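/- **Setting.** Let $d\in\{2,3\}$ and let $\Omega\subset\mathbb R^d$ be a bounded polygonal/polyhedral domain (a connected open set equal to the interior of its closure). Let $\mathbb A$ be a measurable symmetric matrix function on $\Omega$ with $\alpha|\xi|^2\le\xi^T\mathbb A(x)\xi\le\beta|\xi|^2$ for all $x\in\Omega$, $\xi\in\mathbb R^d$, where $0<\alpha\le\beta$. Let $\mathcal T_h$ be a conforming simplicial mesh of $\overline\Omega$ that is shape-regular (with constant $\sigma$) and quasi-uniform (with constant $\tau$, all element diameters being comparable to the characteristic mesh size $h>0$), and let $\mathcal E_h$ be the set of its edges ($d=2$) or faces ($d=3$). Let $j\ge 0$, and let either $l=j$, $G_j=[P_j]^d+\widehat P_j\,\mathbf x$ with $\widehat P_j$ the homogeneous polynomials of degree $j$ (Raviart–Thomas), or $l=j+1$, $G_j=[P_{j+1}]^d$ (Brezzi–Douglas–Marini). Let $V_h$ be the space of pairs $v=\{v_0,v_b\}$ with $v_0|_K\in P_j(K)$ for each $K\in\mathcal T_h$, $v_b|_e\in P_l(e)$ for each $e\in\mathcal E_h$, and $v_b|_e=0$ if $e\subset\partial\Omega$. The weak gradient $\nabla_w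 v$ is given on each $K$ by $\nabla_w v|_K\in G_j$ and $$(\nabla_w v,\mathbf q)_K=-(v_0,\nabla\cdot\mathbf q)_K+\langle v_b,\mathbf q\cdot\mathbf n\rangle_{\partial K}\quad\text{for all }\mathbf q\in G_j,$$ with $\mathbf n$ the outward unit normal. Let $\mathcal V_h\subset H^1_0(\Omega)$ be the space of continuous functions that are affine on each element and vanish on $\partial\Omega$. Equip $\mathcal V_h$ with the $L^2(\Omega)$ inner product $(\cdot,\cdot)$ and $V_h$ with $$((v,\phi))=\sum_{K\in\mathcal T_h}\big[(v_0,\phi_0)_K+h\,(v_0-v_b,\phi_0-\phi_b)_{\partial K}\big].$$ Define $A:V_h\to V_h$ by $((Au,v))=\sum_K(\mathbb A\nabla_w u,\nabla_w v)_K$ and $\mathcal A:\mathcal V_h\to\mathcal V_h$ by $(\mathcal Au,v)=(\mathbb A\nabla u,\nabla v)$, and put $\rho_A=\lambda_{\max}(A)$. Let $\Pi=Q_h=\{Q_0,Q_b\}:\mathcal V_h\to V_h$, where $Q_0$ is the $L^2(K)$ projection onto $P_j(K)$ on each $K$ and $Q_b$ is the $L^2(e)$ projection onto $P_l(e)$ on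 each $e$, and let $\Pi^t:V_h\to\mathcal V_h$ be given by $(\Pi^tv,w)=((v,\Pi w))$. For an operator $T$ with positive real spectrum let $\kappa(T)=\lambda_{\max}(T)/\lambda_{\min}(T)$. **Theorem.** Let $R:V_h\to V_h$ be symmetric with respect to $((\cdot,\cdot))$ and $\mathcal B:\mathcal V_h\to\mathcal V_h$ symmetric with respect to $(\cdot,\cdot)$, and suppose that, with constants $r_0,b_0>0$ and $r_1,b_1$, for all $v\in V_h$ and $w\in\mathcal V_h$, $$r_0\,\rho_A^{-1}((v,v))\le((Rv,v))\le r_1\,\rho_A^{-1}((v,v)),\qquad b_0\,(\mathcal Aw,w)\le(\mathcal B\mathcal Aw,\mathcal Aw)\le b_1\,(\mathcal Aw,w).$$ 1. (Additive.) $B=R+\Pi\mathcal B\Pi^t$ is symmetric and positive definite with respect to $((\cdot,\cdot))$, and $\kappa(BA)\le C$. 2. (Multiplicative.) Suppose in addition that the smoother is convergent, in the sense that $((RAv,Av))\le\omega\,((Av,v))$ for all $v\in V_h$ with a constant $\omega<2$. Then the relation $$I-BA=(I-RA)(I-\Pi\mathcal B\Pi^tA)(I-RA)$$ defines a unique operator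 $B:V_h\to V_h$; it is symmetric and positive definite with respect to $((\cdot,\cdot))$, and $\kappa(BA)\le C_\omega$. Here $C$ depends only on $\Omega$, $d$, $j$, the choice of the pair, $\alpha$, $\beta$, $\sigma$, $\tau$, $r_0,r_1,b_0,b_1$, and $C_\omega$ depends only on these and on $\omega$. Both are independent of the mesh, in particular of $h$, and of $\mathbb A$, $R$, $\mathcal B$ otherwise. -/

import Mathlib

namespace WG

noncomputable section

open MeasureTheory

/-! ### Linear algebra: bilinear forms, Riesz representation, spectral quantities -/

section LinearAlgebra

variable {V W X : Type*} [AddCommGroup V] [Module ℝ V] [AddCommGroup W] [Module ℝ W]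

/-- `(u, v) ↦ ∫ f_u(x) g_v(x) dμ(x)` for linear families of functions `f`, `g`. -/
def intBilin [MeasurableSpace X] (f : V →ₗ[ℝ] (X → ℝ)) (g : W →ₗ[ℝ] (X → ℝ)) (μ : Measure X)
    (h : ∀ u v, Integrable (fun x => f u x * g v x) μ) : V →ₗ[ℝ] W →ₗ[ℝ] ℝ :=
  LinearMap.mk₂ ℝ (fun u v => ∫ x, f u x * g v x ∂μ)
    (fun u u' v => by
      rw [← integral_add (h u v) (h u' v)]
      simp [add_mul])
    (fun c u v => by
      rw [smul_eq_mul, ← integral_const_mul]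
      simp [mul_assoc])
    (fun u v v' => by
      rw [← integral_add (h u v) (h u v')]
      simp [mul_add])
    (fun c u v => by
      rw [smul_eq_mul, ← integral_const_mul]
      simp [mul_left_comm])

theorem intBilin_apply [MeasurableSpace X] (f : V →ₗ[ℝ] (X → ℝ)) (g : W →ₗ[ℝ] (X → ℝ))
    (μ : Measure X) (h : ∀ u v, Integrable (fun x => f u x * g v x) μ) (u : V) (v : W) :
    intBilin f g μ h u v = ∫ x, f u x * g v x ∂μ := rfl

/-- `(u, v) ↦ ∫ (M(x) f_u(x)) ⬝ g_v(x) dμ(x)` for linear families of vector fields `f`, `g` and a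
matrix-valued weight `M`. -/
def intBilinVec {ι : Type*} [Fintype ι] [MeasurableSpace X] (M : X → Matrix ι ι ℝ)
    (f : V →ₗ[ℝ] (X → ι → ℝ)) (g : W →ₗ[ℝ] (X → ι → ℝ)) (μ : Measure X)
    (h : ∀ u v, Integrable (fun x => (M x).mulVec (f u x) ⬝ᵥ g v x) μ) : V →ₗ[ℝ] W →ₗ[ℝ] ℝ :=
  LinearMap.mk₂ ℝ (fun u v => ∫ x, (M x).mulVec (f u x) ⬝ᵥ g v x ∂μ)
    (fun u u' v => by
      rw [← integral_add (h u v) (h u' v)]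
      simp [Matrix.mulVec_add, add_dotProduct])
    (fun c u v => by
      rw [smul_eq_mul, ← integral_const_mul]
      simp [Matrix.mulVec_smul, smul_dotProduct])
    (fun u v v' => by
      rw [← integral_add (h u v) (h u v')]
      simp [dotProduct_add])
    (fun c u v => by
      rw [smul_eq_mul, ← integral_const_mul]
      simp [dotProduct_smul])

theorem intBilinVec_apply {ι : Type*} [Fintype ι] [MeasurableSpace X] (M : X → Matrix ι ι ℝ)
    (f : V →ₗ[ℝ] (X → ι → ℝ)) (g : W →ₗ[ℝ] (X → ι → ℝ)) (μ : Measure X)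
    (h : ∀ u v, Integrable (fun x => (M x).mulVec (f u x) ⬝ᵥ g v x) μ) (u : V) (v : W) :
    intBilinVec M f g μ h u v = ∫ x, (M x).mulVec (f u x) ⬝ᵥ g v x ∂μ := rfl

theorem nondegenerate_of_definite {b : LinearMap.BilinForm ℝ V} (h : ∀ v, b v v = 0 → v = 0) :
    b.Nondegenerate :=
  ⟨fun v hv => h v (hv v), fun v hv => h v (hv v)⟩

/-- The map `T : W → V` with `b (T w) v = a w v` for all `v`, for a definite form `b` on `V`. -/
def riesz [FiniteDimensional ℝ V] (b : LinearMap.BilinForm ℝ V) (hb : b.Nondegenerate)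
    (a : W →ₗ[ℝ] V →ₗ[ℝ] ℝ) : W →ₗ[ℝ] V :=
  (b.toDual hb).symm.toLinearMap ∘ₗ a

theorem riesz_spec [FiniteDimensional ℝ V] (b : LinearMap.BilinForm ℝ V) (hb : b.Nondegenerate)
    (a : W →ₗ[ℝ] V →ₗ[ℝ] ℝ) (w : W) (v : V) : b (riesz b hb a w) v = a w v := by
  simp [riesz]

/-- `T` is symmetric with respect to the inner product `b`. -/
def IsSymmetric (b : LinearMap.BilinForm ℝ V) (T : Module.End ℝ V) : Prop :=
  ∀ u v, b (T u) v = b u (T v)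

/-- `T` is symmetric and positive definite with respect to the inner product `b`. -/
def IsSPD (b : LinearMap.BilinForm ℝ V) (T : Module.End ℝ V) : Prop :=
  IsSymmetric b T ∧ ∀ v, v ≠ 0 → 0 < b (T v) v

/-- The largest eigenvalue of an operator on a finite-dimensional space. -/
def maxEigenvalue (T : Module.End ℝ V) : ℝ := sSup {μ : ℝ | T.HasEigenvalue μ}

/-- The smallest eigenvalue of an operator on a finite-dimensional space. -/
def minEigenvalue (T : Module.End ℝ V) : ℝ := sInf {μ : ℝ | T.HasEigenvalue μ}

/-- The condition number `κ(T) = λ_max(T) / λ_min(T)`. -/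
def condNumber (T : Module.End ℝ V) : ℝ := maxEigenvalue T / minEigenvalue T

end LinearAlgebra

/-! ### Domains, meshes and polynomial spaces -/

/-- The Euclidean space in which the domain lies. -/
abbrev Pt (d : ℕ) := EuclideanSpace ℝ (Fin d)

/-- A bounded domain that is the interior of its closure (no slits or punctures). That its closure
is a polygon or polyhedron is expressed by the meshes below. -/
structure Domain (d : ℕ) where
  carrier : Set (Pt d)
  isOpen : IsOpen carrier
  isConnected : IsConnected carrier
  isBounded : Bornology.IsBounded carrier
  interior_closure : interior (closure carrier) = carrier

/-- A conforming simplicial mesh of the closure of `Ω`, i.e. a finite pure `d`-dimensional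
simplicial complex whose underlying space is the closure of `Ω`, together with its
characteristic mesh size `h`. -/
structure SimplicialMesh {d : ℕ} (Ω : Domain d) where
  complex : Geometry.SimplicialComplex ℝ (Pt d)
  finite : complex.faces.Finite
  pure : ∀ s ∈ complex.faces, ∃ K ∈ complex.faces, s ⊆ K ∧ K.card = d + 1
  space_eq : complex.space = closure Ω.carrier
  h : ℝ
  h_pos : 0 < h

/-- A polynomial as a function. -/
def polyFun (d : ℕ) : MvPolynomial (Fin d) ℝ →ₗ[ℝ] (Pt d → ℝ) where
  toFun p x := MvPolynomial.eval x.ofLp p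
  map_add' p q := by ext x; simp
  map_smul' c p := by ext x; simp [MvPolynomial.smul_eval]

theorem continuous_polyFun {d : ℕ} (p : MvPolynomial (Fin d) ℝ) : Continuous (polyFun d p) := by
  have := MvPolynomial.continuous_eval p
  exact this.comp (PiLp.continuous_ofLp 2 _)

/-- The polynomials of degree at most `k` in `d` variables. -/
abbrev Poly (d k : ℕ) : Submodule ℝ (MvPolynomial (Fin d) ℝ) :=
  MvPolynomial.restrictTotalDegree (Fin d) ℝ k

/-- Restriction of a function to `S`, as a function that is zero off `S`. -/
def restrictTo {d : ℕ} (S : Set (Pt d)) : (Pt d → ℝ) →ₗ[ℝ] (Pt d → ℝ) where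
  toFun f := S.indicator f
  map_add' f g := Set.indicator_add S f g
  map_smul' c f := Set.indicator_const_smul S c f

/-- `P_k(S)`: the functions on `S` (extended by zero off `S`) that are restrictions of polynomials
of degree at most `k`. -/
def polyOn {d : ℕ} (S : Set (Pt d)) (k : ℕ) : Submodule ℝ (Pt d → ℝ) :=
  (Poly d k).map (restrictTo S ∘ₗ polyFun d)

instance {d : ℕ} (S : Set (Pt d)) (k : ℕ) : FiniteDimensional ℝ (polyOn S k) := by
  unfold polyOn; infer_instance

theorem continuousOn_of_mem_polyOn {d k : ℕ} {S : Set (Pt d)} {f : Pt d → ℝ}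
    (hf : f ∈ polyOn S k) : ContinuousOn f S := by
  obtain ⟨p, -, rfl⟩ := hf
  exact (continuous_polyFun p).continuousOn.congr fun x hx => by simp [restrictTo, hx]

theorem eq_zero_off_of_mem_polyOn {d k : ℕ} {S : Set (Pt d)} {f : Pt d → ℝ}
    (hf : f ∈ polyOn S k) {x : Pt d} (hx : x ∉ S) : f x = 0 := by
  obtain ⟨p, -, rfl⟩ := hf
  simp [restrictTo, hx]

theorem poly_eq_zero {d : ℕ} {U : Set (Pt d)} (hU : IsOpen U) (hne : U.Nonempty)
    (p : MvPolynomial (Fin d) ℝ) (hp : ∀ x ∈ U, polyFun d p x = 0) : p = 0 := by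
  obtain ⟨a, ha⟩ := hne
  have hU' : IsOpen ((fun y : Fin d → ℝ => (WithLp.toLp 2 y : Pt d)) ⁻¹' U) :=
    hU.preimage (PiLp.continuous_toLp 2 _)
  obtain ⟨ε, hε, hball⟩ := Metric.isOpen_iff.1 hU' a.ofLp (by simpa using ha)
  refine MvPolynomial.funext_set (fun i => Set.Ioo (a.ofLp i - ε) (a.ofLp i + ε))
    (fun i => Set.Ioo_infinite (by linarith)) fun y hy => ?_
  have hy' : y ∈ Metric.ball a.ofLp ε := by
    rw [ball_pi _ hε]
    intro i hi
    simpa only [Real.ball_eq_Ioo] using hy i hi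
  simpa [polyFun] using hp _ (hball hy')

theorem eqOn_zero_of_integral_sq {X : Type*} [TopologicalSpace X] [MeasurableSpace X]
    [OpensMeasurableSpace X] {μ : Measure X} [μ.IsOpenPosMeasure] {U : Set X} (hU : IsOpen U)
    {f : X → ℝ} (hf : ContinuousOn f U) (hi : IntegrableOn (fun x => f x * f x) U μ)
    (h0 : ∫ x in U, f x * f x ∂μ = 0) : ∀ x ∈ U, f x = 0 := by
  have h1 := (integral_eq_zero_iff_of_nonneg (fun x => mul_self_nonneg (f x)) hi).1 h0
  have h2 := Measure.eqOn_of_ae_eq h1 (hf.mul hf) continuousOn_const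
    (by rw [hU.interior_eq]; exact subset_closure)
  intro x hx
  simpa using h2 hx

namespace SimplicialMesh

variable {d : ℕ} {Ω : Domain d} (T : SimplicialMesh Ω)

/-- The elements (triangles, tetrahedra) of the mesh. -/
structure Cell where
  verts : Finset (Pt d)
  mem : verts ∈ T.complex.faces
  card_eq : verts.card = d + 1

/-- The `(d-1)`-dimensional faces of the mesh (edges if `d = 2`, triangles if `d = 3`). -/
structure Facet where
  verts : Finset (Pt d)
  mem : verts ∈ T.complex.faces
  card_eq : verts.card = d

instance : Fintype T.Cell := by
  haveI := T.finite.to_subtype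
  haveI : Finite T.Cell := Finite.of_injective (β := T.complex.faces) (fun s => ⟨s.verts, s.mem⟩)
    (fun s t hst => by cases s; cases t; simpa using hst)
  exact Fintype.ofFinite _

instance : Fintype T.Facet := by
  haveI := T.finite.to_subtype
  haveI : Finite T.Facet := Finite.of_injective (β := T.complex.faces) (fun s => ⟨s.verts, s.mem⟩)
    (fun s t hst => by cases s; cases t; simpa using hst)
  exact Fintype.ofFinite _

variable {T}

/-- The closed simplex `K`. -/
def Cell.body (K : T.Cell) : Set (Pt d) := convexHull ℝ (K.verts : Set (Pt d))

/-- The interior `K₀` of the simplex `K`. -/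
def Cell.inner (K : T.Cell) : Set (Pt d) := interior K.body

/-- The closed face `e`. -/
def Facet.body (e : T.Facet) : Set (Pt d) := convexHull ℝ (e.verts : Set (Pt d))

open Classical in
/-- The faces that make up `∂K`. -/
def Cell.facets (K : T.Cell) : Finset T.Facet := Finset.univ.filter fun e => e.verts ⊆ K.verts

/-- The surface measure on the face `e`. -/
def Facet.surface (e : T.Facet) : Measure (Pt d) :=
  (Measure.euclideanHausdorffMeasure (d - 1)).restrict e.body

/-- The arithmetic mean of the points of `s`. -/
def barycenter (s : Finset (Pt d)) : Pt d := (s.card : ℝ)⁻¹ • ∑ x ∈ s, x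

/-- The outward unit normal of `K` on its face `e`: the vector from the barycenter of `K` to that
of `e`, projected orthogonally to `e` and normalized. -/
def Cell.normal (K : T.Cell) (e : T.Facet) : Pt d :=
  let w := (vectorSpan ℝ (e.verts : Set (Pt d)))ᗮ.starProjection (barycenter e.verts - barycenter K.verts)
  ‖w‖⁻¹ • w

variable (T)

/-- Shape regularity with constant `σ`. -/
def ShapeRegular (σ : ℝ) : Prop :=
  ∀ K : T.Cell, ∃ x : Pt d, ∃ r : ℝ, 0 < r ∧ Metric.closedBall x r ⊆ K.body ∧
    Metric.diam K.body ≤ σ * r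

/-- Quasi-uniformity with constant `τ`: all elements have diameter comparable to `h`. -/
def QuasiUniform (τ : ℝ) : Prop :=
  ∀ K : T.Cell, Metric.diam K.body ≤ τ * T.h ∧ T.h ≤ τ * Metric.diam K.body

variable {T}

theorem Cell.isCompact_body (K : T.Cell) : IsCompact K.body :=
  K.verts.finite_toSet.isCompact_convexHull ℝ

theorem Facet.isCompact_body (e : T.Facet) : IsCompact e.body :=
  e.verts.finite_toSet.isCompact_convexHull ℝ

theorem Cell.isOpen_inner (K : T.Cell) : IsOpen K.inner := isOpen_interior

theorem Cell.inner_nonempty (K : T.Cell) : K.inner.Nonempty := by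
  unfold Cell.inner Cell.body
  rw [interior_convexHull_nonempty_iff_affineSpan_eq_top]
  have hi := T.complex.indep K.mem
  have := hi.affineSpan_eq_top_iff_card_eq_finrank_add_one.2 (by simpa using K.card_eq)
  simpa using this

theorem Cell.body_subset_closure (K : T.Cell) : K.body ⊆ closure Ω.carrier := by
  rw [← T.space_eq]
  exact Geometry.SimplicialComplex.convexHull_subset_space K.mem

theorem Cell.inner_subset (K : T.Cell) : K.inner ⊆ Ω.carrier := by
  rw [← Ω.interior_closure]
  exact interior_mono K.body_subset_closure

theorem exists_cell_of_mem {x : Pt d} (hx : x ∈ closure Ω.carrier) : ∃ K : T.Cell, x ∈ K.body := by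
  rw [← T.space_eq, Geometry.SimplicialComplex.mem_space_iff] at hx
  obtain ⟨s, hs, hxs⟩ := hx
  obtain ⟨K, hK, hsK, hc⟩ := T.pure s hs
  exact ⟨⟨K, hK, hc⟩, convexHull_mono (by exact_mod_cast hsK) hxs⟩

theorem Facet.exists_cell (e : T.Facet) : ∃ K : T.Cell, e ∈ K.facets := by
  obtain ⟨K, hK, hsK, hc⟩ := T.pure e.verts e.mem
  exact ⟨⟨K, hK, hc⟩, by simpa [Cell.facets] using hsK⟩

theorem Cell.facet_subset {K : T.Cell} {e : T.Facet} (he : e ∈ K.facets) : e.body ⊆ K.body := by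
  classical
  have : e.verts ⊆ K.verts := by simpa [Cell.facets] using he
  exact convexHull_mono (by exact_mod_cast this)

/-- A face as a convex body in a Euclidean space of dimension `d - 1`. -/
theorem Facet.chart (e : T.Facet) : ∃ (W : Submodule ℝ (Pt d)) (a : Pt d),
    e.surface = (volume.restrict ((fun w : W => a + (w : Pt d)) ⁻¹' e.body)).map
      (fun w : W => a + (w : Pt d)) ∧
    IsCompact ((fun w : W => a + (w : Pt d)) ⁻¹' e.body) ∧
    ((fun w : W => a + (w : Pt d)) ⁻¹' e.body ⊆
      closure (interior ((fun w : W => a + (w : Pt d)) ⁻¹' e.body))) ∧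
    e.body ⊆ Set.range (fun w : W => a + (w : Pt d)) := by
  obtain ⟨a, ha⟩ := T.complex.nonempty_of_mem_faces e.mem
  set W : Submodule ℝ (Pt d) := vectorSpan ℝ (e.verts : Set (Pt d)) with hW
  set f : W → Pt d := fun w => a + (w : Pt d) with hf
  have hfi : Isometry f := (isometry_add_left a).comp isometry_subtype_coe
  have hfc : Continuous f := hfi.continuous
  have hrange : e.body ⊆ Set.range f := by
    intro x hx
    have hx' : x ∈ affineSpan ℝ (e.verts : Set (Pt d)) := convexHull_subset_affineSpan _ hx
    have : x -ᵥ a ∈ vectorSpan ℝ (e.verts : Set (Pt d)) := by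
      rw [← direction_affineSpan]
      exact AffineSubspace.vsub_mem_direction hx' (subset_affineSpan ℝ _ ha)
    exact ⟨⟨x -ᵥ a, this⟩, by simp [hf]⟩
  have hconv : Convex ℝ (f ⁻¹' e.body) := by
    have : Convex ℝ ((fun x : Pt d => a + x) ⁻¹' e.body) :=
      (convex_convexHull ℝ (e.verts : Set (Pt d))).translate_preimage_right a
    exact this.linear_preimage W.subtype
  have hcomp : IsCompact (f ⁻¹' e.body) :=
    hfi.isClosedEmbedding.isCompact_preimage e.isCompact_body
  have hspan : affineSpan ℝ (f ⁻¹' e.body) = ⊤ := by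
    have h0 : (0 : W) ∈ f ⁻¹' e.body := by
      simpa [hf, Facet.body] using subset_convexHull ℝ (e.verts : Set (Pt d)) ha
    rw [AffineSubspace.affineSpan_eq_top_iff_vectorSpan_eq_top_of_nonempty ℝ W W ⟨0, h0⟩,
      vectorSpan_eq_span_vsub_set_right ℝ h0, eq_top_iff]
    have h1 : Submodule.span ℝ (f ⁻¹' (e.verts : Set (Pt d))) = ⊤ := by
      apply Submodule.map_injective_of_injective W.injective_subtype
      rw [Submodule.map_span, Submodule.map_top, Submodule.range_subtype]
      refine Eq.trans ?_ (vectorSpan_eq_span_vsub_set_right ℝ (s := (e.verts : Set (Pt d)))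
        (p := a) ha).symm
      congr 1
      ext x
      constructor
      · rintro ⟨w, hw, rfl⟩
        exact ⟨f w, hw, by simp [hf]⟩
      · rintro ⟨y, hy, rfl⟩
        have : y -ᵥ a ∈ W := vsub_mem_vectorSpan ℝ hy ha
        exact ⟨⟨y -ᵥ a, this⟩, by simpa [hf] using hy, rfl⟩
    rw [← h1]
    apply Submodule.span_mono
    intro w hw
    exact ⟨w, subset_convexHull ℝ (e.verts : Set (Pt d)) hw, by simp⟩
  have hint : (interior (f ⁻¹' e.body)).Nonempty :=
    hconv.interior_nonempty_iff_affineSpan_eq_top.2 hspan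
  refine ⟨W, a, ?_, hcomp, ?_, hrange⟩
  · have hrank : Module.finrank ℝ W = d - 1 := by
      have hi := T.complex.indep e.mem
      have hpos : 0 < e.verts.card := Finset.card_pos.2 ⟨a, ha⟩
      have h := hi.finrank_vectorSpan (n := d - 1)
        (by rw [Fintype.card_coe]; have := e.card_eq; omega)
      rw [Subtype.range_coe_subtype] at h
      exact h
    have h1 := hfi.map_euclideanHausdorffMeasure (d := d - 1)
    rw [← hrank, InnerProductSpace.euclideanHausdorffMeasure_eq_volume, hrank] at h1
    rw [Facet.surface, ← Measure.restrict_map hfc.measurable e.isCompact_body.measurableSet, h1,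
      Measure.restrict_restrict e.isCompact_body.measurableSet,
      Set.inter_eq_self_of_subset_left hrange]
  · rw [hconv.closure_interior_eq_closure_of_nonempty_interior hint]
    exact subset_closure

instance (e : T.Facet) : IsFiniteMeasure e.surface := by
  obtain ⟨W, a, h, hc, -, -⟩ := e.chart
  rw [h]
  have : IsFiniteMeasure ((volume : Measure W).restrict
      ((fun w : W => a + (w : Pt d)) ⁻¹' e.body)) := ⟨by simpa using hc.measure_lt_top⟩
  infer_instance

theorem Facet.integrable (e : T.Facet) {f : Pt d → ℝ} (hf : ContinuousOn f e.body) :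
    Integrable f e.surface := by
  have h := hf.integrableOn_compact (μ := e.surface) e.isCompact_body
  rwa [IntegrableOn, Facet.surface, Measure.restrict_restrict e.isCompact_body.measurableSet,
    Set.inter_self] at h

theorem Facet.eq_zero_of_integral_sq (e : T.Facet) {f : Pt d → ℝ} (hf : ContinuousOn f e.body)
    (h0 : ∫ x, f x * f x ∂e.surface = 0) : ∀ x ∈ e.body, f x = 0 := by
  have hi := e.integrable (hf.mul hf)
  have h1 := (integral_eq_zero_iff_of_nonneg (fun x => mul_self_nonneg (f x)) hi).1 h0
  obtain ⟨W, a, h, hc, hcl, hr⟩ := e.chart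
  have hcont : Continuous (fun w : W => a + (w : Pt d)) := by fun_prop
  rw [h] at h1
  have h2 := ae_of_ae_map hcont.aemeasurable h1
  have hfW : ContinuousOn (fun w : W => f (a + (w : Pt d)) * f (a + (w : Pt d)))
      ((fun w : W => a + (w : Pt d)) ⁻¹' e.body) :=
    (hf.mul hf).comp hcont.continuousOn (fun _ hw => hw)
  have h3 := Measure.eqOn_of_ae_eq h2 hfW continuousOn_const hcl
  intro x hx
  obtain ⟨w, rfl⟩ := hr hx
  simpa using h3 hx

theorem Cell.integrableOn (K : T.Cell) {f : Pt d → ℝ} (hf : Continuous f) :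
    IntegrableOn f K.inner :=
  (hf.continuousOn.integrableOn_compact K.isCompact_body).mono_set interior_subset

end SimplicialMesh

/-! ### The weak Galerkin space, the weak gradient and the auxiliary space -/

/-- The two pairs: `W_{j,j}` with Raviart-Thomas, `W_{j,j+1}` with Brezzi-Douglas-Marini. -/
inductive Pair
  | RT
  | BDM

/-- The polynomial degree `l` on faces. -/
def Pair.faceDegree : Pair → ℕ → ℕ
  | RT, j => j
  | BDM, j => j + 1

/-- The local space `G_j` of vector polynomials: `[P_j]^d + P̂_j x` (RT) or `[P_{j+1}]^d` (BDM),
where `P̂_j` are the homogeneous polynomials of degree `j`. -/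
def gradSpace (d : ℕ) : Pair → ℕ → Submodule ℝ (Fin d → MvPolynomial (Fin d) ℝ)
  | Pair.RT, j => Submodule.pi Set.univ (fun _ => Poly d j) ⊔
      (MvPolynomial.homogeneousSubmodule (Fin d) ℝ j).map
        (LinearMap.pi fun i => LinearMap.mulLeft ℝ (MvPolynomial.X i))
  | Pair.BDM, j => Submodule.pi Set.univ (fun _ => Poly d (j + 1))

/-- Divergence of a vector polynomial. -/
def divergence (d : ℕ) : (Fin d → MvPolynomial (Fin d) ℝ) →ₗ[ℝ] MvPolynomial (Fin d) ℝ :=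
  ∑ i, (MvPolynomial.pderiv i).toLinearMap ∘ₗ LinearMap.proj i

/-- Gradient of a polynomial. -/
def gradient (d : ℕ) : MvPolynomial (Fin d) ℝ →ₗ[ℝ] (Fin d → MvPolynomial (Fin d) ℝ) :=
  LinearMap.pi fun i => (MvPolynomial.pderiv i).toLinearMap

/-- A vector polynomial as a vector field. -/
def vecFun (d : ℕ) : (Fin d → MvPolynomial (Fin d) ℝ) →ₗ[ℝ] (Pt d → Fin d → ℝ) where
  toFun q x i := polyFun d (q i) x
  map_add' p q := by ext x i; simp
  map_smul' c p := by ext x i; simp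

/-- The scalar field `q · n` for a constant vector `n`. -/
def fluxFun {d : ℕ} (n : Pt d) : (Fin d → MvPolynomial (Fin d) ℝ) →ₗ[ℝ] (Pt d → ℝ) where
  toFun q x := vecFun d q x ⬝ᵥ n.ofLp
  map_add' p q := by ext x; simp [add_dotProduct]
  map_smul' c p := by ext x; simp [smul_dotProduct]

theorem continuous_vecFun {d : ℕ} (q : Fin d → MvPolynomial (Fin d) ℝ) :
    Continuous (vecFun d q) :=
  continuous_pi fun i => continuous_polyFun (q i)

theorem continuous_fluxFun {d : ℕ} (n : Pt d) (q : Fin d → MvPolynomial (Fin d) ℝ) :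
    Continuous (fluxFun n q) := by
  change Continuous fun x => vecFun d q x ⬝ᵥ n.ofLp
  exact (continuous_vecFun q).dotProduct continuous_const

instance (d : ℕ) (P : Pair) (j : ℕ) : FiniteDimensional ℝ (gradSpace d P j) := by
  have hpi : ∀ k, gradSpace d Pair.BDM k ≤ Submodule.pi Set.univ (fun _ => Poly d (k + 1)) :=
    fun k => le_rfl
  have hfin : ∀ k, FiniteDimensional ℝ
      (Submodule.pi Set.univ (fun _ : Fin d => Poly d k)) := fun k =>
    FiniteDimensional.of_injective
      (LinearMap.pi fun i : Fin d => ((LinearMap.proj i).domRestrict _).codRestrict (Poly d k)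
        (fun q => q.2 i trivial))
      (fun p q h => by
        ext1
        funext i
        exact congrArg Subtype.val (congrFun h i))
  have hhom : FiniteDimensional ℝ (MvPolynomial.homogeneousSubmodule (Fin d) ℝ j) := by
    refine Submodule.finiteDimensional_of_le (S₂ := Poly d j) fun p hp => ?_
    rw [MvPolynomial.mem_restrictTotalDegree]
    exact ((MvPolynomial.mem_homogeneousSubmodule j p).1 hp).totalDegree_le
  cases P
  · unfold gradSpace
    have := hfin j
    infer_instance
  · exact hfin (j + 1)

namespace SimplicialMesh

variable {d : ℕ} {Ω : Domain d} (T : SimplicialMesh Ω) (P : Pair) (j : ℕ)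

/-- The weak Galerkin space `V_h` of pairs `v = {v₀, v_b}`: `v₀` is in `P_j` on each element, `v_b`
is in `P_l` on each face, and `v_b = 0` on the faces in `∂Ω`. -/
def weakSpace : Submodule ℝ ((T.Cell → MvPolynomial (Fin d) ℝ) × (T.Facet → Pt d → ℝ)) where
  carrier := {v | (∀ K, v.1 K ∈ Poly d j) ∧ (∀ e : T.Facet, v.2 e ∈ polyOn e.body (P.faceDegree j)) ∧
    ∀ e : T.Facet, e.body ⊆ frontier Ω.carrier → v.2 e = 0}
  add_mem' := fun {u v} hu hv => ⟨fun K => add_mem (hu.1 K) (hv.1 K),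
    fun e => add_mem (hu.2.1 e) (hv.2.1 e), fun e he => by simp [hu.2.2 e he, hv.2.2 e he]⟩
  zero_mem' := ⟨fun _ => zero_mem _, fun _ => zero_mem _, fun _ _ => rfl⟩
  smul_mem' := fun c v hv => ⟨fun K => Submodule.smul_mem _ c (hv.1 K),
    fun e => Submodule.smul_mem _ c (hv.2.1 e), fun e he => by simp [hv.2.2 e he]⟩

/-- The auxiliary space: continuous functions, affine on each element, zero on `∂Ω` (extended by
zero to the complement of `Ω`). -/
def p1Space : Submodule ℝ (Pt d → ℝ) where
  carrier := {w | Continuous w ∧ (∀ x ∉ Ω.carrier, w x = 0) ∧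
    ∀ K : T.Cell, ∃ p ∈ Poly d 1, ∀ x ∈ K.body, w x = polyFun d p x}
  add_mem' := fun {u v} hu hv => ⟨hu.1.add hv.1,
    fun x hx => by simp [hu.2.1 x hx, hv.2.1 x hx], fun K => by
      obtain ⟨p, hp, hpx⟩ := hu.2.2 K
      obtain ⟨q, hq, hqx⟩ := hv.2.2 K
      exact ⟨p + q, add_mem hp hq, fun x hx => by simp [hpx x hx, hqx x hx]⟩⟩
  zero_mem' := ⟨continuous_const, fun _ _ => rfl, fun _ => ⟨0, zero_mem _, fun _ _ => by simp⟩⟩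
  smul_mem' := fun c v hv => ⟨hv.1.const_smul c,
    fun x hx => by simp [hv.2.1 x hx], fun K => by
      obtain ⟨p, hp, hpx⟩ := hv.2.2 K
      exact ⟨c • p, Submodule.smul_mem _ c hp, fun x hx => by simp [hpx x hx]⟩⟩

variable {T P j}

/-- `v ↦ v₀|_K`, as a polynomial function. -/
def cellVal (K : T.Cell) : T.weakSpace P j →ₗ[ℝ] (Pt d → ℝ) :=
  polyFun d ∘ₗ LinearMap.proj K ∘ₗ LinearMap.fst ℝ _ _ ∘ₗ (T.weakSpace P j).subtype

/-- `v ↦ v_b|_e`. -/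
def facetVal (e : T.Facet) : T.weakSpace P j →ₗ[ℝ] (Pt d → ℝ) :=
  LinearMap.proj e ∘ₗ LinearMap.snd ℝ _ _ ∘ₗ (T.weakSpace P j).subtype

theorem continuous_cellVal (K : T.Cell) (v : T.weakSpace P j) : Continuous (cellVal K v) :=
  continuous_polyFun _

theorem continuousOn_facetVal (e : T.Facet) (v : T.weakSpace P j) :
    ContinuousOn (facetVal e v) e.body :=
  continuousOn_of_mem_polyOn (v.2.2.1 e)

instance : FiniteDimensional ℝ (T.weakSpace P j) := by
  let F : T.weakSpace P j →ₗ[ℝ]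
      ((T.Cell → Poly d j) × (∀ e : T.Facet, polyOn e.body (P.faceDegree j))) :=
    { toFun := fun v => (fun K => ⟨v.1.1 K, v.2.1 K⟩, fun e => ⟨v.1.2 e, v.2.2.1 e⟩)
      map_add' := fun u v => rfl
      map_smul' := fun c v => rfl }
  refine FiniteDimensional.of_injective F fun u v h => ?_
  have h1 := congrArg Prod.fst h
  have h2 := congrArg Prod.snd h
  refine Subtype.ext (Prod.ext ?_ ?_)
  · funext K
    exact congrArg Subtype.val (congrFun h1 K)
  · funext e
    exact congrArg Subtype.val (congrFun h2 e)

instance : FiniteDimensional ℝ T.p1Space := by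
  let F : T.p1Space →ₗ[ℝ] (∀ K : T.Cell, polyOn K.body 1) :=
    { toFun := fun w K => ⟨restrictTo K.body w.1, by
        obtain ⟨p, hp, hpx⟩ := w.2.2.2 K
        refine ⟨p, hp, ?_⟩
        exact Set.indicator_congr fun x hx => (hpx x hx).symm⟩
      map_add' := fun u v => by
        funext K
        exact Subtype.ext (map_add (restrictTo K.body) u.1 v.1)
      map_smul' := fun c v => by
        funext K
        exact Subtype.ext (map_smul (restrictTo K.body) c v.1) }
  refine FiniteDimensional.of_injective F fun u v h => ?_
  refine Subtype.ext (funext fun x => ?_)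
  by_cases hx : x ∈ Ω.carrier
  · obtain ⟨K, hK⟩ := T.exists_cell_of_mem (subset_closure hx)
    have := congrFun (congrArg Subtype.val (congrFun h K)) x
    simpa [F, restrictTo, hK] using this
  · rw [u.2.2.1 x hx, v.2.2.1 x hx]

/-- The discrete inner product
`((v, φ)) = ∑_K [(v₀, φ₀)_K + h (v₀ - v_b, φ₀ - φ_b)_{∂K}]` on `V_h`. -/
def weakInner : LinearMap.BilinForm ℝ (T.weakSpace P j) :=
  ∑ K : T.Cell,
    (intBilin (cellVal K) (cellVal K) (volume.restrict K.inner)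
        (fun u v => K.integrableOn ((continuous_cellVal K u).mul (continuous_cellVal K v))) +
      T.h • ∑ e ∈ K.facets, intBilin (cellVal K - facetVal e) (cellVal K - facetVal e) e.surface
        (fun u v => e.integrable
          (((continuous_cellVal K u).continuousOn.sub (continuousOn_facetVal e u)).mul
          ((continuous_cellVal K v).continuousOn.sub (continuousOn_facetVal e v)))))

theorem weakInner_apply (u v : T.weakSpace P j) :
    weakInner u v = ∑ K : T.Cell, ((∫ x in K.inner, cellVal K u x * cellVal K v x) +
      T.h * ∑ e ∈ K.facets, ∫ x, (cellVal K u x - facetVal e u x) *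
        (cellVal K v x - facetVal e v x) ∂e.surface) := by
  simp [weakInner, LinearMap.sum_apply, intBilin_apply]
  rfl

theorem weakInner_definite (v : T.weakSpace P j) (h0 : weakInner v v = 0) : v = 0 := by
  rw [weakInner_apply] at h0
  have hb : ∀ K : T.Cell, ∀ e ∈ K.facets, 0 ≤ ∫ x, (cellVal K v x - facetVal e v x) *
      (cellVal K v x - facetVal e v x) ∂e.surface :=
    fun K e _ => integral_nonneg fun x => mul_self_nonneg _
  have hc : ∀ K : T.Cell, 0 ≤ ∫ x in K.inner, cellVal K v x * cellVal K v x :=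
    fun K => integral_nonneg fun x => mul_self_nonneg _
  have hs : ∀ K : T.Cell, 0 ≤ T.h * ∑ e ∈ K.facets, ∫ x, (cellVal K v x - facetVal e v x) *
      (cellVal K v x - facetVal e v x) ∂e.surface :=
    fun K => mul_nonneg T.h_pos.le (Finset.sum_nonneg (hb K))
  have h1 := (Finset.sum_eq_zero_iff_of_nonneg fun K _ => add_nonneg (hc K) (hs K)).1 h0
  have hcell : ∀ K : T.Cell, v.1.1 K = 0 := fun K => by
    have := ((add_eq_zero_iff_of_nonneg (hc K) (hs K)).1 (h1 K (Finset.mem_univ K))).1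
    exact poly_eq_zero K.isOpen_inner K.inner_nonempty _
      (eqOn_zero_of_integral_sq K.isOpen_inner (continuous_cellVal K v).continuousOn
        (K.integrableOn ((continuous_cellVal K v).mul (continuous_cellVal K v))) this)
  have hval : ∀ (K : T.Cell) (x : Pt d), cellVal K v x = 0 := fun K x => by
    simp [cellVal, hcell K]
  have hfacet : ∀ e : T.Facet, v.1.2 e = 0 := fun e => by
    obtain ⟨K, hK⟩ := e.exists_cell
    have h2 := ((add_eq_zero_iff_of_nonneg (hc K) (hs K)).1 (h1 K (Finset.mem_univ K))).2
    have h3 := (mul_eq_zero.1 h2).resolve_left T.h_pos.ne'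
    have h4 := (Finset.sum_eq_zero_iff_of_nonneg (hb K)).1 h3 e hK
    have h5 := e.eq_zero_of_integral_sq (f := fun x => cellVal K v x - facetVal e v x)
      ((continuous_cellVal K v).continuousOn.sub (continuousOn_facetVal e v)) h4
    funext x
    by_cases hx : x ∈ e.body
    · have := h5 x hx
      rw [hval, zero_sub, neg_eq_zero] at this
      exact this
    · exact eq_zero_off_of_mem_polyOn (v.2.2.1 e) hx
  exact Subtype.ext (Prod.ext (funext hcell) (funext hfacet))

/-- The `L²(K)` inner product on the local space `G_j`. -/
def gradInner (P : Pair) (j : ℕ) (K : T.Cell) : LinearMap.BilinForm ℝ (gradSpace d P j) :=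
  intBilinVec (fun _ => 1) (vecFun d ∘ₗ (gradSpace d P j).subtype)
    (vecFun d ∘ₗ (gradSpace d P j).subtype) (volume.restrict K.inner)
    (fun p q => by
      simp only [Matrix.one_mulVec]
      exact K.integrableOn ((continuous_vecFun _).dotProduct (continuous_vecFun _)))

theorem gradInner_apply (K : T.Cell) (p q : gradSpace d P j) :
    gradInner P j K p q = ∫ x in K.inner, vecFun d p.1 x ⬝ᵥ vecFun d q.1 x := by
  simp [gradInner, intBilinVec_apply]

theorem gradInner_nondegenerate (P : Pair) (j : ℕ) (K : T.Cell) :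
    (gradInner P j K).Nondegenerate := by
  refine nondegenerate_of_definite fun q h => ?_
  rw [gradInner_apply] at h
  have hi : ∀ i ∈ (Finset.univ : Finset (Fin d)), Integrable
      (fun x => polyFun d (q.1 i) x * polyFun d (q.1 i) x) (volume.restrict K.inner) :=
    fun i _ => K.integrableOn ((continuous_polyFun (q.1 i)).mul (continuous_polyFun (q.1 i)))
  have h' : ∑ i, ∫ x in K.inner, polyFun d (q.1 i) x * polyFun d (q.1 i) x = 0 := by
    rw [← integral_finsetSum _ hi]
    exact h
  have h1 := (Finset.sum_eq_zero_iff_of_nonneg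
    fun i _ => integral_nonneg fun x => mul_self_nonneg _).1 h'
  refine Subtype.ext (funext fun i => ?_)
  exact poly_eq_zero K.isOpen_inner K.inner_nonempty _
    (eqOn_zero_of_integral_sq K.isOpen_inner (continuous_polyFun (q.1 i)).continuousOn
      (hi i (Finset.mem_univ i)) (h1 i (Finset.mem_univ i)))

/-- The right-hand side `-(v₀, ∇·q)_K + ⟨v_b, q·n⟩_{∂K}` in the definition of `∇_w v`. -/
def weakGradRHS (K : T.Cell) : T.weakSpace P j →ₗ[ℝ] gradSpace d P j →ₗ[ℝ] ℝ :=
  -intBilin (cellVal K) (polyFun d ∘ₗ divergence d ∘ₗ (gradSpace d P j).subtype)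
      (volume.restrict K.inner)
      (fun v _ => K.integrableOn ((continuous_cellVal K v).mul (continuous_polyFun _))) +
    ∑ e ∈ K.facets, intBilin (facetVal e) (fluxFun (K.normal e) ∘ₗ (gradSpace d P j).subtype)
      e.surface
      (fun v _ => e.integrable
        ((continuousOn_facetVal e v).mul (continuous_fluxFun _ _).continuousOn))

/-- The discrete weak gradient `∇_w v` on `K`. -/
def weakGrad (K : T.Cell) : T.weakSpace P j →ₗ[ℝ] gradSpace d P j :=
  riesz (gradInner P j K) (gradInner_nondegenerate P j K) (weakGradRHS K)

/-- The defining equation of the discrete weak gradient. -/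
theorem weakGrad_spec (K : T.Cell) (v : T.weakSpace P j) (q : gradSpace d P j) :
    ∫ x in K.inner, vecFun d (weakGrad K v).1 x ⬝ᵥ vecFun d q.1 x =
      -(∫ x in K.inner, cellVal K v x * polyFun d (divergence d q.1) x) +
        ∑ e ∈ K.facets, ∫ x, facetVal e v x * (vecFun d q.1 x ⬝ᵥ (K.normal e).ofLp)
          ∂e.surface := by
  rw [← gradInner_apply, weakGrad, riesz_spec, weakGradRHS]
  simp [LinearMap.sum_apply, intBilin_apply, fluxFun]
  rfl

/-- The `L²(Ω)` inner product on the auxiliary space. -/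
def p1Inner : LinearMap.BilinForm ℝ T.p1Space :=
  intBilin T.p1Space.subtype T.p1Space.subtype (volume.restrict Ω.carrier)
    (fun u v => ((u.2.1.mul v.2.1).continuousOn.integrableOn_compact
      Ω.isBounded.isCompact_closure).mono_set subset_closure)

theorem p1Inner_apply (u v : T.p1Space) :
    p1Inner u v = ∫ x in Ω.carrier, u.1 x * v.1 x := rfl

theorem p1Inner_nondegenerate : (p1Inner (T := T)).Nondegenerate := by
  refine nondegenerate_of_definite fun w h => ?_
  have h1 := eqOn_zero_of_integral_sq Ω.isOpen w.2.1.continuousOn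
    (((w.2.1.mul w.2.1).continuousOn.integrableOn_compact
      Ω.isBounded.isCompact_closure).mono_set subset_closure) h
  refine Subtype.ext (funext fun x => ?_)
  by_cases hx : x ∈ Ω.carrier
  · exact h1 x hx
  · exact w.2.2.1 x hx

/-- The polynomial `w|_K` of a function `w` in the auxiliary space. -/
def cellPoly (K : T.Cell) : T.p1Space →ₗ[ℝ] MvPolynomial (Fin d) ℝ :=
  have key : ∀ p q : MvPolynomial (Fin d) ℝ, (∀ x ∈ K.body, polyFun d p x = polyFun d q x) →
      p = q := fun p q h => by
    rw [← sub_eq_zero]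
    refine poly_eq_zero K.isOpen_inner K.inner_nonempty _ fun x hx => ?_
    simp [h x (interior_subset hx)]
  { toFun := fun w => (w.2.2.2 K).choose
    map_add' := fun u v => key _ _ fun x hx => by
      have hu := (u.2.2.2 K).choose_spec.2 x hx
      have hv := (v.2.2.2 K).choose_spec.2 x hx
      have huv := ((u + v).2.2.2 K).choose_spec.2 x hx
      rw [map_add, Pi.add_apply, ← hu, ← hv, ← huv]
      rfl
    map_smul' := fun c v => key _ _ fun x hx => by
      have hv := (v.2.2.2 K).choose_spec.2 x hx
      have hcv := ((c • v).2.2.2 K).choose_spec.2 x hx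
      rw [RingHom.id_apply, map_smul, Pi.smul_apply, ← hv, ← hcv]
      rfl }

theorem cellPoly_spec (K : T.Cell) (w : T.p1Space) :
    cellPoly K w ∈ Poly d 1 ∧ ∀ x ∈ K.body, w.1 x = polyFun d (cellPoly K w) x :=
  (w.2.2.2 K).choose_spec

/-! ### The projection `Q_h` -/

/-- The `L²(K)` inner product on `P_k(K)`. -/
def cellInner (K : T.Cell) (k : ℕ) : LinearMap.BilinForm ℝ (Poly d k) :=
  intBilin (polyFun d ∘ₗ (Poly d k).subtype) (polyFun d ∘ₗ (Poly d k).subtype)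
    (volume.restrict K.inner)
    (fun p q => K.integrableOn ((continuous_polyFun p.1).mul (continuous_polyFun q.1)))

theorem cellInner_nondegenerate (K : T.Cell) (k : ℕ) : (cellInner K k).Nondegenerate :=
  nondegenerate_of_definite fun p h => Subtype.ext <|
    poly_eq_zero K.isOpen_inner K.inner_nonempty _
      (eqOn_zero_of_integral_sq K.isOpen_inner (continuous_polyFun p.1).continuousOn
        (K.integrableOn ((continuous_polyFun p.1).mul (continuous_polyFun p.1))) h)

/-- The `L²(e)` inner product on `P_k(e)`. -/
def facetInner (e : T.Facet) (k : ℕ) : LinearMap.BilinForm ℝ (polyOn e.body k) :=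
  intBilin (polyOn e.body k).subtype (polyOn e.body k).subtype e.surface
    (fun p q => e.integrable
      ((continuousOn_of_mem_polyOn p.2).mul (continuousOn_of_mem_polyOn q.2)))

theorem facetInner_nondegenerate (e : T.Facet) (k : ℕ) : (facetInner e k).Nondegenerate := by
  refine nondegenerate_of_definite fun p h => Subtype.ext (funext fun x => ?_)
  by_cases hx : x ∈ e.body
  · exact e.eq_zero_of_integral_sq (continuousOn_of_mem_polyOn p.2) h x hx
  · exact eq_zero_off_of_mem_polyOn p.2 hx

/-- `Q₀ w` on `K`: the `L²(K)` projection of `w` to `P_j(K)`. -/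
def projCell (j : ℕ) (K : T.Cell) : T.p1Space →ₗ[ℝ] Poly d j :=
  riesz (cellInner K j) (cellInner_nondegenerate K j)
    (intBilin T.p1Space.subtype (polyFun d ∘ₗ (Poly d j).subtype) (volume.restrict K.inner)
      (fun w p => K.integrableOn (w.2.1.mul (continuous_polyFun p.1))))

theorem projCell_spec (K : T.Cell) (w : T.p1Space) (p : Poly d j) :
    ∫ x in K.inner, polyFun d (projCell j K w).1 x * polyFun d p.1 x =
      ∫ x in K.inner, w.1 x * polyFun d p.1 x :=
  riesz_spec (cellInner K j) (cellInner_nondegenerate K j) _ w p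

/-- `Q_b w` on `e`: the `L²(e)` projection of `w` to `P_l(e)`. -/
def projFacet (l : ℕ) (e : T.Facet) : T.p1Space →ₗ[ℝ] polyOn e.body l :=
  riesz (facetInner e l) (facetInner_nondegenerate e l)
    (intBilin T.p1Space.subtype (polyOn e.body l).subtype e.surface
      (fun w p => e.integrable (w.2.1.continuousOn.mul (continuousOn_of_mem_polyOn p.2))))

theorem projFacet_spec {l : ℕ} (e : T.Facet) (w : T.p1Space) (p : polyOn e.body l) :
    ∫ x, (projFacet l e w).1 x * p.1 x ∂e.surface = ∫ x, w.1 x * p.1 x ∂e.surface :=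
  riesz_spec (facetInner e l) (facetInner_nondegenerate e l) _ w p

theorem projFacet_boundary {l : ℕ} (e : T.Facet) (he : e.body ⊆ frontier Ω.carrier)
    (w : T.p1Space) : projFacet l e w = 0 := by
  have hw : ∀ x ∈ e.body, w.1 x = 0 := fun x hx => by
    have hx' := he hx
    rw [Ω.isOpen.frontier_eq] at hx'
    exact w.2.2.1 x hx'.2
  have h := projFacet_spec e w (projFacet l e w)
  have h0 : ∫ x, w.1 x * (projFacet l e w).1 x ∂e.surface = 0 := by
    rw [Facet.surface, setIntegral_congr_fun (g := fun _ => (0 : ℝ))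
      e.isCompact_body.measurableSet fun x hx => by simp [hw x hx]]
    simp
  exact (facetInner_nondegenerate e l).1 _ fun q => by
    have hz := e.eq_zero_of_integral_sq (continuousOn_of_mem_polyOn (projFacet l e w).2)
      (h.trans h0)
    have : projFacet l e w = 0 := Subtype.ext (funext fun x => by
      by_cases hx : x ∈ e.body
      · exact hz x hx
      · exact eq_zero_off_of_mem_polyOn (projFacet l e w).2 hx)
    simp [this]

/-- The prolongation `Π = Q_h = {Q₀, Q_b}` from the auxiliary space to `V_h`. -/
def prolong (P : Pair) (j : ℕ) : T.p1Space →ₗ[ℝ] T.weakSpace P j where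
  toFun w := ⟨(fun K => (projCell j K w).1, fun e => (projFacet (P.faceDegree j) e w).1),
    fun K => (projCell j K w).2, fun e => (projFacet (P.faceDegree j) e w).2,
    fun e he => by simp [projFacet_boundary e he w]⟩
  map_add' u v := by
    refine Subtype.ext (Prod.ext (funext fun K => ?_) (funext fun e => ?_)) <;> simp
  map_smul' c v := by
    refine Subtype.ext (Prod.ext (funext fun K => ?_) (funext fun e => ?_)) <;> simp

theorem weakInner_nondegenerate : (weakInner (T := T) (P := P) (j := j)).Nondegenerate :=
  nondegenerate_of_definite weakInner_definite

/-- The restriction `Πᵗ`, defined by `(Πᵗ v, w) = ((v, Π w))`. -/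
def restriction (P : Pair) (j : ℕ) : T.weakSpace P j →ₗ[ℝ] T.p1Space :=
  riesz p1Inner p1Inner_nondegenerate (weakInner.compl₂ (prolong P j))

theorem restriction_spec (v : T.weakSpace P j) (w : T.p1Space) :
    p1Inner (restriction P j v) w = weakInner v (prolong P j w) :=
  riesz_spec p1Inner p1Inner_nondegenerate _ v w

end SimplicialMesh

/-! ### The diffusion matrix and the discrete operators -/

/-- A measurable symmetric diffusion matrix on `Ω` with `α|ξ|² ≤ ξᵀ 𝔸(x) ξ ≤ β|ξ|²`. -/
structure DiffusionMatrix {d : ℕ} (Ω : Domain d) (α β : ℝ) where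
  coeff : Pt d → Matrix (Fin d) (Fin d) ℝ
  aemeasurable : ∀ i k, AEMeasurable (fun x => coeff x i k) (volume.restrict Ω.carrier)
  symm : ∀ x ∈ Ω.carrier, (coeff x).IsSymm
  lower : ∀ x ∈ Ω.carrier, ∀ ξ : Fin d → ℝ, α * (ξ ⬝ᵥ ξ) ≤ ξ ⬝ᵥ (coeff x).mulVec ξ
  upper : ∀ x ∈ Ω.carrier, ∀ ξ : Fin d → ℝ, ξ ⬝ᵥ (coeff x).mulVec ξ ≤ β * (ξ ⬝ᵥ ξ)

namespace DiffusionMatrix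

variable {d : ℕ} {Ω : Domain d} {α β : ℝ} (𝔸 : DiffusionMatrix Ω α β)

theorem abs_coeff_le {x : Pt d} (hx : x ∈ Ω.carrier) (i k : Fin d) :
    |𝔸.coeff x i k| ≤ 2 * (|α| + |β|) := by
  have ha := abs_nonneg α
  have hb := abs_nonneg β
  have ha1 := neg_abs_le α
  have hb1 := le_abs_self β
  have hdiag : ∀ i, α ≤ 𝔸.coeff x i i ∧ 𝔸.coeff x i i ≤ β := fun i => by
    have h1 := 𝔸.lower x hx (Pi.single i 1)
    have h2 := 𝔸.upper x hx (Pi.single i 1)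
    simp at h1 h2
    exact ⟨h1, h2⟩
  by_cases hik : i = k
  · subst hik
    rw [abs_le]
    constructor <;> linarith [hdiag i]
  · have h1 := 𝔸.lower x hx (Pi.single i 1 + Pi.single k 1)
    have h2 := 𝔸.upper x hx (Pi.single i 1 + Pi.single k 1)
    have hs : 𝔸.coeff x k i = 𝔸.coeff x i k := (𝔸.symm x hx).apply i k
    simp [Matrix.mulVec_add, add_dotProduct, dotProduct_add, hik, Ne.symm hik, hs] at h1 h2
    rw [abs_le]
    constructor <;> linarith [hdiag i, hdiag k]

theorem integrable {T : SimplicialMesh Ω} (K : T.Cell) {f g : Pt d → Fin d → ℝ}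
    (hf : Continuous f) (hg : Continuous g) :
    Integrable (fun x => (𝔸.coeff x).mulVec (f x) ⬝ᵥ g x) (volume.restrict K.inner) := by
  have h : ∀ i k, Integrable (fun x => 𝔸.coeff x i k * (f x k * g x i))
      (volume.restrict K.inner) := fun i k => by
    have hc : Continuous fun x => f x k * g x i :=
      ((continuous_apply k).comp hf).mul ((continuous_apply i).comp hg)
    refine Integrable.bdd_mul (c := 2 * (|α| + |β|)) (K.integrableOn hc) ?_ ?_
    · exact ((𝔸.aemeasurable i k).mono_measure
        (Measure.restrict_mono K.inner_subset le_rfl)).aestronglyMeasurable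
    · exact (ae_restrict_iff' K.isOpen_inner.measurableSet).2
        (Filter.Eventually.of_forall fun x hx => 𝔸.abs_coeff_le (K.inner_subset hx) i k)
  refine (integrable_finsetSum Finset.univ fun i _ =>
    integrable_finsetSum Finset.univ fun k _ => h i k).congr
    (Filter.Eventually.of_forall fun x => ?_)
  simp [Matrix.mulVec, dotProduct, Finset.sum_mul, mul_assoc]

end DiffusionMatrix

namespace SimplicialMesh

variable {d : ℕ} {Ω : Domain d} {T : SimplicialMesh Ω} {α β : ℝ}

/-- The bilinear form `a_h(u, v) = (𝔸 ∇_w u, ∇_w v)` on `V_h`. -/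
def weakForm (P : Pair) (j : ℕ) (𝔸 : DiffusionMatrix Ω α β) :
    LinearMap.BilinForm ℝ (T.weakSpace P j) :=
  ∑ K : T.Cell, intBilinVec 𝔸.coeff (vecFun d ∘ₗ (gradSpace d P j).subtype ∘ₗ weakGrad K)
    (vecFun d ∘ₗ (gradSpace d P j).subtype ∘ₗ weakGrad K) (volume.restrict K.inner)
    (fun _ _ => 𝔸.integrable K (continuous_vecFun _) (continuous_vecFun _))

theorem weakForm_apply {P : Pair} {j : ℕ} (𝔸 : DiffusionMatrix Ω α β) (u v : T.weakSpace P j) :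
    weakForm P j 𝔸 u v = ∑ K : T.Cell, ∫ x in K.inner,
      (𝔸.coeff x).mulVec (vecFun d (weakGrad K u).1 x) ⬝ᵥ vecFun d (weakGrad K v).1 x := by
  simp [weakForm, LinearMap.sum_apply, intBilinVec_apply]

/-- The bilinear form `(𝔸 ∇u, ∇v)` on the auxiliary space. -/
def p1Form (𝔸 : DiffusionMatrix Ω α β) : LinearMap.BilinForm ℝ T.p1Space :=
  ∑ K : T.Cell, intBilinVec 𝔸.coeff (vecFun d ∘ₗ gradient d ∘ₗ cellPoly K)
    (vecFun d ∘ₗ gradient d ∘ₗ cellPoly K) (volume.restrict K.inner)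
    (fun _ _ => 𝔸.integrable K (continuous_vecFun _) (continuous_vecFun _))

theorem p1Form_apply (𝔸 : DiffusionMatrix Ω α β) (u v : T.p1Space) :
    p1Form 𝔸 u v = ∑ K : T.Cell, ∫ x in K.inner,
      (𝔸.coeff x).mulVec (vecFun d (gradient d (cellPoly K u)) x) ⬝ᵥ
        vecFun d (gradient d (cellPoly K v)) x := by
  simp [p1Form, LinearMap.sum_apply, intBilinVec_apply]

/-- The operator `A` on `V_h`: `((A u, v)) = (𝔸 ∇_w u, ∇_w v)`. -/
def weakOp (P : Pair) (j : ℕ) (𝔸 : DiffusionMatrix Ω α β) : Module.End ℝ (T.weakSpace P j) :=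
  riesz weakInner weakInner_nondegenerate (weakForm P j 𝔸)

theorem weakOp_spec {P : Pair} {j : ℕ} (𝔸 : DiffusionMatrix Ω α β) (u v : T.weakSpace P j) :
    weakInner (weakOp P j 𝔸 u) v = weakForm P j 𝔸 u v :=
  riesz_spec weakInner weakInner_nondegenerate _ u v

/-- The operator `𝒜` on the auxiliary space: `(𝒜 u, v) = (𝔸 ∇u, ∇v)`. -/
def p1Op (𝔸 : DiffusionMatrix Ω α β) : Module.End ℝ T.p1Space :=
  riesz p1Inner p1Inner_nondegenerate (p1Form 𝔸)

theorem p1Op_spec (𝔸 : DiffusionMatrix Ω α β) (u v : T.p1Space) :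
    p1Inner (p1Op 𝔸 u) v = p1Form 𝔸 u v :=
  riesz_spec p1Inner p1Inner_nondegenerate _ u v

/-- The additive preconditioner `B = R + Π ℬ Πᵗ`. -/
def additive {P : Pair} {j : ℕ} (R : Module.End ℝ (T.weakSpace P j))
    (S : Module.End ℝ T.p1Space) : Module.End ℝ (T.weakSpace P j) :=
  R + prolong P j ∘ₗ S ∘ₗ restriction P j

/-- `B` is the symmetric multiplicative preconditioner, defined implicitly by
`I - B A = (I - R A) (I - Π ℬ Πᵗ A) (I - R A)`. -/
def IsMultiplicative {P : Pair} {j : ℕ} (𝔸 : DiffusionMatrix Ω α β)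
    (R : Module.End ℝ (T.weakSpace P j)) (S : Module.End ℝ T.p1Space)
    (B : Module.End ℝ (T.weakSpace P j)) : Prop :=
  1 - B * weakOp P j 𝔸 =
    (1 - R * weakOp P j 𝔸) * (1 - (prolong P j ∘ₗ S ∘ₗ restriction P j) * weakOp P j 𝔸) *
      (1 - R * weakOp P j 𝔸)

end SimplicialMesh

end

end WG

open WG
open WG.SimplicialMesh (weakInner p1Inner weakOp p1Op additive IsMultiplicative)

/-! Spectra are read off in the energy form a(u, v) = ((Au, v)). Put q(v) = ((RAv, Av)) and c(v) =
(ℬΠᵗAv, ΠᵗAv). For the additive preconditioner a(BAv, v) = q(v) + c(v), so κ(BA) is bounded once q +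
c is equivalent to a. The upper bound uses R ≤ r₁/ρ_A and the energy stability of Π (`coarse_le`).
The lower bound is the fictitious-space argument (`energy_le`): every v splits as Πw + (v - Πw),
where both the energy of w and ρ_A ‖v - Πw‖² are at most a constant times a(v, v).

For the multiplicative preconditioner put y = (I - RA)v. Then a(BAv, v) = a(v, v) - a(y, y) + c(y).
A convergent smoother gives a(v, v) - a(y, y) ≥ (2 - ω) q(v) ≥ (2 - ω) q(y), and the additive lower
bound at y turns q(y) + c(y) into control of a(y, y). The coarse solver needs no scaling, because c
enters with a plus sign.

What remains concerns the weak Galerkin space. Π is stable because ∇_w Πw is the local L² projection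
of ∇w onto G_j (`integral_weakGrad_prolong`). For the splitting, ∇_w v is tested against well-chosen
fields of G_j. A field with zero normal component on ∂K recovers ∇v₀ (`exists_radial_field`), and a
lift of v₀ - v_b from one face recovers the jump (`exists_lift`). Hence ‖∇_w v‖² controls ‖∇v₀‖² and
h⁻¹ times the squared jumps (`exists_energy_le`).

The function w has as nodal value at an interior vertex the value of v₀ from some element there, and
zero at boundary vertices. The error at a vertex is a chain of face jumps inside the star of that
vertex; at a boundary vertex the chain ends at a boundary face, where v_b = 0
(`starGraph_dichotomy`, `exists_nodeVal_sub_le`). This gives ‖v - Πw‖² ≤ C h² ‖∇_w v‖²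
(`exists_splitting`), and the inverse estimate ρ_A ≤ C h⁻² (`exists_weakForm_le`) cancels the power
of h.

The only geometry used is that of a simplicial complex filling the closure of Ω and the identity
between Ω and the interior of its closure. No elliptic regularity and no Lipschitz boundary enter,
and the constants come out independent of Ω. -/

namespace WG
noncomputable section
open MeasureTheory

/-! ### Abstract auxiliary space preconditioning -/

section Preconditioner

variable {V W : Type*} [AddCommGroup V] [Module ℝ V] [AddCommGroup W] [Module ℝ W]

/-- A symmetric positive definite bilinear form. -/
structure IsInner (b : LinearMap.BilinForm ℝ V) : Prop where
  symm : ∀ u v, b u v = b v u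
  pos : ∀ v, v ≠ 0 → 0 < b v v

theorem IsInner.nonneg {b : LinearMap.BilinForm ℝ V} (hb : IsInner b) (v : V) : 0 ≤ b v v := by
  by_cases h : v = 0
  · simp [h]
  · exact (hb.pos v h).le

/-- Expand b(su - v, su - v) ≥ 0 and divide by s. Semidefiniteness is enough; this generality serves
the form (u, v) ↦ ((RAu, Av)) below. -/
theorem two_mul_le_of_nonneg {b : LinearMap.BilinForm ℝ V} (hs : ∀ u v, b u v = b v u)
    (hp : ∀ v, 0 ≤ b v v) {s : ℝ} (hs0 : 0 < s) (u v : V) :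
    2 * b u v ≤ s * b u u + s⁻¹ * b v v := by
  have h := hp (s • u - v)
  simp only [map_sub, map_smul, LinearMap.sub_apply, LinearMap.smul_apply, smul_eq_mul,
    hs v u] at h
  have h2 := mul_nonneg (inv_pos.2 hs0).le h
  have : s⁻¹ * s = 1 := inv_mul_cancel₀ hs0.ne'
  have e : s⁻¹ * (s * (s * b u u - b u v) - (s * b u v - b v v)) =
      (s⁻¹ * s) * (s * b u u) - 2 * ((s⁻¹ * s) * b u v) + s⁻¹ * b v v := by ring
  rw [e, this] at h2
  linarith

theorem IsInner.two_mul_le {b : LinearMap.BilinForm ℝ V} (hb : IsInner b) {s : ℝ} (hs : 0 < s)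
    (u v : V) : 2 * b u v ≤ s * b u u + s⁻¹ * b v v :=
  two_mul_le_of_nonneg hb.symm hb.nonneg hs u v

/-- The condition number is bounded by the ratio of the bounds of the Rayleigh quotient. -/
theorem condNumber_le {a : LinearMap.BilinForm ℝ V} (ha : IsInner a) {T : Module.End ℝ V}
    {m M : ℝ} (hm : 0 < m) (hM : 0 ≤ M) (hl : ∀ v, m * a v v ≤ a (T v) v)
    (hu : ∀ v, a (T v) v ≤ M * a v v) : condNumber T ≤ M / m := by
  have hmem : ∀ μ ∈ {μ : ℝ | T.HasEigenvalue μ}, m ≤ μ ∧ μ ≤ M := fun μ hμ => by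
    obtain ⟨v, hv⟩ := Module.End.HasEigenvalue.exists_hasEigenvector hμ
    have hpos := ha.pos v hv.2
    have h1 := hl v
    have h2 := hu v
    rw [hv.apply_eq_smul, map_smul, LinearMap.smul_apply, smul_eq_mul] at h1 h2
    exact ⟨le_of_mul_le_mul_right h1 hpos, le_of_mul_le_mul_right h2 hpos⟩
  unfold condNumber maxEigenvalue minEigenvalue
  -- Without eigenvalues (as on the zero space) both `sSup ∅` and `sInf ∅` are 0, and 0 / 0 = 0.
  -- This is where M ≥ 0 is needed.
  rcases Set.eq_empty_or_nonempty {μ : ℝ | T.HasEigenvalue μ} with h | h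
  · rw [h]
    simp [div_nonneg hM hm.le]
  · exact div_le_div₀ hM (csSup_le h fun μ hμ => (hmem μ hμ).2) hm
      (le_csInf h fun μ hμ => (hmem μ hμ).1)

/-- Make b the inner product and expand v in an orthonormal eigenbasis with coefficients cᵢ. The
claim becomes ∑ λᵢ² cᵢ² ≤ λ_max ∑ λᵢ cᵢ², which holds because 0 ≤ λᵢ ≤ λ_max. -/
theorem apply_apply_le_maxEigenvalue [FiniteDimensional ℝ V] {b : LinearMap.BilinForm ℝ V}
    (hb : IsInner b) {A : Module.End ℝ V} (hA : IsSymmetric b A) (hp : ∀ v, 0 ≤ b (A v) v) (v : V) :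
    b (A v) (A v) ≤ maxEigenvalue A * b (A v) v := by
  classical
  let core : InnerProductSpace.Core ℝ V :=
    { inner := fun u v => b u v
      conj_inner_symm := fun u v => by simpa using hb.symm v u
      re_inner_nonneg := fun v => by simpa using hb.nonneg v
      add_left := fun u v w => by simp
      smul_left := fun u v r => by simp
      definite := fun v h => by
        by_contra hv
        exact (hb.pos v hv).ne' h }
  let _ : NormedAddCommGroup V := core.toNormedAddCommGroup
  let _ : InnerProductSpace ℝ V := InnerProductSpace.ofCore core.toCore
  have hin : ∀ u v : V, inner ℝ u v = b u v := fun u v => rfl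
  have hsym : LinearMap.IsSymmetric A := fun u v => by rw [hin, hin]; exact hA u v
  let e := hsym.eigenvectorBasis rfl
  let ev := hsym.eigenvalues rfl
  have hev : ∀ i, A.HasEigenvalue (ev i) := fun i => hsym.hasEigenvalue_eigenvalues rfl i
  have hAe : ∀ i, A (e i) = ev i • e i := fun i => hsym.apply_eigenvectorBasis rfl i
  have hle : ∀ i, ev i ≤ maxEigenvalue A := fun i =>
    le_csSup (Module.End.finite_hasEigenvalue A).bddAbove (hev i)
  have hnn : ∀ i, 0 ≤ ev i := fun i => by
    have h := hp (e i)
    rw [hAe, map_smul, LinearMap.smul_apply, smul_eq_mul, ← hin, real_inner_self_eq_norm_sq,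
      e.orthonormal.1 i] at h
    simpa using h
  have hcoef : ∀ i, inner ℝ (A v) (e i) = ev i * inner ℝ v (e i) := fun i => by
    rw [hsym v (e i), hAe, inner_smul_right]
  rw [← hin, ← hin, ← e.sum_inner_mul_inner, ← e.sum_inner_mul_inner, Finset.mul_sum]
  refine Finset.sum_le_sum fun i _ => ?_
  rw [real_inner_comm (A v) (e i), real_inner_comm v (e i), hcoef]
  have h1 : 0 ≤ ev i * inner ℝ v (e i) * inner ℝ v (e i) := by
    rw [mul_assoc]; exact mul_nonneg (hnn i) (mul_self_nonneg _)
  have h2 := mul_le_mul_of_nonneg_right (hle i) h1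
  linarith

/-- Positivity follows from the preceding inequality at any v ≠ 0. It also shows that an eigenvalue
exists, since the supremum of the empty set would be 0. -/
theorem maxEigenvalue_pos_and_le [FiniteDimensional ℝ V] [Nontrivial V]
    {b : LinearMap.BilinForm ℝ V} (hb : IsInner b) {A : Module.End ℝ V} (hA : IsSPD b A) {M : ℝ}
    (hM : ∀ v, b (A v) v ≤ M * b v v) : 0 < maxEigenvalue A ∧ maxEigenvalue A ≤ M := by
  have hp : ∀ v, 0 ≤ b (A v) v := fun v => by
    by_cases h : v = 0
    · simp [h]
    · exact (hA.2 v h).le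
  obtain ⟨v, hv⟩ := exists_ne (0 : V)
  have hpos : 0 < maxEigenvalue A := by
    have h1 := apply_apply_le_maxEigenvalue hb hA.1 hp v
    have hAv : A v ≠ 0 := fun h => by simpa [h] using hA.2 v hv
    exact pos_of_mul_pos_left ((hb.pos _ hAv).trans_le h1) (hp v)
  refine ⟨hpos, csSup_le ?_ fun μ hμ => ?_⟩
  · by_contra h
    rw [Set.not_nonempty_iff_eq_empty] at h
    simp [maxEigenvalue, h] at hpos
  · obtain ⟨w, hw⟩ := Module.End.HasEigenvalue.exists_hasEigenvector hμ
    have h := hM w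
    rw [hw.apply_eq_smul, map_smul, LinearMap.smul_apply, smul_eq_mul] at h
    exact le_of_mul_le_mul_right h (hb.pos w hw.2)

/-- The hypotheses on an auxiliary space preconditioner: energy forms `a`, `a'` with operators
`A`, `A'`, the transfer operators `Q`, `Qt`, the smoother `R` and the auxiliary solver `S`. The form
`q v = (R A v, A v)` of the smoother is compared with the stable splitting through `ρ`. -/
structure AuxiliarySpace (b a : LinearMap.BilinForm ℝ V) (c a' : LinearMap.BilinForm ℝ W)
    (A R : Module.End ℝ V) (A' S : Module.End ℝ W) (Q : W →ₗ[ℝ] V) (Qt : V →ₗ[ℝ] W)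
    (r₀ r₁ b₀ b₁ ρ C₁ C₂ C₃ : ℝ) : Prop where
  inner_b : IsInner b
  inner_a : IsInner a
  inner_c : IsInner c
  inner_a' : IsInner a'
  A_spec : ∀ u v, b (A u) v = a u v
  A'_spec : ∀ u v, c (A' u) v = a' u v
  Qt_spec : ∀ v w, c (Qt v) w = b v (Q w)
  R_symm : IsSymmetric b R
  S_symm : IsSymmetric c S
  r₀_pos : 0 < r₀
  b₀_pos : 0 < b₀
  r₁_nonneg : 0 ≤ r₁
  b₁_nonneg : 0 ≤ b₁
  ρ_pos : 0 < ρ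
  C₁_pos : 0 < C₁
  C₂_pos : 0 < C₂
  C₃_pos : 0 < C₃
  R_lower : ∀ v, r₀ * (ρ⁻¹ * b v v) ≤ b (R v) v
  R_upper : ∀ v, b (R v) v ≤ r₁ * (ρ⁻¹ * b v v)
  S_lower : ∀ w, b₀ * c (A' w) w ≤ c (S (A' w)) (A' w)
  S_upper : ∀ w, c (S (A' w)) (A' w) ≤ b₁ * c (A' w) w
  A_le : ∀ v, b (A v) (A v) ≤ ρ * a v v
  Q_stable : ∀ w, a (Q w) (Q w) ≤ C₁ * a' w w
  split : ∀ v, ∃ w, a' w w ≤ C₂ * a v v ∧ ρ * b (v - Q w) (v - Q w) ≤ C₃ * a v v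

namespace AuxiliarySpace

variable {b a : LinearMap.BilinForm ℝ V} {c a' : LinearMap.BilinForm ℝ W}
    {A R : Module.End ℝ V} {A' S : Module.End ℝ W} {Q : W →ₗ[ℝ] V} {Qt : V →ₗ[ℝ] W}
    {r₀ r₁ b₀ b₁ ρ C₁ C₂ C₃ : ℝ}
    (H : AuxiliarySpace b a c a' A R A' S Q Qt r₀ r₁ b₀ b₁ ρ C₁ C₂ C₃)

include H

theorem a_eq (u v : V) : a u v = b u (A v) := by
  rw [H.inner_a.symm, ← H.A_spec, H.inner_b.symm]

theorem b_Q (w : W) (v : V) : b (Q w) v = c w (Qt v) := by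
  rw [H.inner_b.symm, ← H.Qt_spec, H.inner_c.symm]

theorem A_injective : Function.Injective A := by
  rw [injective_iff_map_eq_zero]
  intro v hv
  by_contra h
  have := H.inner_a.pos v h
  rw [← H.A_spec, hv] at this
  simp at this

theorem A_surjective [FiniteDimensional ℝ V] : Function.Surjective A :=
  LinearMap.injective_iff_surjective.1 H.A_injective

theorem A'_surjective [FiniteDimensional ℝ W] : Function.Surjective A' := by
  refine LinearMap.injective_iff_surjective.1 ((injective_iff_map_eq_zero _).2 fun v hv => ?_)
  by_contra h
  have := H.inner_a'.pos v h
  rw [← H.A'_spec, hv] at this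
  simp at this

theorem R_nonneg (v : V) : 0 ≤ b (R v) v :=
  (mul_nonneg H.r₀_pos.le (mul_nonneg (inv_pos.2 H.ρ_pos).le (H.inner_b.nonneg v))).trans
    (H.R_lower v)

theorem R_pos (v : V) (hv : v ≠ 0) : 0 < b (R v) v :=
  (mul_pos H.r₀_pos (mul_pos (inv_pos.2 H.ρ_pos) (H.inner_b.pos v hv))).trans_le (H.R_lower v)

theorem S_nonneg [FiniteDimensional ℝ W] (u : W) : 0 ≤ c (S u) u := by
  obtain ⟨y, rfl⟩ := H.A'_surjective u
  refine le_trans ?_ (H.S_lower y)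
  rw [H.A'_spec]
  exact mul_nonneg H.b₀_pos.le (H.inner_a'.nonneg y)

theorem smoother_le (v : V) : b (R (A v)) (A v) ≤ r₁ * a v v := by
  refine (H.R_upper _).trans (mul_le_mul_of_nonneg_left ?_ H.r₁_nonneg)
  rw [inv_mul_le_iff₀ H.ρ_pos]
  exact H.A_le v

/-- Duality. The solution y of 𝒜y = ΠᵗAv satisfies a'(y, y) = a(v, Πy), so y is the energy adjoint
of Π applied to v, and the stability of Π gives a'(y, y) ≤ C₁ a(v, v). -/
theorem coarse_le [FiniteDimensional ℝ W] (v : V) :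
    c (S (Qt (A v))) (Qt (A v)) ≤ b₁ * C₁ * a v v := by
  obtain ⟨y, hy⟩ := H.A'_surjective (Qt (A v))
  have h1 : a' y y = a v (Q y) := by
    rw [← H.A'_spec, hy, H.Qt_spec, H.A_spec]
  have h2 := H.inner_a.two_mul_le H.C₁_pos v (Q y)
  have h3 : C₁⁻¹ * a (Q y) (Q y) ≤ a' y y := by
    rw [inv_mul_le_iff₀ H.C₁_pos]; exact H.Q_stable y
  have h4 : a' y y ≤ C₁ * a v v := by linarith
  rw [← hy]
  refine (H.S_upper y).trans ?_
  rw [H.A'_spec, mul_assoc]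
  exact mul_le_mul_of_nonneg_left h4 H.b₁_nonneg

/-- With the stable splitting v = Πw + (v - Πw) and 𝒜y = ΠᵗAv, the energy is a(v, v) = ((Av, v -
Πw)) + a'(y, w). Young's inequality separates Av and y, which R and ℬ bound from above, from the two
parts of the splitting, which a(v, v) bounds. -/
theorem energy_le [FiniteDimensional ℝ W] (v : V) :
    a v v ≤ 2 * (C₃ / r₀ + C₂ / b₀) *
      (b (R (A v)) (A v) + c (S (Qt (A v))) (Qt (A v))) := by
  obtain ⟨w, hw, hz⟩ := H.split v
  obtain ⟨y, hy⟩ := H.A'_surjective (Qt (A v))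
  have hdec : a v v = b (A v) (v - Q w) + a' y w := by
    rw [map_sub, ← H.A'_spec, hy, H.Qt_spec, H.A_spec]
    ring
  -- The Young weights 2C₃/ρ and 2C₂ make each of the two splitting terms at most a(v, v)/2, so that
  -- together they are absorbed on the left.
  have hs1 : 0 < 2 * C₃ / ρ := div_pos (mul_pos two_pos H.C₃_pos) H.ρ_pos
  have h1 := H.inner_b.two_mul_le hs1 (A v) (v - Q w)
  have h2 := H.inner_a'.two_mul_le (mul_pos two_pos H.C₂_pos) y w
  have h3 : 2 * C₃ / ρ * b (A v) (A v) ≤ 2 * (C₃ / r₀) * b (R (A v)) (A v) := by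
    have := mul_le_mul_of_nonneg_left (H.R_lower (A v))
      (div_pos (mul_pos two_pos H.C₃_pos) H.r₀_pos).le
    have hr := H.r₀_pos.ne'
    calc _ = 2 * C₃ / r₀ * (r₀ * (ρ⁻¹ * b (A v) (A v))) := by field_simp
      _ ≤ _ := this
      _ = _ := by ring
  have h4 : (2 * C₃ / ρ)⁻¹ * b (v - Q w) (v - Q w) ≤ a v v / 2 := by
    rw [inv_mul_le_iff₀ hs1]
    have hρ := H.ρ_pos
    calc _ = ρ⁻¹ * (ρ * b (v - Q w) (v - Q w)) := by field_simp
      _ ≤ ρ⁻¹ * (C₃ * a v v) := mul_le_mul_of_nonneg_left hz (inv_pos.2 hρ).le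
      _ = _ := by field_simp
  have h5 : 2 * C₂ * a' y y ≤ 2 * (C₂ / b₀) * c (S (Qt (A v))) (Qt (A v)) := by
    have h := H.S_lower y
    rw [H.A'_spec, hy] at h
    have := mul_le_mul_of_nonneg_left h (div_pos (mul_pos two_pos H.C₂_pos) H.b₀_pos).le
    have hr := H.b₀_pos.ne'
    calc _ = 2 * C₂ / b₀ * (b₀ * a' y y) := by field_simp
      _ ≤ _ := this
      _ = _ := by ring
  have h6 : (2 * C₂)⁻¹ * a' w w ≤ a v v / 2 := by
    rw [inv_mul_le_iff₀ (mul_pos two_pos H.C₂_pos)]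
    linarith
  have hR := H.R_nonneg (A v)
  have hS := H.S_nonneg (Qt (A v))
  have h7 := mul_nonneg (div_pos H.C₃_pos H.r₀_pos).le hS
  have h8 := mul_nonneg (div_pos H.C₂_pos H.b₀_pos).le hR
  nlinarith

theorem additive_isSPD [FiniteDimensional ℝ W] : IsSPD b (R + Q ∘ₗ S ∘ₗ Qt) := by
  refine ⟨fun u v => ?_, fun v hv => ?_⟩
  · simp only [LinearMap.add_apply, LinearMap.comp_apply, map_add, H.b_Q]
    rw [H.R_symm, H.S_symm, ← H.Qt_spec]
  · simp only [LinearMap.add_apply, LinearMap.comp_apply, map_add, H.b_Q]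
    exact add_pos_of_pos_of_nonneg (H.R_pos v hv) (H.S_nonneg _)

theorem additive_condNumber_le [FiniteDimensional ℝ W] :
    condNumber ((R + Q ∘ₗ S ∘ₗ Qt) * A) ≤
      (r₁ + b₁ * C₁) / (2 * (C₃ / r₀ + C₂ / b₀))⁻¹ := by
  have hK : 0 < 2 * (C₃ / r₀ + C₂ / b₀) := mul_pos two_pos
    (add_pos (div_pos H.C₃_pos H.r₀_pos) (div_pos H.C₂_pos H.b₀_pos))
  have key : ∀ v, a (((R + Q ∘ₗ S ∘ₗ Qt) * A) v) v =
      b (R (A v)) (A v) + c (S (Qt (A v))) (Qt (A v)) := fun v => by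
    rw [H.a_eq]
    simp [H.b_Q]
  refine condNumber_le H.inner_a (inv_pos.2 hK)
    (add_nonneg H.r₁_nonneg (mul_nonneg H.b₁_nonneg H.C₁_pos.le)) (fun v => ?_) fun v => ?_
  · rw [key, inv_mul_le_iff₀ hK]
    exact H.energy_le v
  · rw [key, add_mul]
    exact add_le_add (H.smoother_le v) (H.coarse_le v)

/-- The symmetrized multiplicative operator is bounded from above and from below in the energy. -/
theorem multiplicative_bounds [FiniteDimensional ℝ W] {ω : ℝ} (hω1 : 1 ≤ ω) (hω2 : ω < 2)
    (hR : ∀ v, b (R (A v)) (A v) ≤ ω * b (A v) v) {T : Module.End ℝ V}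
    (hT : 1 - T = (1 - R * A) * (1 - (Q ∘ₗ S ∘ₗ Qt) * A) * (1 - R * A)) :
    (∀ u v, a (T u) v = a u (T v)) ∧
    (∀ v, (1 + 2 * (C₃ / r₀ + C₂ / b₀) / (2 - ω))⁻¹ * a v v ≤ a (T v) v) ∧
    ∀ v, a (T v) v ≤ (1 + b₁ * C₁) * a v v := by
  have hK : 0 < 2 * (C₃ / r₀ + C₂ / b₀) := mul_pos two_pos
    (add_pos (div_pos H.C₃_pos H.r₀_pos) (div_pos H.C₂_pos H.b₀_pos))
  have hT' : ∀ v, T v = v - (1 - R * A) ((1 - (Q ∘ₗ S ∘ₗ Qt) * A) ((1 - R * A) v)) := fun v => by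
    have := LinearMap.congr_fun hT v
    simp only [LinearMap.sub_apply, Module.End.mul_apply, Module.End.one_apply] at this ⊢
    rw [← this, sub_sub_cancel]
  have hs : ∀ u v, a ((1 - R * A) u) v = a u ((1 - R * A) v) := fun u v => by
    simp only [LinearMap.sub_apply, Module.End.mul_apply, Module.End.one_apply, map_sub]
    rw [H.a_eq (R (A u)), H.R_symm, H.A_spec]
  have hc : ∀ u v, a ((1 - (Q ∘ₗ S ∘ₗ Qt) * A) u) v = a u v - c (S (Qt (A u))) (Qt (A v)) :=
    fun u v => by
      simp only [LinearMap.sub_apply, Module.End.mul_apply, Module.End.one_apply, map_sub,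
        LinearMap.comp_apply]
      rw [H.a_eq (Q _), H.b_Q]
  have hform : ∀ u v, a (T u) v = a u v - (a ((1 - R * A) u) ((1 - R * A) v) -
      c (S (Qt (A ((1 - R * A) u)))) (Qt (A ((1 - R * A) v)))) := fun u v => by
    rw [hT', map_sub, LinearMap.sub_apply, hs, hc]
  have hy : ∀ v, a v v - a ((1 - R * A) v) ((1 - R * A) v) =
      2 * b (R (A v)) (A v) - a (R (A v)) (R (A v)) := fun v => by
    simp only [LinearMap.sub_apply, Module.End.mul_apply, Module.End.one_apply, map_sub]
    rw [H.inner_a.symm v (R (A v)), H.a_eq (R (A v)) v]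
    ring
  -- Since RA ≤ ω in energy, (RA)² ≤ ω RA. The proof is Young's inequality with weight ω in the
  -- semidefinite form ((RAu, Av)), applied to v and RAv.
  have hRR : ∀ v, a (R (A v)) (R (A v)) ≤ ω * b (R (A v)) (A v) := fun v => by
    have h := two_mul_le_of_nonneg (b := b.compl₁₂ (R ∘ₗ A) A)
      (fun u v => by simp [H.R_symm (A u), H.inner_b.symm (A u)])
      (fun v => by simpa using H.R_nonneg (A v)) (lt_of_lt_of_le one_pos hω1) v (R (A v))
    simp only [LinearMap.compl₁₂_apply, LinearMap.comp_apply] at h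
    rw [← H.a_eq] at h
    have h2 : ω⁻¹ * b (R (A (R (A v)))) (A (R (A v))) ≤ a (R (A v)) (R (A v)) := by
      rw [inv_mul_le_iff₀ (lt_of_lt_of_le one_pos hω1), ← H.A_spec (R (A v))]
      exact hR _
    linarith
  -- The expansion is q(v) - 2 a(RAv, RAv) + q(RAv), and q(RAv) ≤ ω a(RAv, RAv) with ω < 2.
  have hq : ∀ v, b (R (A ((1 - R * A) v))) (A ((1 - R * A) v)) ≤ b (R (A v)) (A v) := fun v => by
    have h := hR (R (A v))
    have h3 : b (R (A (R (A v)))) (A v) = a (R (A v)) (R (A v)) := by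
      rw [H.R_symm, H.A_spec]
    simp only [LinearMap.sub_apply, Module.End.mul_apply, Module.End.one_apply, map_sub]
    rw [← H.a_eq (R (A v)) (R (A v)), h3]
    rw [H.A_spec] at h
    have := H.inner_a.nonneg (R (A v))
    nlinarith
  refine ⟨fun u v => ?_, fun v => ?_, fun v => ?_⟩
  · rw [hform, H.inner_a.symm u (T v), hform, H.inner_a.symm v u,
      H.inner_a.symm ((1 - R * A) v), H.S_symm, H.inner_c.symm (Qt _)]
  · have h1 := hform v v
    have h2 := hy v
    have h3 := hRR v
    have h4 := hq v
    have h5 := H.energy_le ((1 - R * A) v)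
    have h6 := H.S_nonneg (Qt (A ((1 - R * A) v)))
    have h0 : 0 < 2 - ω := by linarith
    set y := (1 - R * A) v
    -- Here ω ≥ 1 is used: as 2 - ω ≤ 1, the coarse term may carry the same factor as the smoother
    -- term.
    have h7 : (2 - ω) * (b (R (A y)) (A y) + c (S (Qt (A y))) (Qt (A y))) ≤ a (T v) v := by
      have := mul_le_mul_of_nonneg_left h4 h0.le
      nlinarith
    have h8 : a y y ≤ 2 * (C₃ / r₀ + C₂ / b₀) / (2 - ω) * a (T v) v := by
      refine h5.trans ?_
      rw [div_mul_eq_mul_div, mul_div_assoc]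
      refine mul_le_mul_of_nonneg_left ?_ hK.le
      rw [le_div_iff₀ h0]
      linarith
    rw [inv_mul_le_iff₀ (by have := div_pos hK h0; linarith)]
    linarith
  · have h1 := hform v v
    have h2 := hy v
    have h3 := hRR v
    have h4 := H.coarse_le ((1 - R * A) v)
    have h5 := H.R_nonneg (A v)
    have h6 := H.inner_a.nonneg ((1 - R * A) v)
    have h7 : a ((1 - R * A) v) ((1 - R * A) v) ≤ a v v := by nlinarith
    have h8 := mul_le_mul_of_nonneg_left h7 (mul_nonneg H.b₁_nonneg H.C₁_pos.le)
    linarith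

/-- A is bijective, so the relation determines B. Symmetry and positivity of BA in the energy form
are those of B in the inner product, because every vector has the form Ax. -/
theorem multiplicative [FiniteDimensional ℝ V] [FiniteDimensional ℝ W] {ω : ℝ} (hω1 : 1 ≤ ω)
    (hω2 : ω < 2) (hR : ∀ v, b (R (A v)) (A v) ≤ ω * b (A v) v) :
    (∃! B : Module.End ℝ V,
      1 - B * A = (1 - R * A) * (1 - (Q ∘ₗ S ∘ₗ Qt) * A) * (1 - R * A)) ∧
    ∀ B : Module.End ℝ V,
      1 - B * A = (1 - R * A) * (1 - (Q ∘ₗ S ∘ₗ Qt) * A) * (1 - R * A) →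
      IsSPD b B ∧ condNumber (B * A) ≤
        (1 + b₁ * C₁) / (1 + 2 * (C₃ / r₀ + C₂ / b₀) / (2 - ω))⁻¹ := by
  have hK : 0 < (1 + 2 * (C₃ / r₀ + C₂ / b₀) / (2 - ω))⁻¹ := by
    have : 0 < 2 * (C₃ / r₀ + C₂ / b₀) / (2 - ω) := div_pos (mul_pos two_pos
      (add_pos (div_pos H.C₃_pos H.r₀_pos) (div_pos H.C₂_pos H.b₀_pos))) (by linarith)
    positivity
  constructor
  · let Ae := LinearEquiv.ofBijective A ⟨H.A_injective, H.A_surjective⟩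
    have hAe : Ae.symm.toLinearMap * A = 1 := by
      ext v
      exact Ae.symm_apply_apply v
    have hAe' : A * Ae.symm.toLinearMap = 1 := by
      ext v
      exact Ae.apply_symm_apply v
    refine ⟨(1 - (1 - R * A) * (1 - (Q ∘ₗ S ∘ₗ Qt) * A) * (1 - R * A)) * Ae.symm.toLinearMap,
      ?_, fun B hB => ?_⟩
    · simp only [mul_assoc _ Ae.symm.toLinearMap, hAe, mul_one, sub_sub_cancel]
    · rw [← hB, sub_sub_cancel, mul_assoc, hAe', mul_one]
  · intro B hB
    obtain ⟨h1, h2, h3⟩ := H.multiplicative_bounds hω1 hω2 hR hB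
    refine ⟨⟨fun u v => ?_, fun v hv => ?_⟩, condNumber_le H.inner_a hK
      (by have := mul_nonneg H.b₁_nonneg H.C₁_pos.le; linarith) h2 h3⟩
    · obtain ⟨x, rfl⟩ := H.A_surjective u
      obtain ⟨y, rfl⟩ := H.A_surjective v
      have := h1 x y
      rwa [H.a_eq, ← H.A_spec x] at this
    · obtain ⟨x, rfl⟩ := H.A_surjective v
      have := h2 x
      rw [show a ((B * A) x) x = b (B (A x)) (A x) from H.a_eq _ _] at this
      refine lt_of_lt_of_le (mul_pos hK (H.inner_a.pos x ?_)) this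
      rintro rfl
      simp at hv

end AuxiliarySpace

end Preconditioner


/-! ### Polynomials: affine substitution, scaling, norm equivalence -/

section Polynomials

variable {d n : ℕ}

theorem mem_Poly {k : ℕ} {p : MvPolynomial (Fin d) ℝ} : p ∈ Poly d k ↔ p.totalDegree ≤ k :=
  MvPolynomial.mem_restrictTotalDegree _ _ _

theorem Poly_mono {k l : ℕ} (h : k ≤ l) : Poly d k ≤ Poly d l := fun _ hp =>
  mem_Poly.2 ((mem_Poly.1 hp).trans h)

theorem mul_mem_Poly {k l : ℕ} {p q : MvPolynomial (Fin d) ℝ} (hp : p ∈ Poly d k)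
    (hq : q ∈ Poly d l) : p * q ∈ Poly d (k + l) :=
  mem_Poly.2 ((MvPolynomial.totalDegree_mul p q).trans (add_le_add (mem_Poly.1 hp) (mem_Poly.1 hq)))

theorem C_mem_Poly (k : ℕ) (c : ℝ) : (MvPolynomial.C c : MvPolynomial (Fin d) ℝ) ∈ Poly d k :=
  mem_Poly.2 (by simp)

theorem X_mem_Poly (i : Fin d) : (MvPolynomial.X i : MvPolynomial (Fin d) ℝ) ∈ Poly d 1 :=
  mem_Poly.2 (by simp)

theorem pderiv_mem_Poly {k : ℕ} {p : MvPolynomial (Fin d) ℝ} (hp : p ∈ Poly d k) (i : Fin d) :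
    MvPolynomial.pderiv i p ∈ Poly d (k - 1) := by
  classical
  have hp' := mem_Poly.1 hp
  rw [MvPolynomial.as_sum p, map_sum]
  refine Submodule.sum_mem _ fun s hs => ?_
  rw [MvPolynomial.pderiv_monomial]
  by_cases h0 : s i = 0
  · simp [h0]
  refine mem_Poly.2 ((MvPolynomial.totalDegree_monomial_le _ _).trans ?_)
  have h1 := (MvPolynomial.le_totalDegree hs).trans hp'
  have h2 : Finsupp.single i 1 ≤ s := by
    rw [Finsupp.single_le_iff]; omega
  have h3 : (s - Finsupp.single i 1) + Finsupp.single i 1 = s := tsub_add_cancel_of_le h2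
  have h4 := congrArg Finsupp.degree h3
  rw [map_add, Finsupp.degree_single] at h4
  change (s.degree : ℕ) ≤ k at h1
  change ((s - Finsupp.single i 1).degree : ℕ) ≤ k - 1
  omega

@[simp] theorem polyFun_mul (p q : MvPolynomial (Fin d) ℝ) (x : Pt d) :
    polyFun d (p * q) x = polyFun d p x * polyFun d q x := by
  simp [polyFun]

@[simp] theorem polyFun_C (c : ℝ) (x : Pt d) : polyFun d (MvPolynomial.C c) x = c := by
  simp [polyFun]

@[simp] theorem polyFun_X (i : Fin d) (x : Pt d) : polyFun d (MvPolynomial.X i) x = x i := by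
  simp [polyFun]

theorem polyFun_sum {ι : Type*} (s : Finset ι) (f : ι → MvPolynomial (Fin d) ℝ) (x : Pt d) :
    polyFun d (∑ i ∈ s, f i) x = ∑ i ∈ s, polyFun d (f i) x := by
  rw [map_sum, Finset.sum_apply]

/-- An affine function as a polynomial. -/
def affPoly (f : Pt d →ᵃ[ℝ] ℝ) : MvPolynomial (Fin d) ℝ :=
  MvPolynomial.C (f 0) +
    ∑ i, MvPolynomial.C (f.linear (EuclideanSpace.single i 1)) * MvPolynomial.X i

theorem affPoly_mem (f : Pt d →ᵃ[ℝ] ℝ) : affPoly f ∈ Poly d 1 :=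
  add_mem (C_mem_Poly _ _) (sum_mem fun i _ => by
    simpa using mul_mem_Poly (C_mem_Poly 0 _) (X_mem_Poly i))

theorem sum_smul_single (x : Pt d) : ∑ i, x i • (EuclideanSpace.single i 1 : Pt d) = x := by
  have := (EuclideanSpace.basisFun (Fin d) ℝ).sum_repr x
  simpa using this

@[simp] theorem polyFun_affPoly (f : Pt d →ᵃ[ℝ] ℝ) (x : Pt d) : polyFun d (affPoly f) x = f x := by
  have h1 : f x = f 0 + f.linear x := by
    have := f.map_vadd 0 x
    simp only [vadd_eq_add, add_zero] at this
    rw [this, add_comm]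
  have h2 : f.linear x = ∑ i, f.linear (EuclideanSpace.single i 1) * x i := by
    conv_lhs => rw [← sum_smul_single x]
    rw [map_sum]
    exact Finset.sum_congr rfl fun i _ => by rw [map_smul, smul_eq_mul, mul_comm]
  rw [h1, h2, affPoly, map_add, Pi.add_apply, polyFun_sum]
  simp

/-- The `i`-th coordinate of an affine map. -/
def affCoord (g : Pt n →ᵃ[ℝ] Pt d) (i : Fin d) : Pt n →ᵃ[ℝ] ℝ :=
  (EuclideanSpace.proj i : Pt d →L[ℝ] ℝ).toLinearMap.toAffineMap.comp g

@[simp] theorem affCoord_apply (g : Pt n →ᵃ[ℝ] Pt d) (i : Fin d) (z : Pt n) :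
    affCoord g i z = g z i := rfl

/-- Composition of a polynomial with an affine map. -/
def substPoly (g : Pt n →ᵃ[ℝ] Pt d) : MvPolynomial (Fin d) ℝ →ₐ[ℝ] MvPolynomial (Fin n) ℝ :=
  MvPolynomial.aeval fun i => affPoly (affCoord g i)

@[simp] theorem polyFun_substPoly (g : Pt n →ᵃ[ℝ] Pt d) (p : MvPolynomial (Fin d) ℝ) (z : Pt n) :
    polyFun n (substPoly g p) z = polyFun d p (g z) := by
  induction p using MvPolynomial.induction_on with
  | C a => rw [substPoly, MvPolynomial.aeval_C]; simp [MvPolynomial.algebraMap_eq]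
  | add p q hp hq => simp [hp, hq]
  | mul_X p i hp =>
    rw [map_mul, polyFun_mul, hp, polyFun_mul, polyFun_X, substPoly, MvPolynomial.aeval_X,
      polyFun_affPoly, affCoord_apply]

theorem substPoly_mem {k : ℕ} (g : Pt n →ᵃ[ℝ] Pt d) {p : MvPolynomial (Fin d) ℝ}
    (hp : p ∈ Poly d k) : substPoly g p ∈ Poly n k := by
  rw [MvPolynomial.as_sum p, map_sum]
  refine Submodule.sum_mem _ fun s hs => ?_
  rw [substPoly, MvPolynomial.aeval_monomial, MvPolynomial.algebraMap_eq, mem_Poly]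
  refine (MvPolynomial.totalDegree_mul _ _).trans ?_
  rw [MvPolynomial.totalDegree_C, zero_add, Finsupp.prod]
  refine (MvPolynomial.totalDegree_finsetProd _ _).trans ?_
  refine le_trans (Finset.sum_le_sum (g := fun i => s i) fun i _ => ?_)
    ((MvPolynomial.le_totalDegree hs).trans (mem_Poly.1 hp))
  refine (MvPolynomial.totalDegree_pow _ _).trans ?_
  have := mem_Poly.1 (affPoly_mem (affCoord g i))
  nlinarith

theorem hasDerivAt_polyFun (p : MvPolynomial (Fin d) ℝ) (x v : Pt d) (t : ℝ) :
    HasDerivAt (fun t : ℝ => polyFun d p (x + t • v))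
      (∑ i, v i * polyFun d (MvPolynomial.pderiv i p) (x + t • v)) t := by
  classical
  induction p using MvPolynomial.induction_on with
  | C a => simpa using hasDerivAt_const t a
  | add p q hp hq =>
    have hfun : (fun t : ℝ => polyFun d (p + q) (x + t • v)) =
        (fun t : ℝ => polyFun d p (x + t • v)) + fun t : ℝ => polyFun d q (x + t • v) := by
      ext t; simp
    rw [hfun]
    refine (hp.add hq).congr_deriv ?_
    simp only [map_add, Pi.add_apply, mul_add, Finset.sum_add_distrib]
  | mul_X p i hp =>
    have h : HasDerivAt (fun t : ℝ => polyFun d (MvPolynomial.X i) (x + t • v)) (v i) t := by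
      simpa using ((hasDerivAt_id t).mul_const (v i)).const_add (x i)
    have hfun : (fun t : ℝ => polyFun d (p * MvPolynomial.X i) (x + t • v)) =
        (fun t : ℝ => polyFun d p (x + t • v)) *
          fun t : ℝ => polyFun d (MvPolynomial.X i) (x + t • v) := by
      ext t; rw [polyFun_mul]; rfl
    rw [hfun]
    refine (hp.mul h).congr_deriv ?_
    simp only [MvPolynomial.pderiv_mul, map_add, Pi.add_apply, polyFun_mul, mul_add,
      Finset.sum_add_distrib, Finset.sum_mul, MvPolynomial.pderiv_X]
    congr 1
    · exact Finset.sum_congr rfl fun j _ => by ring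
    · rw [Finset.sum_eq_single i]
      · rw [Pi.single_eq_same, mul_comm, ← MvPolynomial.C_1, polyFun_C, mul_one]
      · intro j _ hj
        simp [hj.symm]
      · simp

/-- The squared Euclidean norm of a vector polynomial at a point. -/
def sqNorm (q : Fin d → MvPolynomial (Fin d) ℝ) (x : Pt d) : ℝ := vecFun d q x ⬝ᵥ vecFun d q x

theorem sqNorm_eq (q : Fin d → MvPolynomial (Fin d) ℝ) (x : Pt d) :
    sqNorm q x = ∑ i, polyFun d (q i) x ^ 2 := by
  simp [sqNorm, vecFun, dotProduct, sq]

theorem sqNorm_nonneg (q : Fin d → MvPolynomial (Fin d) ℝ) (x : Pt d) : 0 ≤ sqNorm q x := by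
  rw [sqNorm_eq]; positivity

theorem continuous_sqNorm (q : Fin d → MvPolynomial (Fin d) ℝ) : Continuous (sqNorm q) :=
  (continuous_vecFun q).dotProduct (continuous_vecFun q)

theorem dot_sq_le {ι : Type*} [Fintype ι] (u v : ι → ℝ) : (u ⬝ᵥ v) ^ 2 ≤ (u ⬝ᵥ u) * (v ⬝ᵥ v) := by
  have := Finset.sum_mul_sq_le_sq_mul_sq Finset.univ u v
  simpa [dotProduct, sq] using this

theorem dot_self_eq (v : Pt d) : v.ofLp ⬝ᵥ v.ofLp = ‖v‖ ^ 2 := by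
  rw [EuclideanSpace.real_norm_sq_eq]
  simp [dotProduct, sq]

theorem polyFun_sub_sq_le {p : MvPolynomial (Fin d) ℝ} {x y : Pt d} {M : ℝ}
    (h : ∀ z ∈ segment ℝ x y, sqNorm (gradient d p) z ≤ M) :
    (polyFun d p y - polyFun d p x) ^ 2 ≤ M * ‖y - x‖ ^ 2 := by
  have hM : 0 ≤ M := (sqNorm_nonneg _ _).trans (h x (left_mem_segment ℝ x y))
  have key := Convex.norm_image_sub_le_of_norm_hasDerivWithin_le (𝕜 := ℝ)
    (f := fun t : ℝ => polyFun d p (x + t • (y - x))) (s := Set.Icc 0 1) (x := 0) (y := 1)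
    (C := √(M * ‖y - x‖ ^ 2))
    (fun t _ => (hasDerivAt_polyFun p x (y - x) t).hasDerivWithinAt)
    (fun t ht => by
      refine Real.abs_le_sqrt ?_
      have h1 := dot_sq_le (y - x).ofLp (vecFun d (gradient d p) (x + t • (y - x)))
      rw [dot_self_eq, mul_comm] at h1
      refine le_trans h1 (mul_le_mul_of_nonneg_right (h _ ?_) (sq_nonneg _))
      rw [segment_eq_image']
      exact ⟨t, ht, rfl⟩)
    (convex_Icc 0 1) (by simp) (by simp)
  simp only [one_smul, add_sub_cancel, zero_smul, add_zero, sub_zero, norm_one, mul_one] at key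
  have h2 := pow_le_pow_left₀ (norm_nonneg _) key 2
  rwa [Real.sq_sqrt (by positivity), Real.norm_eq_abs, sq_abs] at h2

/-- The form b serves as the norm of V; a linear map on a finite-dimensional normed space is
continuous. -/
theorem exists_norm_sq_le {V E : Type*} [AddCommGroup V] [Module ℝ V] [FiniteDimensional ℝ V]
    [NormedAddCommGroup E] [NormedSpace ℝ E] {b : LinearMap.BilinForm ℝ V} (hb : IsInner b)
    (L : V →ₗ[ℝ] E) : ∃ C > 0, ∀ v, ‖L v‖ ^ 2 ≤ C * b v v := by
  let core : InnerProductSpace.Core ℝ V :=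
    { inner := fun u v => b u v
      conj_inner_symm := fun u v => by simpa using hb.symm v u
      re_inner_nonneg := fun v => by simpa using hb.nonneg v
      add_left := fun u v w => by simp
      smul_left := fun u v r => by simp
      definite := fun v h => by
        by_contra hv
        exact (hb.pos v hv).ne' h }
  let _ : NormedAddCommGroup V := core.toNormedAddCommGroup
  let _ : InnerProductSpace ℝ V := InnerProductSpace.ofCore core.toCore
  let L' : V →L[ℝ] E := LinearMap.toContinuousLinearMap L
  refine ⟨‖L'‖ ^ 2 + 1, by positivity, fun v => ?_⟩
  have h1 : b v v = ‖v‖ ^ 2 := (real_inner_self_eq_norm_sq v)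
  have h2 : ‖L v‖ ≤ ‖L'‖ * ‖v‖ := L'.le_opNorm v
  have h3 := pow_le_pow_left₀ (norm_nonneg _) h2 2
  rw [h1]
  nlinarith [sq_nonneg ‖v‖]

theorem integrableOn_ball {f : Pt d → ℝ} (hf : Continuous f) (x : Pt d) (r : ℝ) :
    IntegrableOn f (Metric.ball x r) :=
  (hf.continuousOn.integrableOn_compact (isCompact_closedBall x r)).mono_set
    Metric.ball_subset_closedBall

/-- The `L²` inner product of polynomials over the unit ball. -/
def ballInner (d k : ℕ) : LinearMap.BilinForm ℝ (Poly d k) :=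
  intBilin (polyFun d ∘ₗ (Poly d k).subtype) (polyFun d ∘ₗ (Poly d k).subtype)
    (volume.restrict (Metric.ball 0 1))
    (fun p q => integrableOn_ball ((continuous_polyFun p.1).mul (continuous_polyFun q.1)) 0 1)

theorem ballInner_apply (d k : ℕ) (p q : Poly d k) :
    ballInner d k p q = ∫ x in Metric.ball 0 1, polyFun d p.1 x * polyFun d q.1 x := rfl

theorem ballInner_self (d k : ℕ) (p : Poly d k) :
    ballInner d k p p = ∫ x in Metric.ball 0 1, polyFun d p.1 x ^ 2 := by
  simp only [ballInner_apply, sq]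

theorem isInner_ballInner (d k : ℕ) : IsInner (ballInner d k) where
  symm p q := by
    rw [ballInner_apply, ballInner_apply]
    exact integral_congr_ae (Filter.Eventually.of_forall fun x => mul_comm _ _)
  pos p hp := by
    have h0 : 0 ≤ ballInner d k p p := by
      rw [ballInner_self]; exact integral_nonneg fun x => sq_nonneg _
    refine lt_of_le_of_ne h0 fun h => hp (Subtype.ext ?_)
    exact poly_eq_zero Metric.isOpen_ball ⟨0, by simp⟩ _
      (eqOn_zero_of_integral_sq Metric.isOpen_ball (continuous_polyFun p.1).continuousOn
        (integrableOn_ball ((continuous_polyFun p.1).mul (continuous_polyFun p.1)) 0 1) h.symm)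

/-- On polynomials of bounded degree, a linear operator is bounded, in the maximum norm over a
ball, by the `L²` norm over the unit ball. -/
theorem exists_operator_sq_le (d k : ℕ) (D : Poly d k →ₗ[ℝ] MvPolynomial (Fin n) ℝ) (Λ : ℝ) :
    ∃ C > 0, ∀ p : Poly d k, ∀ z ∈ Metric.closedBall (0 : Pt n) Λ,
      polyFun n (D p) z ^ 2 ≤ C * ∫ x in Metric.ball 0 1, polyFun d p.1 x ^ 2 := by
  have : CompactSpace (Metric.closedBall (0 : Pt n) Λ) :=
    isCompact_iff_compactSpace.1 (isCompact_closedBall _ _)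
  -- With the maximum norm of C(ball) on the target, the pointwise bound is boundedness of a linear
  -- map on a finite-dimensional space.
  let L : Poly d k →ₗ[ℝ] C(Metric.closedBall (0 : Pt n) Λ, ℝ) :=
    { toFun := fun p => ⟨fun z => polyFun n (D p) z.1,
        (continuous_polyFun _).comp continuous_subtype_val⟩
      map_add' := fun p q => by ext z; simp
      map_smul' := fun c p => by ext z; simp }
  obtain ⟨C, hC, h⟩ := exists_norm_sq_le (isInner_ballInner d k) L
  refine ⟨C, hC, fun p z hz => ?_⟩
  rw [← ballInner_self]
  refine le_trans ?_ (h p)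
  have h1 := ContinuousMap.norm_coe_le_norm (L p) ⟨z, hz⟩
  rw [← sq_abs]
  exact pow_le_pow_left₀ (abs_nonneg _) h1 2

/-- The affine map `z ↦ x + r z`. -/
def scaling (x : Pt d) (r : ℝ) : Pt d →ᵃ[ℝ] Pt d := AffineMap.const ℝ (Pt d) x + r • AffineMap.id ℝ (Pt d)

@[simp] theorem scaling_apply (x : Pt d) (r : ℝ) (z : Pt d) : scaling x r z = x + r • z := by
  simp [scaling]

theorem setIntegral_scaling (f : Pt d → ℝ) (x : Pt d) {r : ℝ} (hr : 0 < r) :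
    ∫ z in Metric.ball 0 1, f (x + r • z) = (r ^ d)⁻¹ * ∫ y in Metric.ball x r, f y := by
  have h := Measure.setIntegral_comp_smul (volume : Measure (Pt d)) (fun y => f (x + y))
    (Metric.ball 0 1) hr.ne'
  rw [h, finrank_euclideanSpace_fin, abs_of_pos (by positivity), smul_unitBall_of_pos hr, smul_eq_mul]
  congr 1
  have h2 := (measurePreserving_add_left (volume : Measure (Pt d)) x).setIntegral_preimage_emb
    (measurableEmbedding_addLeft x) f (Metric.ball x r)
  rw [← h2]
  congr 2
  ext z
  simp [dist_eq_norm]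

/-- Pull back to the unit ball by z ↦ x + rz. The degree is preserved and the Jacobian contributes
r⁻ᵈ, so one constant serves all balls. -/
theorem exists_ball_sq_le (d k : ℕ) (Λ : ℝ) : ∃ C > 0, ∀ p ∈ Poly d k, ∀ (x : Pt d) (r : ℝ), 0 < r →
    ∀ y ∈ Metric.closedBall x (Λ * r),
      polyFun d p y ^ 2 ≤ C * ((r ^ d)⁻¹ * ∫ z in Metric.ball x r, polyFun d p z ^ 2) := by
  obtain ⟨C, hC, h⟩ := exists_operator_sq_le (n := d) d k (Poly d k).subtype Λ
  refine ⟨C, hC, fun p hp x r hr y hy => ?_⟩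
  have h1 := h ⟨substPoly (scaling x r) p, substPoly_mem _ hp⟩ (r⁻¹ • (y - x)) (by
    rw [mem_closedBall_zero_iff, norm_smul, norm_inv, Real.norm_of_nonneg hr.le, ← dist_eq_norm,
      inv_mul_le_iff₀ hr, mul_comm]
    exact hy)
  simp only [Submodule.subtype_apply, polyFun_substPoly, scaling_apply, smul_inv_smul₀ hr.ne',
    add_sub_cancel] at h1
  rwa [setIntegral_scaling (fun z => polyFun d p z ^ 2) x hr] at h1

theorem exists_ball_pderiv_sq_le (d k : ℕ) (i : Fin d) (Λ : ℝ) : ∃ C > 0, ∀ p ∈ Poly d k,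
    ∀ (x : Pt d) (r : ℝ), 0 < r → ∀ y ∈ Metric.closedBall x (Λ * r),
      r ^ 2 * polyFun d (MvPolynomial.pderiv i p) y ^ 2 ≤
        C * ((r ^ d)⁻¹ * ∫ z in Metric.ball x r, polyFun d p z ^ 2) := by
  obtain ⟨C, hC, h⟩ := exists_operator_sq_le (n := d) d k
    ((MvPolynomial.pderiv i).toLinearMap ∘ₗ (Poly d k).subtype) Λ
  refine ⟨C, hC, fun p hp x r hr y hy => ?_⟩
  -- The chain rule, obtained by differentiating the same function of t in two ways; it supplies the
  -- factor r.
  have hchain : ∀ z, polyFun d (MvPolynomial.pderiv i (substPoly (scaling x r) p)) z =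
      r * polyFun d (MvPolynomial.pderiv i p) (x + r • z) := fun z => by
    have e1 := hasDerivAt_polyFun (substPoly (scaling x r) p) z (EuclideanSpace.single i 1) 0
    have e2 := hasDerivAt_polyFun p (x + r • z) (r • EuclideanSpace.single i 1) 0
    simp only [polyFun_substPoly, scaling_apply] at e1
    have e3 := e1.unique (e2.congr_of_eventuallyEq (Filter.Eventually.of_forall fun t => by
      simp only [smul_add, smul_comm r t, add_assoc]))
    simpa [Finset.sum_ite_eq, Pi.single_apply] using e3
  have h1 := h ⟨substPoly (scaling x r) p, substPoly_mem _ hp⟩ (r⁻¹ • (y - x)) (by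
    rw [mem_closedBall_zero_iff, norm_smul, norm_inv, Real.norm_of_nonneg hr.le, ← dist_eq_norm,
      inv_mul_le_iff₀ hr, mul_comm]
    exact hy)
  simp only [Submodule.subtype_apply, LinearMap.comp_apply, Derivation.coeFn_coe, hchain,
    polyFun_substPoly, scaling_apply, smul_inv_smul₀ hr.ne', add_sub_cancel, mul_pow] at h1
  rwa [setIntegral_scaling (fun z => polyFun d p z ^ 2) x hr] at h1

/-- A linear choice of a decomposition `p = c + ∑ i, X i * q i` with `q i` of lower degree. -/
theorem exists_division (d k : ℕ) : ∃ (c : Poly d (k + 1) →ₗ[ℝ] ℝ)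
    (q : Fin d → Poly d (k + 1) →ₗ[ℝ] MvPolynomial (Fin d) ℝ), (∀ i p, q i p ∈ Poly d k) ∧
    ∀ p, p.1 = MvPolynomial.C (c p) + ∑ i, MvPolynomial.X i * q i p := by
  classical
  let F : (ℝ × (Fin d → Poly d k)) →ₗ[ℝ] Poly d (k + 1) :=
    { toFun := fun a => ⟨MvPolynomial.C a.1 + ∑ i, MvPolynomial.X i * (a.2 i).1,
        add_mem (C_mem_Poly _ _) (sum_mem fun i _ => by
          rw [add_comm k 1]; exact mul_mem_Poly (X_mem_Poly i) (a.2 i).2)⟩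
      map_add' := fun a b => Subtype.ext (by
        simp [mul_add, Finset.sum_add_distrib]; ring)
      map_smul' := fun r a => Subtype.ext (by
        simp [Finset.smul_sum, MvPolynomial.smul_eq_C_mul, MvPolynomial.C_mul, mul_left_comm]) }
  have hF : Function.Surjective F := by
    rw [← LinearMap.range_eq_top, Submodule.eq_top_iff']
    rintro ⟨p, hp⟩
    have hp' := mem_Poly.1 hp
    have key : ∀ s ∈ p.support, ∃ a, (F a).1 = MvPolynomial.monomial s (p.coeff s) := fun s hs => by
      by_cases h0 : s = 0
      · exact ⟨(p.coeff 0, 0), by subst h0; simp [F]⟩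
      · obtain ⟨i, hi⟩ := Finsupp.ne_iff.1 h0
        have h2 : Finsupp.single i 1 ≤ s := by
          rw [Finsupp.single_le_iff]
          exact Nat.one_le_iff_ne_zero.2 hi
        have h3 : Finsupp.single i 1 + (s - Finsupp.single i 1) = s := add_tsub_cancel_of_le h2
        have h1 : (s.degree : ℕ) ≤ k + 1 := (MvPolynomial.le_totalDegree hs).trans hp'
        have h4 := congrArg Finsupp.degree h3
        rw [map_add, Finsupp.degree_single] at h4
        refine ⟨(0, Pi.single i ⟨MvPolynomial.monomial (s - Finsupp.single i 1) (p.coeff s),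
          mem_Poly.2 ((MvPolynomial.totalDegree_monomial_le _ _).trans ?_)⟩), ?_⟩
        · change ((s - Finsupp.single i 1).degree : ℕ) ≤ k
          omega
        · simp only [F, LinearMap.coe_mk, AddHom.coe_mk, map_zero, zero_add]
          rw [Finset.sum_eq_single i]
          · rw [Pi.single_eq_same, MvPolynomial.X, MvPolynomial.monomial_mul, h3, one_mul]
          · intro j _ hj
            rw [Pi.single_eq_of_ne hj]
            simp
          · simp
    choose! a ha using key
    refine ⟨∑ s ∈ p.support, a s, Subtype.ext ?_⟩
    rw [map_sum, AddSubmonoidClass.coe_finsetSum, Finset.sum_congr rfl ha, ← MvPolynomial.as_sum]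
  -- A linear right inverse makes the quotients depend linearly on p, so that
  -- `exists_operator_sq_le` bounds them.
  obtain ⟨G, hG⟩ := LinearMap.exists_rightInverse_of_surjective F (LinearMap.range_eq_top.2 hF)
  refine ⟨LinearMap.fst ℝ _ _ ∘ₗ G, fun i => (Poly d k).subtype ∘ₗ LinearMap.proj i ∘ₗ
    LinearMap.snd ℝ _ _ ∘ₗ G, fun i p => ((G p).2 i).2, fun p => ?_⟩
  exact (congrArg Subtype.val (LinearMap.congr_fun hG p)).symm

end Polynomials


/-! ### Affine maps and orthogonal splittings of Euclidean space -/

theorem affineMap_eq {E F : Type*} [AddCommGroup E] [Module ℝ E] [AddCommGroup F] [Module ℝ F]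
    (f : E →ᵃ[ℝ] F) (x : E) : f x = f.linear x + f 0 := by
  have := f.map_vadd 0 x
  simpa using this

theorem affineMap_sum {E F ι : Type*} [AddCommGroup E] [Module ℝ E] [AddCommGroup F] [Module ℝ F]
    (f : E →ᵃ[ℝ] F) (s : Finset ι) {w : ι → ℝ} (hw : ∑ i ∈ s, w i = 1) (p : ι → E) :
    f (∑ i ∈ s, w i • p i) = ∑ i ∈ s, w i • f (p i) := by
  rw [affineMap_eq, map_sum]
  have h : ∑ i ∈ s, w i • f (p i) = ∑ i ∈ s, (f.linear (w i • p i) + w i • f 0) :=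
    Finset.sum_congr rfl fun i _ => by rw [affineMap_eq f (p i), smul_add, map_smul]
  rw [h, Finset.sum_add_distrib, ← Finset.sum_smul, hw, one_smul]

/-- A splitting of Euclidean space along a unit vector. -/
theorem exists_split (m : ℕ) {n : Pt (m + 1)} (hn : ‖n‖ = 1) :
    ∃ Φ : WithLp 2 (ℝ × Pt m) ≃ₗᵢ[ℝ] Pt (m + 1), Φ (WithLp.toLp 2 (1, 0)) = n := by
  have hfin : Module.finrank ℝ (WithLp 2 (ℝ × Pt m)) = m + 1 := by
    rw [(WithLp.linearEquiv 2 ℝ (ℝ × Pt m)).finrank_eq, Module.finrank_prod]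
    simp [add_comm]
  let Φ₀ : WithLp 2 (ℝ × Pt m) ≃ₗᵢ[ℝ] Pt (m + 1) :=
    (stdOrthonormalBasis ℝ _).equiv (EuclideanSpace.basisFun (Fin (m + 1)) ℝ)
      (finCongr hfin)
  have hu : ‖(WithLp.toLp 2 (1, 0) : WithLp 2 (ℝ × Pt m))‖ = 1 := by simp
  have h : ‖Φ₀ (WithLp.toLp 2 (1, 0))‖ = ‖n‖ := by rw [Φ₀.norm_map, hu, hn]
  -- The two unit vectors have equal length, so a Householder reflection carries one to the other.
  exact ⟨Φ₀.trans (ℝ ∙ (Φ₀ (WithLp.toLp 2 (1, 0)) - n))ᗮ.reflection, Submodule.reflection_sub h⟩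

section Split

variable {m : ℕ} (Φ : WithLp 2 (ℝ × Pt m) ≃ₗᵢ[ℝ] Pt (m + 1))

/-- The embedding of the hyperplane orthogonal to the splitting direction. -/
def hyper : Pt m →ₗ[ℝ] Pt (m + 1) :=
  Φ.toLinearEquiv.toLinearMap ∘ₗ (WithLp.linearEquiv 2 ℝ (ℝ × Pt m)).symm.toLinearMap ∘ₗ
    LinearMap.inr ℝ ℝ (Pt m)

/-- The orthogonal projection to the hyperplane. -/
def hyperProj : Pt (m + 1) →ₗ[ℝ] Pt m where
  toFun x := (Φ.symm x).snd
  map_add' x y := by simp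
  map_smul' c x := by simp

theorem split_apply (t : ℝ) (z : Pt m) :
    Φ (WithLp.toLp 2 (t, z)) = t • Φ (WithLp.toLp 2 (1, 0)) + hyper Φ z := by
  change _ = _ + Φ (WithLp.toLp 2 (0, z))
  rw [← map_smul, ← map_add, ← WithLp.toLp_smul, ← WithLp.toLp_add]
  simp

theorem norm_hyper (z : Pt m) : ‖hyper Φ z‖ = ‖z‖ := by
  change ‖Φ (WithLp.toLp 2 (0, z))‖ = _
  rw [Φ.norm_map]
  simp

theorem norm_hyperProj_le (x : Pt (m + 1)) : ‖hyperProj Φ x‖ ≤ ‖x‖ := by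
  change ‖(Φ.symm x).snd‖ ≤ _
  rw [← Φ.symm.norm_map x, WithLp.prod_norm_eq_of_L2]
  exact Real.le_sqrt_of_sq_le (by linarith [sq_nonneg ‖(Φ.symm x).fst‖])

theorem inner_hyper (z : Pt m) : inner ℝ (hyper Φ z) (Φ (WithLp.toLp 2 (1, 0))) = 0 := by
  change inner ℝ (Φ (WithLp.toLp 2 (0, z))) _ = _
  rw [Φ.inner_map_map]
  simp

theorem fst_eq_inner (x : Pt (m + 1)) :
    (Φ.symm x).fst = inner ℝ x (Φ (WithLp.toLp 2 (1, 0))) := by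
  conv_rhs => rw [← Φ.apply_symm_apply x, Φ.inner_map_map]
  simp

theorem split_decomp (x : Pt (m + 1)) :
    x = inner ℝ x (Φ (WithLp.toLp 2 (1, 0))) • Φ (WithLp.toLp 2 (1, 0)) +
      hyper Φ (hyperProj Φ x) := by
  rw [← split_apply, ← fst_eq_inner]
  change x = Φ (WithLp.toLp 2 ((Φ.symm x).fst, (Φ.symm x).snd))
  conv_lhs => rw [← Φ.apply_symm_apply x]
  rfl

theorem integral_split (f : Pt (m + 1) → ℝ) (a : Pt (m + 1)) :
    ∫ x, f x = ∫ p : ℝ × Pt m, f (a + Φ (WithLp.toLp 2 p)) := by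
  have h1 := (measurePreserving_add_left (volume : Measure (Pt (m + 1))) a).integral_comp
    (measurableEmbedding_addLeft a) f
  have h2 := Φ.measurePreserving.integral_comp Φ.toHomeomorph.measurableEmbedding
    (fun x => f (a + x))
  have h3 := (WithLp.volume_preserving_toLp ℝ (Pt m)).integral_comp
    (MeasurableEquiv.toLp 2 (ℝ × Pt m)).measurableEmbedding (fun x => f (a + Φ x))
  rw [← h1, ← h2, ← h3]

end Split

/-! ### Barycentric coordinates, facets and normals -/

namespace SimplicialMesh

variable {d : ℕ} {Ω : Domain d} {T : SimplicialMesh Ω}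

/-- The vertices of an element as an affine basis. -/
def Cell.basis (K : T.Cell) : AffineBasis K.verts ℝ (Pt d) :=
  ⟨((↑) : K.verts → Pt d), T.complex.indep K.mem, by
    have hi := T.complex.indep K.mem
    exact hi.affineSpan_eq_top_iff_card_eq_finrank_add_one.2 (by simpa using K.card_eq)⟩

open Classical in
/-- The barycentric coordinate of an element with respect to the vertex `a`. -/
def Cell.bary (K : T.Cell) (a : Pt d) : Pt d →ᵃ[ℝ] ℝ :=
  if h : a ∈ K.verts then K.basis.coord ⟨a, h⟩ else 0

variable (K : T.Cell)

theorem Cell.bary_eq {a : Pt d} (h : a ∈ K.verts) : K.bary a = K.basis.coord ⟨a, h⟩ := by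
  simp [Cell.bary, h]

theorem Cell.range_basis : Set.range K.basis = (K.verts : Set (Pt d)) := by
  ext x
  constructor
  · rintro ⟨y, rfl⟩
    exact y.2
  · intro hx
    exact ⟨⟨x, hx⟩, rfl⟩

theorem Cell.sum_bary (x : Pt d) : ∑ a ∈ K.verts, K.bary a x = 1 := by
  rw [← K.basis.sum_coord_apply_eq_one x, ← Finset.sum_coe_sort]
  exact Finset.sum_congr rfl fun a _ => by rw [K.bary_eq a.2]

theorem Cell.sum_bary_smul (x : Pt d) : ∑ a ∈ K.verts, K.bary a x • a = x := by
  conv_rhs => rw [← K.basis.linear_combination_coord_eq_self x]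
  rw [← Finset.sum_coe_sort]
  exact Finset.sum_congr rfl fun a _ => by rw [K.bary_eq a.2]; rfl

theorem Cell.bary_self {a : Pt d} (h : a ∈ K.verts) : K.bary a a = 1 := by
  rw [K.bary_eq h]
  exact K.basis.coord_apply_eq ⟨a, h⟩

theorem Cell.bary_ne {a b : Pt d} (ha : a ∈ K.verts) (hb : b ∈ K.verts) (hab : a ≠ b) :
    K.bary a b = 0 := by
  rw [K.bary_eq ha]
  exact K.basis.coord_apply_ne (i := ⟨a, ha⟩) (j := ⟨b, hb⟩) (by simpa using hab)

theorem Cell.mem_body {x : Pt d} : x ∈ K.body ↔ ∀ a ∈ K.verts, 0 ≤ K.bary a x := by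
  rw [Cell.body, ← K.range_basis, K.basis.convexHull_eq_nonneg_coord]
  exact ⟨fun h a ha => by rw [K.bary_eq ha]; exact h _,
    fun h a => by have := h a a.2; rwa [K.bary_eq a.2] at this⟩

theorem Cell.mem_inner {x : Pt d} : x ∈ K.inner ↔ ∀ a ∈ K.verts, 0 < K.bary a x := by
  rw [Cell.inner, Cell.body, ← K.range_basis, K.basis.interior_convexHull]
  exact ⟨fun h a ha => by rw [K.bary_eq ha]; exact h _,
    fun h a => by have := h a a.2; rwa [K.bary_eq a.2] at this⟩

theorem Cell.continuous_bary (a : Pt d) : Continuous (K.bary a) :=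
  (K.bary a).continuous_of_finiteDimensional

theorem Cell.bary_unique {w : Pt d → ℝ} (hw : ∑ a ∈ K.verts, w a = 1) {a : Pt d}
    (ha : a ∈ K.verts) : K.bary a (∑ b ∈ K.verts, w b • b) = w a := by
  rw [affineMap_sum _ _ hw, Finset.sum_eq_single_of_mem a ha fun b hb hba => by
    rw [K.bary_ne ha hb hba.symm, smul_zero], K.bary_self ha, smul_eq_mul, mul_one]

theorem Cell.bary_le_one {x : Pt d} (hx : x ∈ K.body) {a : Pt d} (ha : a ∈ K.verts) :
    K.bary a x ≤ 1 := by
  rw [← K.sum_bary x]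
  exact Finset.single_le_sum (fun b hb => K.mem_body.1 hx b hb) ha

/-- The closed faces of an element in barycentric coordinates. -/
theorem Cell.mem_convexHull {s : Finset (Pt d)} (hs : s ⊆ K.verts) {x : Pt d} :
    x ∈ convexHull ℝ (s : Set (Pt d)) ↔ x ∈ K.body ∧ ∀ a ∈ K.verts, a ∉ s → K.bary a x = 0 := by
  classical
  constructor
  · intro hx
    refine ⟨convexHull_mono (by exact_mod_cast hs) hx, fun a ha has => ?_⟩
    obtain ⟨w, hw, hw1, hwx⟩ := (Finset.mem_convexHull (s := s)).1 hx
    rw [Finset.centerMass_eq_of_sum_1 _ _ hw1] at hwx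
    rw [← hwx, affineMap_sum _ _ hw1]
    exact Finset.sum_eq_zero fun b hb => by
      rw [id, K.bary_ne ha (hs hb) (fun h => has (h ▸ hb)), smul_zero]
  · rintro ⟨hx, h0⟩
    have hsum : ∑ a ∈ s, K.bary a x = 1 := by
      rw [← K.sum_bary x]
      exact Finset.sum_subset hs fun a ha has => h0 a ha has
    have hx' : ∑ a ∈ s, K.bary a x • a = x := by
      conv_rhs => rw [← K.sum_bary_smul x]
      exact Finset.sum_subset hs fun a ha has => by rw [h0 a ha has, zero_smul]
    rw [Finset.mem_convexHull]
    refine ⟨fun a => K.bary a x, fun a ha => K.mem_body.1 hx a (hs ha), hsum, ?_⟩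
    rw [Finset.centerMass_eq_of_sum_1 _ _ hsum]
    exact hx'

theorem Cell.mem_facets {K : T.Cell} {e : T.Facet} : e ∈ K.facets ↔ e.verts ⊆ K.verts := by
  simp [Cell.facets]

open Classical in
theorem Cell.exists_opp {K : T.Cell} {e : T.Facet} (he : e ∈ K.facets) :
    ∃ a ∈ K.verts, e.verts = K.verts.erase a := by
  have hs := Cell.mem_facets.1 he
  have hc : (K.verts \ e.verts).card = 1 := by
    rw [Finset.card_sdiff_of_subset hs, K.card_eq, e.card_eq]; omega
  obtain ⟨a, ha⟩ := Finset.card_eq_one.1 hc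
  have ha' : a ∈ K.verts \ e.verts := by rw [ha]; simp
  refine ⟨a, (Finset.mem_sdiff.1 ha').1, ?_⟩
  rw [Finset.erase_eq, ← ha, Finset.sdiff_sdiff_eq_self hs]

theorem Facet.ext' {e e' : T.Facet} (h : e.verts = e'.verts) : e = e' := by
  cases e; cases e'; simp_all

theorem Cell.ext' {K K' : T.Cell} (h : K.verts = K'.verts) : K = K' := by
  cases K; cases K'; simp_all

open Classical in
/-- The facet of an element opposite to a vertex. -/
theorem Cell.exists_facet (hd : 0 < d) {a : Pt d} (ha : a ∈ K.verts) :
    ∃ e ∈ K.facets, e.verts = K.verts.erase a := by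
  have hc : (K.verts.erase a).card = d := by rw [Finset.card_erase_of_mem ha, K.card_eq]; rfl
  exact ⟨⟨K.verts.erase a, T.complex.down_closed K.mem (Finset.erase_subset _ _)
    (Finset.card_pos.1 (by omega)), hc⟩, Cell.mem_facets.2 (Finset.erase_subset _ _), rfl⟩

open Classical in
theorem Cell.mem_facet_body {e : T.Facet} {a : Pt d} (ha : a ∈ K.verts)
    (he : e.verts = K.verts.erase a) {x : Pt d} :
    x ∈ e.body ↔ x ∈ K.body ∧ K.bary a x = 0 := by
  rw [Facet.body, K.mem_convexHull (he ▸ Finset.erase_subset _ _), he]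
  refine and_congr_right fun _ => ⟨fun h => h a ha (by simp), fun h b hb hbe => ?_⟩
  have : b = a := by
    by_contra hba
    exact hbe (Finset.mem_erase.2 ⟨hba, hb⟩)
  rw [this, h]

-- The barycenter of K divides the segment from a to the barycenter of the opposite facet in the
-- ratio d : 1. This ties the vector defining the normal to the height over a.
open Classical in
theorem Cell.barycenter_sub (hd : 0 < d) {e : T.Facet} {a : Pt d} (ha : a ∈ K.verts)
    (he : e.verts = K.verts.erase a) :
    barycenter e.verts - barycenter K.verts = ((d : ℝ) + 1)⁻¹ • (barycenter e.verts - a) := by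
  have h1 : ∑ x ∈ K.verts, x = a + (d : ℝ) • barycenter e.verts := by
    rw [barycenter, e.card_eq, smul_inv_smul₀ (by positivity), he,
      Finset.add_sum_erase _ (fun x => x) ha]
  have h2 : barycenter K.verts = ((d : ℝ) + 1)⁻¹ • (a + (d : ℝ) • barycenter e.verts) := by
    rw [← h1, barycenter, K.card_eq]
    push_cast
    rfl
  have h3 : ((d : ℝ) + 1) ≠ 0 := by positivity
  rw [h2]
  have : barycenter e.verts = ((d : ℝ) + 1)⁻¹ • (((d : ℝ) + 1) • barycenter e.verts) := by
    rw [inv_smul_smul₀ h3]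
  nth_rw 1 [this]
  rw [← smul_sub]
  congr 1
  module

theorem Facet.barycenter_mem (hd : 0 < d) (e : T.Facet) : barycenter e.verts ∈ e.body := by
  have hc : (e.verts.card : ℝ) ≠ 0 := by rw [e.card_eq]; positivity
  rw [barycenter, Finset.smul_sum]
  exact (convex_convexHull ℝ _).sum_mem (fun _ _ => by positivity) (by simp [hc])
    fun x hx => subset_convexHull ℝ _ hx

open Classical in
/-- The outward normal: the distance to the vertex opposite to the facet. -/
theorem normal_spec (hd : 0 < d) {e : T.Facet} {a : Pt d} (ha : a ∈ K.verts)
    (he : e.verts = K.verts.erase a) : ‖K.normal e‖ = 1 ∧ ∃ H > 0,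
      ∀ x, inner ℝ (x - a) (K.normal e) = H * (1 - K.bary a x) := by
  set U := vectorSpan ℝ (e.verts : Set (Pt d)) with hU
  set g := barycenter e.verts with hg
  set w := Uᗮ.starProjection (g - barycenter K.verts) with hw
  have hn : K.normal e = ‖w‖⁻¹ • w := rfl
  have hwU : ∀ u ∈ U, inner ℝ u w = 0 := fun u hu =>
    Submodule.inner_right_of_mem_orthogonal hu (Submodule.starProjection_apply_mem _ _)
  have hd1 : (0 : ℝ) < (d : ℝ) + 1 := by positivity
  have hge := e.barycenter_mem hd
  -- The vector w is the orthogonal projection of (g - a)/(d + 1), so pairing with w gives (d +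
  -- 1)‖w‖². After normalization this identifies the height H as (d + 1)‖w‖.
  have hga : inner ℝ (g - a) w = ((d : ℝ) + 1) * ‖w‖ ^ 2 := by
    have h1 : g - a = ((d : ℝ) + 1) • (g - barycenter K.verts) := by
      rw [K.barycenter_sub hd ha he, smul_inv_smul₀ hd1.ne']
    rw [h1, inner_smul_left, ← real_inner_self_eq_norm_sq]
    congr 1
    nth_rw 2 [hw]
    rw [Submodule.inner_starProjection_left_eq_right, hw,
      Submodule.starProjection_eq_self_iff.2 (Submodule.starProjection_apply_mem _ _)]
  have hb : ∀ b ∈ e.verts, inner ℝ (b - a) w = ((d : ℝ) + 1) * ‖w‖ ^ 2 := fun b hb => by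
    have h1 : b -ᵥ g ∈ U := by
      rw [hU, ← direction_affineSpan]
      exact AffineSubspace.vsub_mem_direction (subset_affineSpan ℝ _ hb)
        (convexHull_subset_affineSpan _ hge)
    have h2 := hwU _ h1
    rw [vsub_eq_sub] at h2
    rw [← hga, ← sub_add_sub_cancel b g a, inner_add_left, h2, zero_add]
  have hx : ∀ x, inner ℝ (x - a) w = ((d : ℝ) + 1) * ‖w‖ ^ 2 * (1 - K.bary a x) := fun x => by
    have h1 : x - a = ∑ b ∈ K.verts, K.bary b x • (b - a) := by
      simp only [smul_sub, Finset.sum_sub_distrib, ← Finset.sum_smul, K.sum_bary, one_smul,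
        K.sum_bary_smul]
    rw [h1, sum_inner, ← Finset.add_sum_erase _ _ ha, sub_self, smul_zero, inner_zero_left, zero_add,
      ← he, Finset.sum_congr rfl fun b hb' => by rw [inner_smul_left, hb b hb'], ← Finset.sum_mul,
      mul_comm]
    congr 1
    rw [← K.sum_bary x, ← Finset.add_sum_erase _ _ ha, add_sub_cancel_left, he]
    rfl
  -- If w = 0, then a lies in the affine span of the facet. There the barycentric coordinate of a
  -- vanishes, although it equals 1 at a.
  have hw0 : w ≠ 0 := by
    intro h0
    have hgU : g - a ∈ Uᗮᗮ := by
      have h1 : g - a = ((d : ℝ) + 1) • (g - barycenter K.verts) := by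
        rw [K.barycenter_sub hd ha he, smul_inv_smul₀ hd1.ne']
      rw [h1]
      refine Submodule.smul_mem _ _ ?_
      rw [← Submodule.starProjection_apply_eq_zero_iff]
      exact h0
    rw [Submodule.orthogonal_orthogonal] at hgU
    have h2 : a ∈ affineSpan ℝ (e.verts : Set (Pt d)) := by
      have h3 := AffineSubspace.vadd_mem_of_mem_direction (s := affineSpan ℝ (e.verts : Set (Pt d)))
        (v := -(g - a)) (by rw [direction_affineSpan]; exact neg_mem hgU)
        (convexHull_subset_affineSpan _ hge)
      rwa [neg_sub, vadd_eq_add, ← hg, sub_add_cancel] at h3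
    have hz : ∀ x ∈ affineSpan ℝ (e.verts : Set (Pt d)), K.bary a x = 0 := by
      intro x hx
      have h4 : affineSpan ℝ (e.verts : Set (Pt d)) ≤
          (AffineSubspace.mk' (0 : ℝ) (⊥ : Submodule ℝ ℝ)).comap (K.bary a) := by
        rw [affineSpan_le]
        intro b hb
        have hb' : b ∈ e.verts := hb
        rw [he, Finset.mem_erase] at hb'
        simp [AffineSubspace.mem_mk', K.bary_ne ha hb'.2 hb'.1.symm]
      have := h4 hx
      simpa [AffineSubspace.mem_mk'] using this
    have := hz a h2
    rw [K.bary_self ha] at this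
    exact one_ne_zero this
  have hwn : 0 < ‖w‖ := norm_pos_iff.2 hw0
  refine ⟨by rw [hn, norm_smul, norm_inv, norm_norm, inv_mul_cancel₀ hwn.ne'],
    ((d : ℝ) + 1) * ‖w‖, mul_pos hd1 hwn, fun x => ?_⟩
  rw [hn, inner_smul_right, hx]
  field_simp

end SimplicialMesh


/-! ### The divergence theorem on a simplex -/

namespace SimplicialMesh

section Cone

variable {m : ℕ} {Ω : Domain (m + 1)} {T : SimplicialMesh Ω} (K : T.Cell)

open Classical in
/-- A facet in coordinates of its hyperplane. -/
theorem Facet.surface_eq_map {e : T.Facet} {a : Pt (m + 1)} (ha : a ∈ K.verts)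
    (he : e.verts = K.verts.erase a) (Φ : WithLp 2 (ℝ × Pt m) ≃ₗᵢ[ℝ] Pt (m + 1))
    (hΦ : Φ (WithLp.toLp 2 (1, 0)) = K.normal e) {y : Pt (m + 1)} (hy : K.bary a y = 0) :
    e.surface = (volume.restrict ((fun z => y + hyper Φ z) ⁻¹' e.body)).map
      (fun z => y + hyper Φ z) := by
  set γ : Pt m → Pt (m + 1) := fun z => y + hyper Φ z with hγ
  have hfi : Isometry γ := by
    refine Isometry.of_dist_eq fun z z' => ?_
    rw [hγ, dist_eq_norm, dist_eq_norm, add_sub_add_left_eq_sub, ← map_sub, norm_hyper]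
  obtain ⟨-, H, hH, hn⟩ := normal_spec K (Nat.succ_pos m) ha he
  have hrange : e.body ⊆ Set.range γ := fun x hx => by
    have h0 := ((K.mem_facet_body ha he).1 hx).2
    have h1 : inner ℝ (x - y) (K.normal e) = 0 := by
      rw [← sub_sub_sub_cancel_right x y a, inner_sub_left, hn, hn, h0, hy, sub_self]
    refine ⟨hyperProj Φ (x - y), ?_⟩
    have h2 := split_decomp Φ (x - y)
    rw [hΦ, h1, zero_smul, zero_add] at h2
    rw [hγ]
    simp only
    rw [← h2, add_sub_cancel]
  have h1 := hfi.map_euclideanHausdorffMeasure (d := m)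
  have h2 : (Measure.euclideanHausdorffMeasure m : Measure (Pt m)) = volume := by
    have := InnerProductSpace.euclideanHausdorffMeasure_eq_volume (V := Pt m)
    rwa [finrank_euclideanSpace_fin] at this
  rw [h2] at h1
  rw [Facet.surface, ← Measure.restrict_map hfi.continuous.measurable e.isCompact_body.measurableSet,
    h1, Measure.restrict_restrict e.isCompact_body.measurableSet,
    Set.inter_eq_self_of_subset_left hrange]
  rfl

open Classical in
theorem Facet.integral_eq {e : T.Facet} {a : Pt (m + 1)} (ha : a ∈ K.verts)
    (he : e.verts = K.verts.erase a) (Φ : WithLp 2 (ℝ × Pt m) ≃ₗᵢ[ℝ] Pt (m + 1))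
    (hΦ : Φ (WithLp.toLp 2 (1, 0)) = K.normal e) {y : Pt (m + 1)} (hy : K.bary a y = 0)
    (f : Pt (m + 1) → ℝ) :
    ∫ x, f x ∂e.surface = ∫ z in (fun z => y + hyper Φ z) ⁻¹' e.body, f (y + hyper Φ z) := by
  have hfi : Isometry (fun z => y + hyper Φ z) := by
    refine Isometry.of_dist_eq fun z z' => ?_
    rw [dist_eq_norm, dist_eq_norm, add_sub_add_left_eq_sub, ← map_sub, norm_hyper]
  rw [Facet.surface_eq_map K ha he Φ hΦ hy,
    hfi.isClosedEmbedding.measurableEmbedding.integral_map]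

theorem Cell.inner_ae_eq : K.inner =ᵐ[volume] K.body :=
  interior_ae_eq_of_null_frontier ((convex_convexHull ℝ _).addHaar_frontier _)

theorem Cell.bary_segment {a b : Pt (m + 1)} (s : ℝ) (y : Pt (m + 1)) :
    K.bary b (a + s • (y - a)) = (1 - s) * K.bary b a + s * K.bary b y := by
  have h := affineMap_eq (K.bary b)
  rw [h (a + _), h a, h y, map_add, map_smul, map_sub, smul_eq_mul]
  ring

open Classical in
/-- Integration over an element in conical coordinates about a vertex. -/
theorem integral_cone {e : T.Facet} {a : Pt (m + 1)} (ha : a ∈ K.verts)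
    (he : e.verts = K.verts.erase a) {H : ℝ} (hH : 0 < H)
    (hn : ∀ x, inner ℝ (x - a) (K.normal e) = H * (1 - K.bary a x))
    (hn1 : ‖K.normal e‖ = 1) {g : Pt (m + 1) → ℝ} (hg : Continuous g) :
    ∃ (E : Set (Pt m)) (γ : Pt m → Pt (m + 1)), MeasurableSet E ∧
      (∀ f : Pt (m + 1) → ℝ, ∫ x, f x ∂e.surface = ∫ z in E, f (γ z)) ∧
      ∫ x in K.inner, g x = ∫ z in E, ∫ t in (0 : ℝ)..H, (t / H) ^ m *
        g (a + (t / H) • (γ z - a)) := by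
  obtain ⟨Φ, hΦ⟩ := exists_split m hn1
  set n := K.normal e with hndef
  -- The coordinates are x = a + Φ(t, z) with t the height over a along the normal; γ charts the
  -- hyperplane t = H of the facet.
  set γ : Pt m → Pt (m + 1) := fun z => (a + H • n) + hyper Φ z with hγ
  have hinner : ∀ t z, inner ℝ (a + Φ (WithLp.toLp 2 (t, z)) - a) n = t := fun t z => by
    rw [add_sub_cancel_left, split_apply, inner_add_left, inner_smul_left, hΦ, ← hΦ, inner_hyper, hΦ,
      real_inner_self_eq_norm_sq, hn1]
    simp
  have hbary : ∀ t z, K.bary a (a + Φ (WithLp.toLp 2 (t, z))) = 1 - t / H := fun t z => by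
    have h := hn (a + Φ (WithLp.toLp 2 (t, z)))
    rw [hinner] at h
    field_simp
    linarith
  have hγeq : ∀ z, γ z = a + Φ (WithLp.toLp 2 (H, z)) := fun z => by
    rw [split_apply, hΦ, hγ]
    simp only [add_assoc]
  have hγ0 : ∀ z, K.bary a (γ z) = 0 := fun z => by
    rw [hγeq, hbary, div_self hH.ne', sub_self]
  have hy0 : K.bary a (a + H • n) = 0 := by simpa [hγ] using hγ0 0
  set E : Set (Pt m) := γ ⁻¹' e.body with hE
  have hfi : Isometry γ := by
    refine Isometry.of_dist_eq fun z z' => ?_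
    rw [hγ, dist_eq_norm, dist_eq_norm, add_sub_add_left_eq_sub, ← map_sub, norm_hyper]
  have hEc : IsCompact E := hfi.isClosedEmbedding.isCompact_preimage e.isCompact_body
  refine ⟨E, γ, hEc.measurableSet, fun f => Facet.integral_eq K ha he Φ hΦ hy0 f, ?_⟩
  -- The slice of K at height sH is the facet contracted toward a by the factor s: the coordinates
  -- of the vertices other than a are multiplied by s > 0.
  have hmem : ∀ s : ℝ, 0 < s → s < 1 → ∀ z, (a + s • (γ z - a) ∈ K.body ↔ z ∈ E) := by
    intro s hs hs1 z
    rw [hE, Set.mem_preimage, K.mem_facet_body ha he, and_iff_left (hγ0 z), K.mem_body, K.mem_body]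
    refine forall₂_congr fun b hb => ?_
    rw [K.bary_segment]
    by_cases hba : b = a
    · subst hba
      rw [K.bary_self hb, hγ0]
      simp [hs1.le]
    · rw [K.bary_ne hb ha hba, mul_zero, zero_add]
      exact mul_nonneg_iff_of_pos_left hs
  set F : ℝ × Pt m → ℝ := fun p => K.body.indicator g (a + Φ (WithLp.toLp 2 p)) with hF
  have hbody : MeasurableSet K.body := K.isCompact_body.measurableSet
  have hgi : Integrable (K.body.indicator g) :=
    (hg.continuousOn.integrableOn_compact K.isCompact_body).integrable_indicator hbody
  have hFi : Integrable F (volume.prod volume) := by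
    have h1 : Integrable (fun x => K.body.indicator g (a + x)) :=
      hgi.comp_add_left a
    have h2 : Integrable (fun x => K.body.indicator g (a + Φ x)) :=
      (Φ.measurePreserving.integrable_comp_emb Φ.toHomeomorph.measurableEmbedding).2 h1
    exact ((WithLp.volume_preserving_toLp ℝ (Pt m)).integrable_comp_emb
      (MeasurableEquiv.toLp 2 (ℝ × Pt m)).measurableEmbedding).2 h2
  -- The substitution z ↦ (t/H)z in the m-dimensional slice produces the Jacobian (t/H)^m. The
  -- endpoint t = 0, where the contraction is singular, is left out as a null set.
  have hslice : ∀ t ∈ Set.Ioo 0 H, ∫ z, F (t, z) =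
      ∫ z in E, (t / H) ^ m * g (a + (t / H) • (γ z - a)) := by
    intro t ht
    have hs : 0 < t / H := div_pos ht.1 hH
    have hs1 : t / H < 1 := (div_lt_one hH).2 ht.2
    have h1 := Measure.integral_comp_smul (volume : Measure (Pt m)) (fun z => F (t, z)) (t / H)
    rw [finrank_euclideanSpace_fin, abs_of_pos (by positivity), smul_eq_mul,
      eq_inv_mul_iff_mul_eq₀ (by positivity)] at h1
    rw [← h1, ← integral_const_mul, ← integral_indicator hEc.measurableSet]
    congr 1
    ext z
    have hx : a + Φ (WithLp.toLp 2 (t, (t / H) • z)) = a + (t / H) • (γ z - a) := by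
      have hsm : (t / H) • (WithLp.toLp 2 (H, z) : WithLp 2 (ℝ × Pt m)) =
          WithLp.toLp 2 (t, (t / H) • z) := by
        change WithLp.toLp 2 (t / H * H, (t / H) • z) = _
        rw [div_mul_cancel₀ _ hH.ne']
      rw [hγeq, add_sub_cancel_left, ← map_smul, hsm]
    by_cases hz : z ∈ E
    · rw [Set.indicator_of_mem hz, hF]
      simp only
      rw [hx, Set.indicator_of_mem ((hmem _ hs hs1 z).2 hz)]
    · rw [Set.indicator_of_notMem hz, hF]
      simp only
      rw [hx, Set.indicator_of_notMem (fun h => hz ((hmem _ hs hs1 z).1 h)), mul_zero]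
  have hzero : ∀ t, t ∉ Set.Icc 0 H → ∫ z, F (t, z) = 0 := fun t ht => by
    have : ∀ z, F (t, z) = 0 := fun z => Set.indicator_of_notMem (fun hx => ht ?_) _
    · simp [this]
    · have h1 := K.mem_body.1 hx a ha
      have h2 := K.bary_le_one hx ha
      rw [hbary] at h1 h2
      have h3 : t / H ≤ 1 := by linarith
      have h4 : 0 ≤ t / H := by linarith
      exact ⟨by rwa [le_div_iff₀ hH, zero_mul] at h4, by rwa [div_le_one hH] at h3⟩
  have hcont : Continuous fun p : ℝ × Pt m =>
      (p.1 / H) ^ m * g (a + (p.1 / H) • (γ p.2 - a)) := by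
    have := hfi.continuous
    fun_prop
  have hint : Integrable (Function.uncurry fun (t : ℝ) (z : Pt m) =>
      (t / H) ^ m * g (a + (t / H) • (γ z - a)))
      ((volume.restrict (Set.Ioc 0 H)).prod (volume.restrict E)) := by
    rw [Measure.prod_restrict]
    exact (hcont.continuousOn.integrableOn_compact (isCompact_Icc.prod hEc)).mono_set
      (Set.prod_mono Set.Ioc_subset_Icc_self le_rfl)
  calc ∫ x in K.inner, g x = ∫ x in K.body, g x := setIntegral_congr_set K.inner_ae_eq
    _ = ∫ x, K.body.indicator g x := (integral_indicator hbody).symm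
    _ = ∫ p : ℝ × Pt m, F p := integral_split Φ _ a
    _ = ∫ t, ∫ z, F (t, z) := integral_prod F hFi
    _ = ∫ t in Set.Icc 0 H, ∫ z, F (t, z) :=
        (setIntegral_eq_integral_of_forall_compl_eq_zero hzero).symm
    _ = ∫ t in Set.Ioo 0 H, ∫ z, F (t, z) := integral_Icc_eq_integral_Ioo
    _ = ∫ t in Set.Ioo 0 H, ∫ z in E, (t / H) ^ m * g (a + (t / H) • (γ z - a)) :=
        setIntegral_congr_fun measurableSet_Ioo hslice
    _ = ∫ t in Set.Ioc 0 H, ∫ z in E, (t / H) ^ m * g (a + (t / H) • (γ z - a)) :=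
        integral_Ioc_eq_integral_Ioo.symm
    _ = ∫ z in E, ∫ t in Set.Ioc 0 H, (t / H) ^ m * g (a + (t / H) • (γ z - a)) :=
        integral_integral_swap hint
    _ = _ := by simp only [intervalIntegral.integral_of_le hH.le]

open Classical in
/-- The divergence theorem for `f(x) (x - a)` with a vertex `a`. -/
theorem integral_radial {e : T.Facet} {a : Pt (m + 1)} (ha : a ∈ K.verts)
    (he : e.verts = K.verts.erase a) {H : ℝ} (hH : 0 < H)
    (hn : ∀ x, inner ℝ (x - a) (K.normal e) = H * (1 - K.bary a x))
    (hn1 : ‖K.normal e‖ = 1) (f : MvPolynomial (Fin (m + 1)) ℝ) :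
    ∫ x in K.inner, (((m : ℝ) + 1) * polyFun _ f x +
      ∑ i, (x i - a i) * polyFun _ (MvPolynomial.pderiv i f) x) =
    H * ∫ x, polyFun _ f x ∂e.surface := by
  have hg : Continuous fun x : Pt (m + 1) => ((m : ℝ) + 1) * polyFun _ f x +
      ∑ i, (x i - a i) * polyFun _ (MvPolynomial.pderiv i f) x := by
    refine (continuous_const.mul (continuous_polyFun f)).add (continuous_finsetSum _ fun i _ => ?_)
    exact ((EuclideanSpace.proj i : Pt (m + 1) →L[ℝ] ℝ).continuous.sub continuous_const).mul
      (continuous_polyFun _)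
  obtain ⟨E, γ, hE, hsurf, hcone⟩ := integral_cone K ha he hH hn hn1 hg
  rw [hcone, hsurf, ← integral_const_mul]
  refine setIntegral_congr_fun hE fun z _ => ?_
  simp only
  -- Along each ray from a, the integrand with its Jacobian is the exact derivative of H (t/H)^(m+1)
  -- f. That primitive vanishes at a and equals H f on the facet.
  have hderiv : ∀ t : ℝ, HasDerivAt
      (fun t : ℝ => H * ((t / H) ^ (m + 1) * polyFun _ f (a + (t / H) • (γ z - a))))
      ((t / H) ^ m * (((m : ℝ) + 1) * polyFun _ f (a + (t / H) • (γ z - a)) +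
        ∑ i, ((a + (t / H) • (γ z - a)) i - a i) *
          polyFun _ (MvPolynomial.pderiv i f) (a + (t / H) • (γ z - a)))) t := fun t => by
    have h1 : HasDerivAt (fun t : ℝ => t / H) (1 / H) t := (hasDerivAt_id t).div_const H
    have h2 := (hasDerivAt_polyFun f a (γ z - a) (t / H)).comp t h1
    refine (((h1.pow (m + 1)).mul h2).const_mul H).congr_deriv ?_
    simp only [PiLp.add_apply, PiLp.smul_apply, smul_eq_mul, add_sub_cancel_left, Function.comp]
    rw [mul_add ((t / H) ^ m), Finset.mul_sum, mul_add, Finset.sum_mul, Finset.mul_sum,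
      Finset.mul_sum]
    congr 1
    · simp only [Nat.add_sub_cancel, Nat.cast_add, Nat.cast_one]
      field_simp
    · refine Finset.sum_congr rfl fun i _ => ?_
      simp only [Pi.pow_apply, pow_succ]
      field_simp
  rw [intervalIntegral.integral_eq_sub_of_hasDerivAt (fun t _ => hderiv t)]
  · simp [hH.ne']
  · refine Continuous.intervalIntegrable ?_ _ _
    have : Continuous fun t : ℝ => a + (t / H) • (γ z - a) := by fun_prop
    exact ((continuous_id.div_const H).pow m).mul (hg.comp this)

/-- The property of satisfying the divergence theorem on `K`. -/
def SatisfiesDivergence (q : Fin (m + 1) → MvPolynomial (Fin (m + 1)) ℝ) : Prop :=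
  ∫ x in K.inner, polyFun _ (divergence _ q) x =
    ∑ e ∈ K.facets, ∫ x, fluxFun (K.normal e) q x ∂e.surface

theorem SatisfiesDivergence.sum {ι : Type*} (s : Finset ι)
    {q : ι → Fin (m + 1) → MvPolynomial (Fin (m + 1)) ℝ}
    (h : ∀ i ∈ s, SatisfiesDivergence K (q i)) : SatisfiesDivergence K (∑ i ∈ s, q i) := by
  unfold SatisfiesDivergence at h ⊢
  have h1 : ∀ x, polyFun _ (divergence _ (∑ i ∈ s, q i)) x =
      ∑ i ∈ s, polyFun _ (divergence _ (q i)) x := fun x => by rw [map_sum, polyFun_sum]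
  have h2 : ∀ (e : T.Facet) x, fluxFun (K.normal e) (∑ i ∈ s, q i) x =
      ∑ i ∈ s, fluxFun (K.normal e) (q i) x := fun e x => by rw [map_sum, Finset.sum_apply]
  simp only [h1, h2]
  rw [integral_finsetSum _ fun i _ => K.integrableOn (continuous_polyFun _),
    Finset.sum_congr rfl h, Finset.sum_comm]
  exact Finset.sum_congr rfl fun e _ => (integral_finsetSum _ fun i _ =>
    e.integrable (continuous_fluxFun _ _).continuousOn).symm

theorem divergence_apply (q : Fin (m + 1) → MvPolynomial (Fin (m + 1)) ℝ) :
    divergence _ q = ∑ i, MvPolynomial.pderiv i (q i) := by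
  simp [divergence]

theorem fluxFun_apply {d : ℕ} (n : Pt d) (q : Fin d → MvPolynomial (Fin d) ℝ) (x : Pt d) :
    fluxFun n q x = ∑ i, polyFun d (q i) x * n i := rfl

-- The field f(x)(x - a) is tangential to every facet through a, so only the opposite facet has
-- flux. There (x - a)·n is the constant H, and the identity is `integral_radial`.
open Classical in
theorem satisfiesDivergence_radial {a : Pt (m + 1)} (ha : a ∈ K.verts)
    (f : MvPolynomial (Fin (m + 1)) ℝ) :
    SatisfiesDivergence K (fun i => (MvPolynomial.X i - MvPolynomial.C (a i)) * f) := by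
  obtain ⟨e, heK, he⟩ := K.exists_facet (Nat.succ_pos m) ha
  obtain ⟨hn1, H, hH, hn⟩ := normal_spec K (Nat.succ_pos m) ha he
  have hflux : ∀ (n x : Pt (m + 1)), fluxFun n
      (fun i => (MvPolynomial.X i - MvPolynomial.C (a i)) * f) x =
      polyFun _ f x * inner ℝ (x - a) n := fun n x => by
    rw [fluxFun_apply, PiLp.inner_apply, Finset.mul_sum]
    refine Finset.sum_congr rfl fun i _ => ?_
    simp only [polyFun_mul, map_sub, Pi.sub_apply, polyFun_X, polyFun_C, PiLp.sub_apply,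
      RCLike.inner_apply, conj_trivial]
    ring
  rw [SatisfiesDivergence, Finset.sum_eq_single_of_mem e heK]
  · have h1 := integral_radial K ha he hH hn hn1 f
    have h2 : ∀ x, polyFun (m + 1) (divergence _ (fun i =>
        (MvPolynomial.X i - MvPolynomial.C (a i)) * f)) x = ((m : ℝ) + 1) * polyFun _ f x +
        ∑ i, (x i - a i) * polyFun _ (MvPolynomial.pderiv i f) x := fun x => by
      rw [divergence_apply, polyFun_sum]
      have : ∀ i, polyFun (m + 1) (MvPolynomial.pderiv i
          ((MvPolynomial.X i - MvPolynomial.C (a i)) * f)) x =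
          polyFun _ f x + (x i - a i) * polyFun _ (MvPolynomial.pderiv i f) x := fun i => by
        rw [MvPolynomial.pderiv_mul, map_sub, MvPolynomial.pderiv_X_self, MvPolynomial.pderiv_C]
        simp
      simp only [this, Finset.sum_add_distrib]
      simp
    simp only [h2]
    rw [h1, ← integral_const_mul, Facet.surface]
    refine setIntegral_congr_fun e.isCompact_body.measurableSet fun x hx => ?_
    rw [hflux, hn, ((K.mem_facet_body ha he).1 hx).2]
    ring
  · intro e' he' hne
    obtain ⟨b, hb, heb⟩ := Cell.exists_opp he'
    have hba : b ≠ a := by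
      rintro rfl
      exact hne (Facet.ext' (heb.trans he.symm))
    obtain ⟨-, H', -, hn'⟩ := normal_spec K (Nat.succ_pos m) hb heb
    rw [Facet.surface, setIntegral_congr_fun (g := fun _ => (0 : ℝ))
      e'.isCompact_body.measurableSet fun x hx => ?_]
    · simp
    · rw [hflux, ← sub_sub_sub_cancel_right x a b, inner_sub_left, hn', hn',
        ((K.mem_facet_body hb heb).1 hx).2, K.bary_ne hb ha hba]
      ring

theorem Cell.sum_bary_linear (v : Pt (m + 1)) : ∑ a ∈ K.verts, (K.bary a).linear v = 0 := by
  have h : ∀ a, (K.bary a).linear v = K.bary a v - K.bary a 0 := fun a => by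
    rw [affineMap_eq (K.bary a) v, add_sub_cancel_right]
  simp only [h, Finset.sum_sub_distrib, K.sum_bary, sub_self]

theorem Cell.sum_bary_linear_smul (v : Pt (m + 1)) :
    ∑ a ∈ K.verts, (K.bary a).linear v • a = v := by
  have h : ∀ a, (K.bary a).linear v = K.bary a v - K.bary a 0 := fun a => by
    rw [affineMap_eq (K.bary a) v, add_sub_cancel_right]
  simp only [h, sub_smul, Finset.sum_sub_distrib, K.sum_bary_smul, sub_zero]

/-- The divergence theorem on an element, for polynomial fields. -/
theorem integral_divergence (q : Fin (m + 1) → MvPolynomial (Fin (m + 1)) ℝ) :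
    SatisfiesDivergence K q := by
  -- Let c a k = ∂ₖλ_a. From ∑ λ_a = 1 and ∑ λ_a a = x follow ∑ c a k = 0 and ∑ (c a k) a = e_k.
  -- Hence q = ∑ (x - a) f_a with f_a = -∑ (c a k) qₖ, a sum of radial fields.
  let c : Pt (m + 1) → Fin (m + 1) → ℝ := fun a k => (K.bary a).linear (EuclideanSpace.single k 1)
  let f : Pt (m + 1) → MvPolynomial (Fin (m + 1)) ℝ := fun a =>
    -∑ k, MvPolynomial.C (c a k) * q k
  have hq : q = ∑ a ∈ K.verts, fun i => (MvPolynomial.X i - MvPolynomial.C (a i)) * f a := by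
    funext i
    rw [Finset.sum_apply]
    have h1 : ∀ k, ∑ a ∈ K.verts, c a k = 0 := fun k => K.sum_bary_linear _
    have h2 : ∀ k, ∑ a ∈ K.verts, c a k * a i = if i = k then 1 else 0 := fun k => by
      have := congrArg (fun x : Pt (m + 1) => x i)
        (K.sum_bary_linear_smul (EuclideanSpace.single k 1))
      simpa [Pi.single_apply] using this
    have h3 : ∀ a, (MvPolynomial.X i - MvPolynomial.C (a i)) * f a =
        ∑ k, (MvPolynomial.C (c a k * a i) * q k - MvPolynomial.C (c a k) * (MvPolynomial.X i * q k)) :=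
      fun a => by
        simp only [f, MvPolynomial.C_mul, mul_neg, Finset.mul_sum, ← Finset.sum_neg_distrib]
        refine Finset.sum_congr rfl fun k _ => ?_
        ring
    simp only [h3]
    rw [Finset.sum_comm]
    have h4 : ∀ k, ∑ a ∈ K.verts, (MvPolynomial.C (c a k * a i) * q k -
        MvPolynomial.C (c a k) * (MvPolynomial.X i * q k)) = if i = k then q k else 0 := fun k => by
      rw [Finset.sum_sub_distrib, ← Finset.sum_mul, ← Finset.sum_mul, ← map_sum, ← map_sum, h1, h2]
      split_ifs <;> simp
    rw [Finset.sum_congr rfl fun k _ => h4 k]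
    simp
  rw [hq]
  exact SatisfiesDivergence.sum K _ fun a ha => satisfiesDivergence_radial K ha (f a)

/-- Integration by parts on an element, for polynomials. -/
theorem integral_by_parts (p : MvPolynomial (Fin (m + 1)) ℝ)
    (q : Fin (m + 1) → MvPolynomial (Fin (m + 1)) ℝ) :
    ∫ x in K.inner, vecFun _ (gradient _ p) x ⬝ᵥ vecFun _ q x =
      -(∫ x in K.inner, polyFun _ p x * polyFun _ (divergence _ q) x) +
      ∑ e ∈ K.facets, ∫ x, polyFun _ p x * (vecFun _ q x ⬝ᵥ (K.normal e).ofLp) ∂e.surface := by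
  have h := integral_divergence K (fun i => p * q i)
  have h1 : ∀ x, polyFun _ (divergence _ fun i => p * q i) x =
      polyFun _ p x * polyFun _ (divergence _ q) x +
        vecFun _ (gradient _ p) x ⬝ᵥ vecFun _ q x := fun x => by
    rw [divergence_apply, divergence_apply, polyFun_sum, polyFun_sum, Finset.mul_sum, dotProduct,
      ← Finset.sum_add_distrib]
    refine Finset.sum_congr rfl fun i _ => ?_
    rw [MvPolynomial.pderiv_mul, map_add, Pi.add_apply, polyFun_mul, polyFun_mul, add_comm]
    rfl
  have h2 : ∀ (e : T.Facet) x, fluxFun (K.normal e) (fun i => p * q i) x =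
      polyFun _ p x * (vecFun _ q x ⬝ᵥ (K.normal e).ofLp) := fun e x => by
    rw [fluxFun_apply, dotProduct, Finset.mul_sum]
    refine Finset.sum_congr rfl fun i _ => ?_
    rw [polyFun_mul, mul_assoc]
    rfl
  rw [SatisfiesDivergence] at h
  simp only [h1, h2] at h
  have h3 : Integrable (fun x => polyFun _ p x * polyFun _ (divergence _ q) x)
      (volume.restrict K.inner) :=
    K.integrableOn ((continuous_polyFun p).mul (continuous_polyFun (divergence _ q)))
  have h4 : Integrable (fun x => vecFun _ (gradient _ p) x ⬝ᵥ vecFun _ q x)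
      (volume.restrict K.inner) :=
    K.integrableOn ((continuous_vecFun (gradient _ p)).dotProduct (continuous_vecFun q))
  rw [integral_add h3 h4] at h
  linarith

end Cone

end SimplicialMesh


/-! ### Scaled estimates on elements and charts of facets -/

theorem continuous_polyFun_sq {d : ℕ} (p : MvPolynomial (Fin d) ℝ) :
    Continuous fun x => polyFun d p x ^ 2 := (continuous_polyFun p).pow 2

namespace SimplicialMesh

section Estimates

variable {m : ℕ} {Ω : Domain (m + 1)} {T : SimplicialMesh Ω}

/-- Every element contains a ball of radius `h / κ` and lies in the concentric ball of radius
`κ h`. -/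
def Regular {d : ℕ} {Ω : Domain d} (T : SimplicialMesh Ω) (κ : ℝ) : Prop :=
  ∀ K : T.Cell, ∃ x : Pt d, Metric.closedBall x (T.h / κ) ⊆ K.body ∧
    K.body ⊆ Metric.closedBall x (κ * T.h)

/-- From h ≤ τ diam K and diam K ≤ σr comes r ≥ h/(στ), and diam K ≤ τh bounds the element from
outside. The signs of σ and τ are forced as soon as there is an element. -/
theorem regular_of_shapeRegular {d : ℕ} {Ω : Domain d} {T : SimplicialMesh Ω} {σ τ : ℝ}
    (hσ : T.ShapeRegular σ) (hτ : T.QuasiUniform τ) : T.Regular (max 1 (max (σ * τ) τ)) := by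
  intro K
  obtain ⟨x, r, hr, hball, hdiam⟩ := hσ K
  obtain ⟨h1, h2⟩ := hτ K
  have hh := T.h_pos
  have hD0 : 0 ≤ Metric.diam K.body := Metric.diam_nonneg
  have hτ0 : 0 < τ := by
    by_contra hc
    have := mul_nonneg_of_nonpos_of_nonpos (not_lt.1 hc) (neg_nonpos.2 hD0)
    linarith
  have hD : 0 < Metric.diam K.body := by
    rcases hD0.eq_or_lt with h | h
    · rw [← h] at h2; linarith
    · exact h
  have hσ0 : 0 < σ := by
    by_contra hc
    have := mul_nonneg_of_nonpos_of_nonpos (not_lt.1 hc) (neg_nonpos.2 hr.le)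
    linarith
  refine ⟨x, (Metric.closedBall_subset_closedBall ?_).trans hball, fun y hy => ?_⟩
  · rw [div_le_iff₀ (lt_of_lt_of_le one_pos (le_max_left _ _))]
    calc T.h ≤ τ * (σ * r) := h2.trans (mul_le_mul_of_nonneg_left hdiam hτ0.le)
      _ = r * (σ * τ) := by ring
      _ ≤ _ := mul_le_mul_of_nonneg_left ((le_max_left _ _).trans (le_max_right _ _)) hr.le
  · have hx : x ∈ K.body := hball (Metric.mem_closedBall_self hr.le)
    refine (Metric.dist_le_diam_of_mem K.isCompact_body.isBounded hy hx).trans (h1.trans ?_)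
    exact mul_le_mul_of_nonneg_right ((le_max_right _ _).trans (le_max_right _ _)) hh.le

theorem Regular.ball_subset_inner {K : T.Cell} {x : Pt (m + 1)} {r : ℝ}
    (h : Metric.closedBall x r ⊆ K.body) : Metric.ball x r ⊆ K.inner :=
  interior_maximal (Metric.ball_subset_closedBall.trans h) Metric.isOpen_ball

theorem Cell.setIntegral_ball_le {K : T.Cell} {x : Pt (m + 1)} {r : ℝ}
    (h : Metric.ball x r ⊆ K.inner) {f : Pt (m + 1) → ℝ} (hf : Continuous f) (h0 : ∀ y, 0 ≤ f y) :
    ∫ y in Metric.ball x r, f y ≤ ∫ y in K.inner, f y :=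
  setIntegral_mono_set (K.integrableOn hf) (Filter.Eventually.of_forall h0) h.eventuallyLE

/-- The maximum of a polynomial over an element is bounded by its `L²` norm over a smaller ball in
the element. -/
theorem exists_cell_half_sq_le (m k : ℕ) {κ : ℝ} (hκ : 1 ≤ κ) : ∃ C > 0,
    ∀ {Ω : Domain (m + 1)} {T : SimplicialMesh Ω} (K : T.Cell) (x : Pt (m + 1)),
    K.body ⊆ Metric.closedBall x (κ * T.h) → ∀ p ∈ Poly (m + 1) k, ∀ y ∈ K.body,
      polyFun _ p y ^ 2 ≤
        C * ((T.h ^ (m + 1))⁻¹ * ∫ z in Metric.ball x (T.h / κ / 2), polyFun _ p z ^ 2) := by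
  -- The ratio of the outer radius κh to the inner radius h/(2κ) is 2κ². The inner ball is halved
  -- because the lower bounds on barycentric coordinates need room around each of its points.
  obtain ⟨C, hC, h⟩ := exists_ball_sq_le (m + 1) k (2 * κ ^ 2)
  have hκ0 : 0 < κ := by linarith
  refine ⟨C * (2 * κ) ^ (m + 1), by positivity, fun {Ω T} K x hK p hp y hy => ?_⟩
  have hh := T.h_pos
  have h1 := h p hp x (T.h / κ / 2) (by positivity) y (by
    have := hK hy
    rwa [show 2 * κ ^ 2 * (T.h / κ / 2) = κ * T.h by field_simp])
  refine h1.trans_eq ?_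
  rw [div_div, mul_comm κ 2, div_pow]
  field_simp

theorem exists_cell_sq_le (m k : ℕ) {κ : ℝ} (hκ : 1 ≤ κ) : ∃ C > 0,
    ∀ {Ω : Domain (m + 1)} {T : SimplicialMesh Ω}, T.Regular κ → ∀ (K : T.Cell),
    ∀ p ∈ Poly (m + 1) k, ∀ y ∈ K.body,
      polyFun _ p y ^ 2 ≤ C * ((T.h ^ (m + 1))⁻¹ * ∫ z in K.inner, polyFun _ p z ^ 2) := by
  obtain ⟨C, hC, h⟩ := exists_cell_half_sq_le m k hκ
  have hκ0 : 0 < κ := by linarith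
  refine ⟨C, hC, fun {Ω T} hT K p hp y hy => ?_⟩
  have hh := T.h_pos
  obtain ⟨x, hx, hK⟩ := hT K
  refine (h K x hK p hp y hy).trans ?_
  have hsub : Metric.ball x (T.h / κ / 2) ⊆ K.inner :=
    (Metric.ball_subset_ball (half_le_self (by positivity))).trans (Regular.ball_subset_inner hx)
  have := Cell.setIntegral_ball_le hsub (continuous_polyFun_sq p) fun y => sq_nonneg _
  exact mul_le_mul_of_nonneg_left (mul_le_mul_of_nonneg_left this (by positivity)) hC.le

theorem exists_cell_gradient_le (m k : ℕ) {κ : ℝ} (hκ : 1 ≤ κ) : ∃ C > 0,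
    ∀ {Ω : Domain (m + 1)} {T : SimplicialMesh Ω}, T.Regular κ → ∀ (K : T.Cell),
    ∀ p ∈ Poly (m + 1) k, ∀ y ∈ K.body, T.h ^ 2 * sqNorm (gradient _ p) y ≤
      C * ((T.h ^ (m + 1))⁻¹ * ∫ z in K.inner, polyFun _ p z ^ 2) := by
  choose C hC h using fun i => exists_ball_pderiv_sq_le (m + 1) k i (κ ^ 2)
  have hκ0 : 0 < κ := by linarith
  refine ⟨∑ i, κ ^ 2 * κ ^ (m + 1) * C i, Finset.sum_pos (fun i _ => by have := hC i; positivity)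
    ⟨0, by simp⟩, fun {Ω T} hT K p hp y hy => ?_⟩
  have hh := T.h_pos
  obtain ⟨x, hx, hK⟩ := hT K
  rw [sqNorm_eq, Finset.mul_sum, Finset.sum_mul]
  refine Finset.sum_le_sum fun i _ => ?_
  have h1 := h i p hp x (T.h / κ) (by positivity) y (by
    have := hK hy
    rwa [show κ ^ 2 * (T.h / κ) = κ * T.h by field_simp])
  have h2 := Cell.setIntegral_ball_le (Regular.ball_subset_inner hx)
    (continuous_polyFun_sq p) fun y => sq_nonneg _
  have h3 := h1.trans (mul_le_mul_of_nonneg_left (mul_le_mul_of_nonneg_left h2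
    (by positivity)) (hC i).le)
  have h4 := mul_le_mul_of_nonneg_left h3 (sq_nonneg κ)
  calc T.h ^ 2 * polyFun _ (gradient _ p i) y ^ 2
      = κ ^ 2 * ((T.h / κ) ^ 2 * polyFun _ (MvPolynomial.pderiv i p) y ^ 2) := by
        rw [div_pow, ← mul_assoc, mul_div_cancel₀ _ (by positivity)]
        rfl
    _ ≤ _ := h4
    _ = _ := by rw [div_pow]; field_simp

theorem exists_cell_integral_le (m : ℕ) {κ : ℝ} (hκ : 1 ≤ κ) : ∃ C > 0,
    ∀ {Ω : Domain (m + 1)} {T : SimplicialMesh Ω}, T.Regular κ → ∀ (K : T.Cell)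
    {f : Pt (m + 1) → ℝ} {M : ℝ}, Continuous f → 0 ≤ M → (∀ x ∈ K.body, f x ≤ M) →
      ∫ x in K.inner, f x ≤ C * T.h ^ (m + 1) * M := by
  have hκ0 : 0 < κ := by linarith
  set B := (volume (Metric.ball (0 : Pt (m + 1)) 1)).toReal
  have hB : 0 < B := ENNReal.toReal_pos (Metric.measure_ball_pos _ _ one_pos).ne'
    measure_ball_lt_top.ne
  refine ⟨κ ^ (m + 1) * B, by positivity, fun {Ω T} hT K f M hf hM h => ?_⟩
  have hh := T.h_pos
  obtain ⟨x, hx, hK⟩ := hT K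
  have h1 : ∫ x in K.inner, f x ≤ ∫ x in K.inner, M :=
    setIntegral_mono_on (K.integrableOn hf) (K.integrableOn continuous_const)
      K.isOpen_inner.measurableSet fun y hy => h y (interior_subset hy)
  rw [setIntegral_const, smul_eq_mul] at h1
  refine h1.trans (mul_le_mul_of_nonneg_right ?_ hM)
  have h2 : volume.real K.inner ≤ volume.real (Metric.closedBall x (κ * T.h)) :=
    measureReal_mono (interior_subset.trans hK) measure_closedBall_lt_top.ne
  refine h2.trans_eq ?_
  rw [measureReal_def, Measure.addHaar_closedBall _ _ (by positivity), finrank_euclideanSpace_fin,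
    ENNReal.toReal_mul, ENNReal.toReal_ofReal (by positivity)]
  ring

open Classical in
/-- A facet in coordinates of its hyperplane, on a regular mesh. -/
theorem Regular.facet_chart {κ : ℝ} (hκ : 1 ≤ κ) (hT : T.Regular κ) {K : T.Cell} {e : T.Facet}
    {a : Pt (m + 1)} (ha : a ∈ K.verts) (he : e.verts = K.verts.erase a) :
    ‖K.normal e‖ = 1 ∧ ∃ (H : ℝ) (γ : Pt m →ᵃ[ℝ] Pt (m + 1)) (β : Pt (m + 1) →ᵃ[ℝ] Pt m)
      (E : Set (Pt m)), T.h / κ ≤ H ∧ H ≤ 2 * κ * T.h ∧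
      (∀ x, inner ℝ (x - a) (K.normal e) = H * (1 - K.bary a x)) ∧
      MeasurableSet E ∧ (∀ f : Pt (m + 1) → ℝ, ∫ x, f x ∂e.surface = ∫ z in E, f (γ z)) ∧
      Metric.ball 0 (T.h / κ) ⊆ E ∧ E ⊆ Metric.closedBall 0 (2 * κ * T.h) ∧
      IsCompact E ∧ (∀ z ∈ E, γ z ∈ e.body) ∧ (∀ x ∈ e.body, β x ∈ E ∧ γ (β x) = x) ∧
      ∀ x ∈ K.body, ‖β x‖ ≤ 2 * κ * T.h := by
  classical
  have hκ0 : 0 < κ := by linarith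
  have hh := T.h_pos
  obtain ⟨hn1, H, hH, hn⟩ := normal_spec K (Nat.succ_pos m) ha he
  obtain ⟨x₀, hx₀, hK⟩ := hT K
  obtain ⟨Φ, hΦ⟩ := exists_split m hn1
  have hr : 0 < T.h / κ := by positivity
  have hx₀K : x₀ ∈ K.body := hx₀ (Metric.mem_closedBall_self hr.le)
  have hdist : ∀ x ∈ K.body, ∀ y ∈ K.body, ‖x - y‖ ≤ 2 * κ * T.h := fun x hx y hy => by
    have h1 := hK hx
    have h2 := hK hy
    rw [Metric.mem_closedBall] at h1 h2
    rw [← dist_eq_norm]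
    linarith [dist_triangle_right x y x₀]
  have hvert : ∀ b ∈ K.verts, b ∈ K.body := fun b hb => subset_convexHull ℝ _ hb
  set l := K.bary a x₀ with hl
  have hl0 : 0 ≤ l := K.mem_body.1 hx₀K a ha
  -- The point x₀ - (h/κ)n still lies in K, hence has nonnegative height over a. So the height H(1 -
  -- l) of x₀ is at least h/κ.
  have hHl : T.h / κ ≤ H * (1 - l) := by
    have h1 : x₀ - (T.h / κ) • K.normal e ∈ K.body := hx₀ (by
      rw [Metric.mem_closedBall, dist_eq_norm, sub_sub_cancel_left, norm_neg, norm_smul, hn1, mul_one,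
        Real.norm_of_nonneg hr.le])
    have h2 := K.bary_le_one h1 ha
    have h3 := hn (x₀ - (T.h / κ) • K.normal e)
    rw [sub_right_comm, inner_sub_left, inner_smul_left, real_inner_self_eq_norm_sq, hn1, hn] at h3
    simp only [conj_trivial, one_pow, mul_one] at h3
    have := mul_nonneg hH.le (sub_nonneg.2 h2)
    linarith
  have hl1 : 0 < 1 - l := by
    by_contra hc
    have := mul_nonneg hH.le (neg_nonneg.2 (not_lt.1 hc))
    linarith
  -- The central projection of the ball's center from a to the hyperplane of the facet; it becomes
  -- the origin of the chart.
  set y₀ : Pt (m + 1) := a + (1 - l)⁻¹ • (x₀ - a) with hy₀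
  have hy₀0 : K.bary a y₀ = 0 := by
    rw [hy₀, K.bary_segment, K.bary_self ha, ← hl]
    field_simp
    ring
  -- Contracting the disc about y₀ toward a by 1 - l ≤ 1 maps it into the inscribed ball. The
  -- contraction only scales the remaining barycentric coordinates, so they were nonnegative before
  -- it.
  have hball : ∀ y, K.bary a y = 0 → ‖y - y₀‖ ≤ T.h / κ → y ∈ e.body := by
    intro y hy hyn
    refine (K.mem_facet_body ha he).2 ⟨K.mem_body.2 fun b hb => ?_, hy⟩
    by_cases hba : b = a
    · rw [hba, hy]
    have h1 : a + (1 - l) • (y - a) ∈ K.body := hx₀ (by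
      have h2 : a + (1 - l) • (y - a) - x₀ = (1 - l) • (y - y₀) := by
        have : x₀ = a + (1 - l) • (y₀ - a) := by
          rw [hy₀, add_sub_cancel_left, smul_inv_smul₀ hl1.ne', add_sub_cancel]
        nth_rw 1 [this]
        rw [add_sub_add_left_eq_sub, ← smul_sub, sub_sub_sub_cancel_right]
      rw [Metric.mem_closedBall, dist_eq_norm, h2, norm_smul, Real.norm_of_nonneg hl1.le]
      nlinarith [norm_nonneg (y - y₀)])
    have h3 := K.mem_body.1 h1 b hb
    rw [K.bary_segment, K.bary_ne hb ha hba, mul_zero, zero_add] at h3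
    exact nonneg_of_mul_nonneg_right h3 hl1
  have hy₀e : y₀ ∈ e.body := hball y₀ hy₀0 (by rw [sub_self, norm_zero]; exact hr.le)
  have hy₀K : y₀ ∈ K.body := ((K.mem_facet_body ha he).1 hy₀e).1
  let γ : Pt m →ᵃ[ℝ] Pt (m + 1) := AffineMap.const ℝ _ y₀ + (hyper Φ).toAffineMap
  let β : Pt (m + 1) →ᵃ[ℝ] Pt m :=
    (hyperProj Φ).toAffineMap.comp (AffineMap.id ℝ _ - AffineMap.const ℝ _ y₀)
  have hγ : ∀ z, γ z = y₀ + hyper Φ z := fun z => rfl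
  have hβ : ∀ x, β x = hyperProj Φ (x - y₀) := fun x => rfl
  have hfi : Isometry (fun z => y₀ + hyper Φ z) := by
    refine Isometry.of_dist_eq fun z z' => ?_
    rw [dist_eq_norm, dist_eq_norm, add_sub_add_left_eq_sub, ← map_sub, norm_hyper]
  have hbγ : ∀ z, K.bary a (γ z) = 0 := fun z => by
    have h1 := hn (γ z)
    have h2 := hn y₀
    rw [hγ, ← sub_add_eq_add_sub, inner_add_left, ← hΦ, inner_hyper, add_zero, hΦ, h2, hy₀0,
      ← hγ] at h1
    have := mul_left_cancel₀ hH.ne' h1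
    linarith
  have hEc : IsCompact ((fun z => y₀ + hyper Φ z) ⁻¹' e.body) :=
    hfi.isClosedEmbedding.isCompact_preimage e.isCompact_body
  refine ⟨hn1, H, γ, β, (fun z => y₀ + hyper Φ z) ⁻¹' e.body, ?_, ?_, hn, hEc.measurableSet,
    Facet.integral_eq K ha he Φ hΦ hy₀0, fun z hz => ?_, fun z hz => ?_, hEc, fun z hz => hz,
    fun x hx => ?_, fun x hx => ?_⟩
  · nlinarith
  · have h1 := hn y₀
    rw [hy₀0, sub_zero, mul_one] at h1
    rw [← h1]
    refine (real_inner_le_norm _ _).trans ?_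
    rw [hn1, mul_one]
    exact hdist _ hy₀K _ (hvert a ha)
  · refine hball _ (hbγ z) ?_
    rw [add_sub_cancel_left, norm_hyper]
    rw [mem_ball_zero_iff] at hz
    exact hz.le
  · rw [mem_closedBall_zero_iff, ← norm_hyper Φ, ← add_sub_cancel_left y₀ (hyper Φ z)]
    exact hdist _ ((K.mem_facet_body ha he).1 hz).1 _ hy₀K
  · have h1 : γ (β x) = x := by
      have h0 : inner ℝ (x - y₀) (K.normal e) = 0 := by
        rw [← sub_sub_sub_cancel_right x y₀ a, inner_sub_left, hn, hn, hy₀0,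
          ((K.mem_facet_body ha he).1 hx).2, sub_self]
      have h2 := split_decomp Φ (x - y₀)
      rw [hΦ, h0, zero_smul, zero_add] at h2
      rw [hγ, hβ, ← h2, add_sub_cancel]
    refine ⟨?_, h1⟩
    rw [hγ] at h1
    rw [Set.mem_preimage, h1]
    exact hx
  · rw [hβ]
    exact (norm_hyperProj_le Φ _).trans (hdist _ hx _ hy₀K)

end Estimates

end SimplicialMesh


/-! ### Membership in the local spaces G_j -/

section GradSpace

variable {d : ℕ}

theorem mem_gradSpace_BDM {j : ℕ} {q : Fin d → MvPolynomial (Fin d) ℝ} :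
    q ∈ gradSpace d Pair.BDM j ↔ ∀ i, q i ∈ Poly d (j + 1) := by
  simp [gradSpace, Submodule.mem_pi]

theorem pi_Poly_le_gradSpace_RT {j : ℕ} {q : Fin d → MvPolynomial (Fin d) ℝ}
    (h : ∀ i, q i ∈ Poly d j) : q ∈ gradSpace d Pair.RT j :=
  Submodule.mem_sup_left (Submodule.mem_pi.2 fun i _ => h i)

theorem gradSpace_RT_le_BDM (j : ℕ) : gradSpace d Pair.RT j ≤ gradSpace d Pair.BDM j := by
  refine sup_le (fun q hq => ?_) ?_
  · exact mem_gradSpace_BDM.2 fun i => Poly_mono (Nat.le_succ j) (Submodule.mem_pi.1 hq i trivial)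
  · rintro q ⟨p, hp, rfl⟩
    refine mem_gradSpace_BDM.2 fun i => ?_
    have hp' : p ∈ Poly d j := mem_Poly.2
      ((MvPolynomial.mem_homogeneousSubmodule j p).1 hp).totalDegree_le
    have := mul_mem_Poly (X_mem_Poly i) hp'
    rwa [add_comm] at this

theorem gradSpace_le_BDM (P : Pair) (j : ℕ) : gradSpace d P j ≤ gradSpace d Pair.BDM j := by
  cases P
  · exact gradSpace_RT_le_BDM j
  · exact le_rfl

theorem gradSpace_RT_le (P : Pair) (j : ℕ) : gradSpace d Pair.RT j ≤ gradSpace d P j := by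
  cases P
  · exact le_rfl
  · exact gradSpace_RT_le_BDM j

/-- Only the homogeneous part of degree j needs the extra summand of the Raviart–Thomas space; x
times the lower parts has degree at most j. -/
theorem X_mul_mem_gradSpace_RT {j : ℕ} {p : MvPolynomial (Fin d) ℝ} (hp : p ∈ Poly d j) :
    (fun i => MvPolynomial.X i * p) ∈ gradSpace d Pair.RT j := by
  have hdeg := mem_Poly.1 hp
  have hsplit : p = ∑ k ∈ Finset.range j, MvPolynomial.homogeneousComponent k p +
      MvPolynomial.homogeneousComponent j p := by
    rw [← Finset.sum_range_succ]
    conv_lhs => rw [← MvPolynomial.sum_homogeneousComponent p]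
    refine Finset.sum_subset (Finset.range_mono (by omega)) fun k _ hk => ?_
    exact MvPolynomial.homogeneousComponent_eq_zero _ _ (by simpa using hk)
  have h1 : (fun i => MvPolynomial.X i * p) =
      (fun i => MvPolynomial.X i * ∑ k ∈ Finset.range j, MvPolynomial.homogeneousComponent k p) +
      (LinearMap.pi fun i => LinearMap.mulLeft ℝ (MvPolynomial.X i))
        (MvPolynomial.homogeneousComponent j p) := by
    funext i
    conv_lhs => rw [hsplit]
    simp [mul_add]
  rw [h1]
  refine add_mem (pi_Poly_le_gradSpace_RT fun i => ?_) (Submodule.mem_sup_right ⟨_,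
    MvPolynomial.homogeneousComponent_mem j p, rfl⟩)
  rw [Finset.mul_sum]
  refine sum_mem fun k hk => ?_
  have h2 : MvPolynomial.homogeneousComponent k p ∈ Poly d k :=
    mem_Poly.2 (MvPolynomial.homogeneousComponent_isHomogeneous k p).totalDegree_le
  exact Poly_mono (by have := Finset.mem_range.1 hk; omega) (mul_mem_Poly (X_mem_Poly i) h2)

theorem radial_mem_gradSpace_RT {j : ℕ} {p : MvPolynomial (Fin d) ℝ} (hp : p ∈ Poly d j)
    (v : Fin d → ℝ) :
    (fun i => (MvPolynomial.X i - MvPolynomial.C (v i)) * p) ∈ gradSpace d Pair.RT j := by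
  have h : (fun i => (MvPolynomial.X i - MvPolynomial.C (v i)) * p) =
      (fun i => MvPolynomial.X i * p) - fun i => MvPolynomial.C (v i) * p := by
    funext i
    simp [sub_mul]
  rw [h]
  refine sub_mem (X_mul_mem_gradSpace_RT hp) (pi_Poly_le_gradSpace_RT fun i => ?_)
  simpa using mul_mem_Poly (C_mem_Poly 0 (v i)) hp

theorem poly_ext {p q : MvPolynomial (Fin d) ℝ} (h : ∀ x, polyFun d p x = polyFun d q x) :
    p = q := by
  rw [← sub_eq_zero]
  exact poly_eq_zero isOpen_univ ⟨0, trivial⟩ _ fun x _ => by simp [h x]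

end GradSpace

/-! ### Lifting normal traces from a facet -/

namespace SimplicialMesh

section Facets

variable {m : ℕ} {Ω : Domain (m + 1)} {T : SimplicialMesh Ω}

theorem Facet.setIntegral_ball_le {e : T.Facet} {γ : Pt m →ᵃ[ℝ] Pt (m + 1)} {E : Set (Pt m)}
    (hE : IsCompact E) {r : ℝ} (hr : Metric.ball 0 r ⊆ E)
    (hsurf : ∀ f : Pt (m + 1) → ℝ, ∫ x, f x ∂e.surface = ∫ z in E, f (γ z))
    (p : MvPolynomial (Fin (m + 1)) ℝ) :
    ∫ z in Metric.ball 0 r, polyFun m (substPoly γ p) z ^ 2 ≤ ∫ x, polyFun _ p x ^ 2 ∂e.surface := by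
  rw [hsurf]
  have h : ∀ z, polyFun _ p (γ z) ^ 2 = polyFun m (substPoly γ p) z ^ 2 := fun z => by
    rw [polyFun_substPoly]
  simp only [h]
  exact setIntegral_mono_set ((continuous_polyFun_sq _).continuousOn.integrableOn_compact hE)
    (Filter.Eventually.of_forall fun z => sq_nonneg _) hr.eventuallyLE

/-- The maximum of a polynomial over a facet is bounded by its `L²` norm. -/
theorem exists_facet_sq_le (m k : ℕ) {κ : ℝ} (hκ : 1 ≤ κ) : ∃ C > 0,
    ∀ {Ω : Domain (m + 1)} {T : SimplicialMesh Ω}, T.Regular κ → ∀ (K : T.Cell), ∀ e ∈ K.facets,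
    ∀ p ∈ Poly (m + 1) k, ∀ y ∈ e.body,
      polyFun _ p y ^ 2 ≤ C * ((T.h ^ m)⁻¹ * ∫ z, polyFun _ p z ^ 2 ∂e.surface) := by
  obtain ⟨C, hC, h⟩ := exists_ball_sq_le m k (2 * κ ^ 2)
  have hκ0 : 0 < κ := by linarith
  refine ⟨C * κ ^ m, by positivity, fun {Ω T} hT K e he p hp y hy => ?_⟩
  have hh := T.h_pos
  obtain ⟨a, ha, hea⟩ := Cell.exists_opp he
  obtain ⟨-, H, γ, β, E, -, -, -, -, hsurf, hr, hR, hEc, -, hβ, -⟩ := hT.facet_chart hκ ha hea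
  obtain ⟨h1, h2⟩ := hβ y hy
  have h3 := h (substPoly γ p) (substPoly_mem γ hp) 0 (T.h / κ) (by positivity) (β y) (by
    have := hR h1
    rwa [show 2 * κ ^ 2 * (T.h / κ) = 2 * κ * T.h by field_simp])
  rw [polyFun_substPoly, h2] at h3
  refine h3.trans ((mul_le_mul_of_nonneg_left (mul_le_mul_of_nonneg_left
    (Facet.setIntegral_ball_le hEc hr hsurf p) (by positivity)) hC.le).trans_eq ?_)
  rw [div_pow]
  field_simp

theorem exists_facet_integral_le (m : ℕ) {κ : ℝ} (hκ : 1 ≤ κ) : ∃ C > 0,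
    ∀ {Ω : Domain (m + 1)} {T : SimplicialMesh Ω}, T.Regular κ → ∀ (K : T.Cell), ∀ e ∈ K.facets,
    ∀ {f : Pt (m + 1) → ℝ} {M : ℝ}, ContinuousOn f e.body → 0 ≤ M → (∀ x ∈ e.body, f x ≤ M) →
      ∫ x, f x ∂e.surface ≤ C * T.h ^ m * M := by
  have hκ0 : 0 < κ := by linarith
  set B := (volume (Metric.ball (0 : Pt m) 1)).toReal
  have hB : 0 < B := ENNReal.toReal_pos (Metric.measure_ball_pos _ _ one_pos).ne'
    measure_ball_lt_top.ne
  refine ⟨(2 * κ) ^ m * B, by positivity, fun {Ω T} hT K e he f M hf hM h => ?_⟩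
  have hh := T.h_pos
  obtain ⟨a, ha, hea⟩ := Cell.exists_opp he
  obtain ⟨-, H, γ, β, E, -, -, -, -, hsurf, hr, hR, hEc, -, hβ, -⟩ := hT.facet_chart hκ ha hea
  have h1 : ∫ x, f x ∂e.surface ≤ ∫ x, M ∂e.surface :=
    integral_mono_ae (e.integrable hf) (integrable_const M)
      (ae_restrict_of_forall_mem e.isCompact_body.measurableSet h)
  refine h1.trans ?_
  rw [hsurf, setIntegral_const, smul_eq_mul]
  refine mul_le_mul_of_nonneg_right ?_ hM
  have h2 : volume.real E ≤ volume.real (Metric.closedBall (0 : Pt m) (2 * κ * T.h)) :=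
    measureReal_mono hR measure_closedBall_lt_top.ne
  refine h2.trans_eq ?_
  rw [measureReal_def, Measure.addHaar_closedBall _ _ (by positivity), finrank_euclideanSpace_fin,
    ENNReal.toReal_mul, ENNReal.toReal_ofReal (by positivity)]
  ring

open Classical in
theorem Cell.sum_erase_bary {K : T.Cell} {a x : Pt (m + 1)} (ha : a ∈ K.verts)
    (hx : K.bary a x = 0) : ∑ b ∈ K.verts.erase a, K.bary b x = 1 ∧
      ∑ b ∈ K.verts.erase a, K.bary b x • b = x := by
  constructor
  · rw [← K.sum_bary x, ← Finset.add_sum_erase _ _ ha, hx, zero_add]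
  · conv_rhs => rw [← K.sum_bary_smul x, ← Finset.add_sum_erase _ _ ha, hx, zero_smul, zero_add]

/-- Extension of a polynomial on a facet in the form `∑ b, λ_b φ_b`. -/
theorem exists_facet_extension (m : ℕ) (P : Pair) (j : ℕ) {κ : ℝ} (hκ : 1 ≤ κ) : ∃ C > 0,
    ∀ {Ω : Domain (m + 1)} {T : SimplicialMesh Ω}, T.Regular κ → ∀ (K : T.Cell), ∀ e ∈ K.facets,
    ∀ p ∈ Poly (m + 1) (P.faceDegree j), ∃ φ : Pt (m + 1) → MvPolynomial (Fin (m + 1)) ℝ,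
      (∀ b, φ b ∈ Poly (m + 1) j) ∧ (P = Pair.RT → ∃ φ₀, ∀ b, φ b = φ₀) ∧
      (∀ x ∈ e.body, ∑ b ∈ e.verts, K.bary b x * polyFun _ (φ b) x = polyFun _ p x) ∧
      ∀ b ∈ K.verts, ∀ x ∈ K.body, polyFun _ (φ b) x ^ 2 ≤
        C * ((T.h ^ m)⁻¹ * ∫ z, polyFun _ p z ^ 2 ∂e.surface) := by
  have hκ0 : 0 < κ := by linarith
  cases P with
  | RT =>
    obtain ⟨C, hC, h⟩ := exists_ball_sq_le m j (2 * κ ^ 2)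
    refine ⟨C * κ ^ m, by positivity, fun {Ω T} hT K e he p hp => ?_⟩
    have hh := T.h_pos
    obtain ⟨a, ha, hea⟩ := Cell.exists_opp he
    obtain ⟨-, H, γ, β, E, -, -, -, -, hsurf, hr, hR, hEc, -, hβ, hβK⟩ := hT.facet_chart hκ ha hea
    -- For Raviart–Thomas p has degree j already; it is extended constantly along the normal, with
    -- the same φ for all vertices.
    refine ⟨fun _ => substPoly β (substPoly γ p), fun _ => substPoly_mem β (substPoly_mem γ hp),
      fun _ => ⟨_, fun _ => rfl⟩, fun x hx => ?_, fun b _ x hx => ?_⟩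
    · rw [← Finset.sum_mul, hea, (Cell.sum_erase_bary ha ((K.mem_facet_body ha hea).1 hx).2).1,
        one_mul, polyFun_substPoly, polyFun_substPoly, (hβ x hx).2]
    · have h3 := h (substPoly γ p) (substPoly_mem γ hp) 0 (T.h / κ) (by positivity) (β x) (by
        rw [show 2 * κ ^ 2 * (T.h / κ) = 2 * κ * T.h by field_simp, mem_closedBall_zero_iff]
        exact hβK x hx)
      rw [polyFun_substPoly]
      refine h3.trans ((mul_le_mul_of_nonneg_left (mul_le_mul_of_nonneg_left
        (Facet.setIntegral_ball_le hEc hr hsurf p) (by positivity)) hC.le).trans_eq ?_)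
      rw [div_pow]
      field_simp
  | BDM =>
    obtain ⟨c, ψ, hψ, hdiv⟩ := exists_division m j
    -- The constant term is viewed as a constant polynomial, so evaluation at the center (radius 0)
    -- suffices.
    obtain ⟨C₀, hC₀, h₀⟩ := exists_operator_sq_le (n := m) m (j + 1)
      ((Algebra.linearMap ℝ (MvPolynomial (Fin m) ℝ)) ∘ₗ c) 0
    choose C hC h using fun i => exists_operator_sq_le (n := m) m (j + 1) (ψ i) (2 * κ ^ 2)
    have hsum : 0 ≤ ∑ i, (2 * κ ^ 2) ^ 2 * C i := Finset.sum_nonneg fun i _ => by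
      have := hC i; positivity
    refine ⟨(2 * C₀ + 2 * (m * ∑ i, (2 * κ ^ 2) ^ 2 * C i)) * κ ^ m, by positivity,
      fun {Ω T} hT K e he p hp => ?_⟩
    have hh := T.h_pos
    have hr0 : 0 < T.h / κ := by positivity
    obtain ⟨a, ha, hea⟩ := Cell.exists_opp he
    obtain ⟨-, H, γ, β, E, -, -, -, -, hsurf, hr, hR, hEc, -, hβ, hβK⟩ := hT.facet_chart hκ ha hea
    let p' : Poly m (j + 1) := ⟨substPoly (scaling 0 (T.h / κ)) (substPoly γ p),
      substPoly_mem _ (substPoly_mem γ hp)⟩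
    let β' : Pt (m + 1) →ᵃ[ℝ] Pt m := (T.h / κ)⁻¹ • β
    have hβ' : ∀ x, β' x = (T.h / κ)⁻¹ • β x := fun x => rfl
    have hβ'K : ∀ x ∈ K.body, ‖β' x‖ ≤ 2 * κ ^ 2 := fun x hx => by
      rw [hβ', norm_smul, norm_inv, Real.norm_of_nonneg hr0.le, inv_mul_le_iff₀ hr0]
      refine (hβK x hx).trans_eq ?_
      field_simp
    have hI : ∫ x in Metric.ball 0 1, polyFun m p'.1 x ^ 2 ≤
        κ ^ m * ((T.h ^ m)⁻¹ * ∫ z, polyFun _ p z ^ 2 ∂e.surface) := by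
      have h1 := setIntegral_scaling (fun z => polyFun m (substPoly γ p) z ^ 2) 0 hr0
      have h2 : ∀ x, polyFun m p'.1 x ^ 2 =
          polyFun m (substPoly γ p) (0 + (T.h / κ) • x) ^ 2 := fun x => by
        simp only [p', polyFun_substPoly, scaling_apply]
      simp only [h2]
      rw [h1]
      refine (mul_le_mul_of_nonneg_left (Facet.setIntegral_ball_le hEc hr hsurf p)
        (by positivity)).trans_eq ?_
      rw [div_pow]
      field_simp
    have hp'β : ∀ x ∈ e.body, polyFun m p'.1 (β' x) = polyFun _ p x := fun x hx => by
      simp only [p', polyFun_substPoly, scaling_apply, hβ', zero_add]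
      rw [smul_inv_smul₀ hr0.ne', (hβ x hx).2]
    -- In chart coordinates p = c + ∑ Xᵢψᵢ, and on the facet Xᵢ = ∑ λ_b β'(b)ᵢ. Collecting the
    -- coefficient of λ_b gives φ_b = c + ∑ β'(b)ᵢ ψᵢ, one degree lower than p.
    refine ⟨fun b => MvPolynomial.C (c p') + ∑ i, MvPolynomial.C (β' b i) *
      substPoly β' (ψ i p'), fun b => ?_, fun hP => by simp at hP, fun x hx => ?_,
      fun b hb x hx => ?_⟩
    · refine add_mem (C_mem_Poly _ _) (sum_mem fun i _ => ?_)
      simpa using mul_mem_Poly (C_mem_Poly 0 _) (substPoly_mem β' (hψ i p'))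
    · obtain ⟨hs1, hs2⟩ := Cell.sum_erase_bary ha ((K.mem_facet_body ha hea).1 hx).2
      have h1 : β' x = ∑ b ∈ K.verts.erase a, K.bary b x • β' b := by
        conv_lhs => rw [← hs2]
        rw [affineMap_sum _ _ hs1]
      have h2 : ∀ i, β' x i = ∑ b ∈ K.verts.erase a, K.bary b x * β' b i := fun i => by
        rw [h1]; simp
      rw [← hp'β x hx, hdiv p', hea]
      simp only [map_add, Pi.add_apply, polyFun_C, polyFun_sum, polyFun_mul, polyFun_substPoly,
        polyFun_X, mul_add, Finset.sum_add_distrib, ← Finset.sum_mul, hs1, one_mul, h2]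
      congr 1
      simp only [Finset.mul_sum, Finset.sum_mul]
      rw [Finset.sum_comm]
      exact Finset.sum_congr rfl fun i _ => Finset.sum_congr rfl fun b _ => by ring
    · have hbK : b ∈ K.body := subset_convexHull ℝ _ hb
      have e0 : c p' ^ 2 ≤ C₀ * ∫ x in Metric.ball 0 1, polyFun m p'.1 x ^ 2 := by
        have := h₀ p' 0 (by simp)
        simpa [MvPolynomial.algebraMap_eq] using this
      have e1 : ∀ i, (β' b i * polyFun m (ψ i p') (β' x)) ^ 2 ≤
          (2 * κ ^ 2) ^ 2 * C i * ∫ x in Metric.ball 0 1, polyFun m p'.1 x ^ 2 := fun i => by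
        rw [mul_pow, mul_assoc]
        refine mul_le_mul ?_ (h i p' _ (by simpa using hβ'K x hx)) (sq_nonneg _) (by positivity)
        rw [← sq_abs]
        refine pow_le_pow_left₀ (abs_nonneg _) ?_ 2
        exact (PiLp.norm_apply_le (β' b) i).trans (hβ'K b hbK)
      have e2 : (∑ i, β' b i * polyFun m (ψ i p') (β' x)) ^ 2 ≤
          m * ∑ i, (β' b i * polyFun m (ψ i p') (β' x)) ^ 2 := by
        simpa using sq_sum_le_card_mul_sum_sq (s := (Finset.univ : Finset (Fin m)))
          (f := fun i => β' b i * polyFun m (ψ i p') (β' x))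
      have e3 := Finset.sum_le_sum fun i (_ : i ∈ Finset.univ) => e1 i
      rw [← Finset.sum_mul] at e3
      simp only [map_add, Pi.add_apply, polyFun_C, polyFun_sum, polyFun_mul, polyFun_substPoly]
      have e4 := mul_le_mul_of_nonneg_left e3 (Nat.cast_nonneg (α := ℝ) m)
      have e5 : (c p' + ∑ i, β' b i * polyFun m (ψ i p') (β' x)) ^ 2 ≤
          (2 * C₀ + 2 * (m * ∑ i, (2 * κ ^ 2) ^ 2 * C i)) *
            ∫ x in Metric.ball 0 1, polyFun m p'.1 x ^ 2 := by
        nlinarith [sq_nonneg (c p' - ∑ i, β' b i * polyFun m (ψ i p') (β' x))]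
      refine e5.trans ?_
      rw [mul_assoc]
      exact mul_le_mul_of_nonneg_left hI (by positivity)

theorem norm_sum_smul_sq_le {ι E : Type*} [NormedAddCommGroup E] [NormedSpace ℝ E] (s : Finset ι)
    {w : ι → ℝ} (hw : ∀ i ∈ s, 0 ≤ w i) (hw1 : ∑ i ∈ s, w i = 1) {u : ι → E} {M : ℝ}
    (hu : ∀ i ∈ s, ‖u i‖ ^ 2 ≤ M) : ‖∑ i ∈ s, w i • u i‖ ^ 2 ≤ M := by
  have h1 : ‖∑ i ∈ s, w i • u i‖ ≤ √M := by
    refine (norm_sum_le _ _).trans ?_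
    calc ∑ i ∈ s, ‖w i • u i‖ ≤ ∑ i ∈ s, w i * √M := Finset.sum_le_sum fun i hi => by
          rw [norm_smul, Real.norm_of_nonneg (hw i hi)]
          exact mul_le_mul_of_nonneg_left (Real.le_sqrt_of_sq_le (hu i hi)) (hw i hi)
      _ = √M := by rw [← Finset.sum_mul, hw1, one_mul]
  have hM : 0 ≤ M := by
    by_contra hc
    have h0 : ∀ i ∈ s, False := fun i hi => hc ((sq_nonneg _).trans (hu i hi))
    rw [Finset.sum_eq_zero fun i hi => (h0 i hi).elim] at hw1
    exact zero_ne_one hw1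
  calc _ ≤ √M ^ 2 := pow_le_pow_left₀ (norm_nonneg _) h1 2
    _ = M := Real.sq_sqrt hM

theorem sqNorm_eq_norm_sq {d : ℕ} (q : Fin d → MvPolynomial (Fin d) ℝ) (x : Pt d) :
    sqNorm q x = ‖(WithLp.toLp 2 (vecFun d q x) : Pt d)‖ ^ 2 := by
  rw [← dot_self_eq]; rfl

theorem fluxFun_eq_inner {d : ℕ} (n : Pt d) (q : Fin d → MvPolynomial (Fin d) ℝ) (x : Pt d) :
    fluxFun n q x = inner ℝ (WithLp.toLp 2 (vecFun d q x) : Pt d) n := by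
  rw [fluxFun_apply, PiLp.inner_apply]
  refine Finset.sum_congr rfl fun i _ => ?_
  simp [vecFun, mul_comm]

theorem Regular.norm_sub_le {κ : ℝ} (hT : T.Regular κ) {K : T.Cell} {x y : Pt (m + 1)}
    (hx : x ∈ K.body) (hy : y ∈ K.body) : ‖x - y‖ ≤ 2 * κ * T.h := by
  obtain ⟨x₀, -, hK⟩ := hT K
  have h1 := hK hx
  have h2 := hK hy
  rw [Metric.mem_closedBall] at h1 h2
  rw [← dist_eq_norm]
  linarith [dist_triangle_right x y x₀]

/-- A field of the local space with prescribed normal component on one facet and vanishing normal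
component on the others. -/
theorem exists_lift (m : ℕ) (P : Pair) (j : ℕ) {κ : ℝ} (hκ : 1 ≤ κ) : ∃ C > 0,
    ∀ {Ω : Domain (m + 1)} {T : SimplicialMesh Ω}, T.Regular κ → ∀ (K : T.Cell), ∀ e ∈ K.facets,
    ∀ p ∈ Poly (m + 1) (P.faceDegree j), ∃ q : gradSpace (m + 1) P j,
      (∀ x ∈ e.body, fluxFun (K.normal e) q.1 x = polyFun _ p x) ∧
      (∀ e' ∈ K.facets, e' ≠ e → ∀ x ∈ e'.body, fluxFun (K.normal e') q.1 x = 0) ∧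
      ∀ x ∈ K.body, sqNorm q.1 x ≤ C * ((T.h ^ m)⁻¹ * ∫ z, polyFun _ p z ^ 2 ∂e.surface) := by
  classical
  obtain ⟨C, hC, h⟩ := exists_facet_extension m P j hκ
  have hκ0 : 0 < κ := by linarith
  refine ⟨(2 * κ ^ 2) ^ 2 * C, by positivity, fun {Ω T} hT K e he p hp => ?_⟩
  have hh := T.h_pos
  obtain ⟨a, ha, hea⟩ := Cell.exists_opp he
  obtain ⟨-, H, -, -, -, hH1, hH2, hn, -⟩ := hT.facet_chart hκ ha hea
  have hH : 0 < H := lt_of_lt_of_le (by positivity) hH1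
  obtain ⟨φ, hφ, hRT, hφp, hφb⟩ := h hT K e he p hp
  -- The field H⁻¹ ∑ λ_b φ_b (b - a). On e one has λ_a = 0 and (b - a)·n = H, so its flux is ∑ λ_b
  -- φ_b = p. On the facet opposite c ≠ a, λ_c = 0 and every other b - a is tangential. If all φ_b
  -- agree, the field is (x - a)φ₀/H, which is of Raviart–Thomas form.
  let q : Fin (m + 1) → MvPolynomial (Fin (m + 1)) ℝ := fun i =>
    ∑ b ∈ K.verts, affPoly (K.bary b) * φ b * MvPolynomial.C ((b i - a i) / H)
  have hqx : ∀ x, (WithLp.toLp 2 (vecFun _ q x) : Pt (m + 1)) =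
      ∑ b ∈ K.verts, K.bary b x • ((polyFun _ (φ b) x / H) • (b - a)) := fun x => by
    ext i
    simp only [vecFun, LinearMap.coe_mk, AddHom.coe_mk, q, polyFun_sum, polyFun_mul,
      polyFun_affPoly, polyFun_C, WithLp.ofLp_sum, Finset.sum_apply, PiLp.smul_apply, PiLp.sub_apply,
      smul_eq_mul]
    exact Finset.sum_congr rfl fun b _ => by ring
  have hflux : ∀ (n x : Pt (m + 1)), fluxFun n q x = ∑ b ∈ K.verts,
      K.bary b x * (polyFun _ (φ b) x / H * inner ℝ (b - a) n) := fun n x => by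
    rw [fluxFun_eq_inner, hqx, sum_inner]
    exact Finset.sum_congr rfl fun b _ => by
      rw [inner_smul_left, inner_smul_left]; simp
  have hq : q ∈ gradSpace (m + 1) P j := by
    cases P with
    | RT =>
      obtain ⟨φ₀, hφ₀⟩ := hRT rfl
      have : q = H⁻¹ • fun i => (MvPolynomial.X i - MvPolynomial.C (a i)) * φ₀ := by
        funext i
        refine poly_ext fun x => ?_
        have h1 := congrArg (fun x : Pt (m + 1) => x i) (K.sum_bary_smul x)
        simp only [WithLp.ofLp_sum, Finset.sum_apply, PiLp.smul_apply, smul_eq_mul] at h1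
        have h2 : ∑ b ∈ K.verts, K.bary b x * (b i - a i) = x i - a i := by
          simp only [mul_sub, Finset.sum_sub_distrib, h1, ← Finset.sum_mul, K.sum_bary, one_mul]
        simp only [q, hφ₀, polyFun_sum, polyFun_mul, polyFun_affPoly, polyFun_C, Pi.smul_apply,
          map_smul, map_sub, Pi.sub_apply, polyFun_X, smul_eq_mul]
        rw [← h2, Finset.sum_mul, Finset.mul_sum]
        exact Finset.sum_congr rfl fun b _ => by ring
      rw [this]
      exact Submodule.smul_mem _ _ (radial_mem_gradSpace_RT (hφ₀ 0 ▸ hφ 0) _)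
    | BDM =>
      refine mem_gradSpace_BDM.2 fun i => sum_mem fun b _ => ?_
      have := mul_mem_Poly (mul_mem_Poly (affPoly_mem (K.bary b)) (hφ b))
        (C_mem_Poly 0 ((b i - a i) / H))
      exact Poly_mono (by omega) this
  refine ⟨⟨q, hq⟩, fun x hx => ?_, fun e' he' hne x hx => ?_, fun x hx => ?_⟩
  · rw [hflux, ← hφp x hx, hea, ← Finset.add_sum_erase _ _ ha,
      ((K.mem_facet_body ha hea).1 hx).2, zero_mul, zero_add]
    refine Finset.sum_congr rfl fun b hb => ?_
    rw [hn, K.bary_ne ha (Finset.mem_of_mem_erase hb) (Finset.ne_of_mem_erase hb).symm]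
    field_simp
    ring
  · obtain ⟨c, hc, hec⟩ := Cell.exists_opp he'
    have hca : c ≠ a := by
      rintro rfl
      exact hne (Facet.ext' (hec.trans hea.symm))
    obtain ⟨-, H', -, hn'⟩ := normal_spec K (Nat.succ_pos m) hc hec
    rw [hflux]
    refine Finset.sum_eq_zero fun b hb => ?_
    by_cases hbc : b = c
    · rw [hbc, ((K.mem_facet_body hc hec).1 hx).2, zero_mul]
    · rw [← sub_sub_sub_cancel_right b a c, inner_sub_left, hn', hn', K.bary_ne hc hb (Ne.symm hbc),
        K.bary_ne hc ha hca]
      ring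
  · rw [sqNorm_eq_norm_sq, hqx]
    refine norm_sum_smul_sq_le _ (K.mem_body.1 hx) (K.sum_bary x) fun b hb => ?_
    rw [norm_smul, mul_pow, norm_div, Real.norm_eq_abs, Real.norm_of_nonneg hH.le, div_pow, sq_abs]
    have h1 : ‖b - a‖ ≤ 2 * κ ^ 2 * H := by
      refine (hT.norm_sub_le (subset_convexHull ℝ _ hb) (subset_convexHull ℝ _ ha)).trans ?_
      calc 2 * κ * T.h = 2 * κ ^ 2 * (T.h / κ) := by field_simp
        _ ≤ _ := mul_le_mul_of_nonneg_left hH1 (by positivity)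
    have h2 := pow_le_pow_left₀ (norm_nonneg _) h1 2
    have h3 := hφb b hb x hx
    calc _ = (H ^ 2)⁻¹ * (polyFun _ (φ b) x ^ 2 * ‖b - a‖ ^ 2) := by field_simp
      _ ≤ (H ^ 2)⁻¹ * ((C * ((T.h ^ m)⁻¹ * ∫ z, polyFun _ p z ^ 2 ∂e.surface)) *
          (2 * κ ^ 2 * H) ^ 2) := by
        refine mul_le_mul_of_nonneg_left (mul_le_mul h3 h2 (sq_nonneg _) ?_) (by positivity)
        exact (sq_nonneg _).trans h3
      _ = _ := by field_simp

end Facets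

end SimplicialMesh


/-! ### Testing the weak gradient; a bubble field -/

namespace SimplicialMesh

section LocalEstimates

variable {m : ℕ} {Ω : Domain (m + 1)} {T : SimplicialMesh Ω} {P : Pair} {j : ℕ}

/-- `∫_K |∇_w v|²`. -/
def weakEnergy (K : T.Cell) (v : T.weakSpace P j) : ℝ := ∫ x in K.inner, sqNorm (weakGrad K v).1 x

/-- `∫_K |∇v₀|²`. -/
def brokenEnergy (K : T.Cell) (v : T.weakSpace P j) : ℝ :=
  ∫ x in K.inner, sqNorm (gradient (m + 1) (v.1.1 K)) x

/-- `∫_{∂K} |v₀ - v_b|²`. -/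
def jumpEnergy (K : T.Cell) (v : T.weakSpace P j) : ℝ :=
  ∑ e ∈ K.facets, ∫ x, (cellVal K v x - facetVal e v x) ^ 2 ∂e.surface

theorem integrable_sqNorm (K : T.Cell) (q : Fin (m + 1) → MvPolynomial (Fin (m + 1)) ℝ) :
    IntegrableOn (sqNorm q) K.inner := K.integrableOn (continuous_sqNorm q)

theorem integral_sqNorm_nonneg (K : T.Cell) (q : Fin (m + 1) → MvPolynomial (Fin (m + 1)) ℝ) :
    0 ≤ ∫ x in K.inner, sqNorm q x := integral_nonneg fun x => sqNorm_nonneg q x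

theorem jump_nonneg (K : T.Cell) (e : T.Facet) (v : T.weakSpace P j) :
    0 ≤ ∫ x, (cellVal K v x - facetVal e v x) ^ 2 ∂e.surface := integral_nonneg fun _ => sq_nonneg _

theorem jumpEnergy_nonneg (K : T.Cell) (v : T.weakSpace P j) : 0 ≤ jumpEnergy K v :=
  Finset.sum_nonneg fun e _ => jump_nonneg K e v

theorem two_dot_le {ι : Type*} [Fintype ι] (u v : ι → ℝ) {s : ℝ} (hs : 0 < s) :
    2 * (u ⬝ᵥ v) ≤ s * (u ⬝ᵥ u) + s⁻¹ * (v ⬝ᵥ v) := by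
  simp only [dotProduct, Finset.mul_sum, ← Finset.sum_add_distrib]
  refine Finset.sum_le_sum fun i _ => ?_
  have h : s * (u i * u i) + s⁻¹ * (v i * v i) - 2 * (u i * v i) = s⁻¹ * (s * u i - v i) ^ 2 := by
    field_simp
    ring
  have := mul_nonneg (inv_nonneg.2 hs.le) (sq_nonneg (s * u i - v i))
  linarith

theorem two_integral_dot_le (K : T.Cell) (p q : Fin (m + 1) → MvPolynomial (Fin (m + 1)) ℝ) {s : ℝ}
    (hs : 0 < s) : 2 * ∫ x in K.inner, vecFun _ p x ⬝ᵥ vecFun _ q x ≤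
      s * (∫ x in K.inner, sqNorm p x) + s⁻¹ * ∫ x in K.inner, sqNorm q x := by
  rw [← integral_const_mul, ← integral_const_mul, ← integral_const_mul, ← integral_add
    ((integrable_sqNorm K p).const_mul s) ((integrable_sqNorm K q).const_mul s⁻¹)]
  exact integral_mono ((K.integrableOn ((continuous_vecFun _).dotProduct
    (continuous_vecFun _))).const_mul 2) (((integrable_sqNorm K p).const_mul s).add
    ((integrable_sqNorm K q).const_mul s⁻¹)) fun x => two_dot_le (vecFun _ p x) (vecFun _ q x) hs

/-- Integration by parts of v₀ subtracted from the definition of ∇_w: the weak gradient differs from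
∇v₀ by a functional of the jump v₀ - v_b. Each energy estimate below is this identity with a
suitable q. -/
theorem integral_weakGrad_dot (K : T.Cell) (v : T.weakSpace P j) (q : gradSpace (m + 1) P j) :
    ∫ x in K.inner, vecFun _ (weakGrad K v).1 x ⬝ᵥ vecFun _ q.1 x =
      (∫ x in K.inner, vecFun _ (gradient _ (v.1.1 K)) x ⬝ᵥ vecFun _ q.1 x) -
      ∑ e ∈ K.facets, ∫ x, (cellVal K v x - facetVal e v x) * fluxFun (K.normal e) q.1 x
        ∂e.surface := by
  rw [weakGrad_spec, integral_by_parts, add_sub_assoc, ← Finset.sum_sub_distrib]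
  congr 1
  refine Finset.sum_congr rfl fun e _ => ?_
  have h1 : Integrable (fun x => cellVal K v x * fluxFun (K.normal e) q.1 x) e.surface :=
    e.integrable ((continuous_cellVal K v).mul (continuous_fluxFun _ _)).continuousOn
  have h2 : Integrable (fun x => facetVal e v x * fluxFun (K.normal e) q.1 x) e.surface :=
    e.integrable ((continuousOn_facetVal e v).mul (continuous_fluxFun _ _).continuousOn)
  simp only [sub_mul]
  rw [integral_sub h1 h2]
  simp [cellVal, fluxFun]

theorem facet_integral_congr {e : T.Facet} {f g : Pt (m + 1) → ℝ} (h : ∀ x ∈ e.body, f x = g x) :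
    ∫ x, f x ∂e.surface = ∫ x, g x ∂e.surface := by
  rw [Facet.surface]
  exact setIntegral_congr_fun e.isCompact_body.measurableSet fun x hx => h x hx

theorem facet_integral_mono {e : T.Facet} {f g : Pt (m + 1) → ℝ} (hf : ContinuousOn f e.body)
    (hg : ContinuousOn g e.body) (h : ∀ x ∈ e.body, f x ≤ g x) :
    ∫ x, f x ∂e.surface ≤ ∫ x, g x ∂e.surface :=
  integral_mono_ae (e.integrable hf) (e.integrable hg) (by
    rw [Facet.surface]
    exact (ae_restrict_iff' e.isCompact_body.measurableSet).2 (Filter.Eventually.of_forall h))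

/-- The segment from a through x can be prolonged by the factor 1 + t, t = 1/(4κ²), without leaving
K. At its end λ_a = (1 + t)λ_a(x) - t ≥ 0, so λ_a(x) ≥ t/(1 + t), and t ≤ 1/4 makes this at least
4t/5. -/
theorem bary_lower {κ : ℝ} (hκ : 1 ≤ κ) (hT : T.Regular κ) {K : T.Cell} {x : Pt (m + 1)}
    (hx : Metric.closedBall x (T.h / κ / 2) ⊆ K.body) {a : Pt (m + 1)} (ha : a ∈ K.verts) :
    (5 * κ ^ 2)⁻¹ ≤ K.bary a x := by
  have hh := T.h_pos
  have hκ0 : 0 < κ := by linarith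
  set t : ℝ := (4 * κ ^ 2)⁻¹ with ht
  have ht0 : 0 < t := by positivity
  have hxK : x ∈ K.body := hx (Metric.mem_closedBall_self (by positivity))
  have h1 := hT.norm_sub_le hxK (subset_convexHull ℝ _ ha)
  have hz : a + (1 + t) • (x - a) ∈ K.body := by
    refine hx ?_
    rw [mem_closedBall_iff_norm, show a + (1 + t) • (x - a) - x = t • (x - a) by module,
      norm_smul, Real.norm_of_nonneg ht0.le]
    calc t * ‖x - a‖ ≤ t * (2 * κ * T.h) := by gcongr
      _ = T.h / κ / 2 := by rw [ht]; field_simp; norm_num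
  have h2 := K.mem_body.1 hz a ha
  rw [K.bary_segment, K.bary_self ha] at h2
  have ht4 : t ≤ 1 / 4 := by
    rw [ht, inv_le_comm₀ (by positivity) (by norm_num)]
    nlinarith
  have h5 : (5 * κ ^ 2)⁻¹ = 4 / 5 * t := by rw [ht]; field_simp
  rw [h5]
  nlinarith

/-- The field is q = ∑ λ_a ((a - x)·∇p)(a - x). It is tangential on ∂K: on the facet opposite c, λ_c
= 0 and the other a - x are tangential. Also q·∇p = ∑ λ_a ((a - x)·∇p)² ≥ 0. Because ∑ λ_a (a - x) =
0, the inner factor a - x may be replaced by a, which lowers the degree enough for q to lie in the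
Raviart–Thomas space. -/
theorem exists_radial_field (P : Pair) {κ : ℝ} (hκ : 1 ≤ κ) (hT : T.Regular κ)
    (K : T.Cell) {p : MvPolynomial (Fin (m + 1)) ℝ} (hp : p ∈ Poly (m + 1) j) :
    ∃ q : gradSpace (m + 1) P j,
      (∀ e ∈ K.facets, ∀ x ∈ e.body, fluxFun (K.normal e) q.1 x = 0) ∧
      (∀ x ∈ K.body, sqNorm q.1 x ≤ (2 * κ * T.h) ^ 4 * sqNorm (gradient _ p) x) ∧
      (∀ x ∈ K.body, 0 ≤ vecFun _ (gradient _ p) x ⬝ᵥ vecFun _ q.1 x) ∧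
      ∀ x, Metric.closedBall x (T.h / κ / 2) ⊆ K.body →
        (5 * κ ^ 2)⁻¹ * (T.h / κ / 2) ^ 2 * sqNorm (gradient _ p) x ≤
          vecFun _ (gradient _ p) x ⬝ᵥ vecFun _ q.1 x := by
  classical
  have hh := T.h_pos
  have hκ0 : 0 < κ := by linarith
  let s : Pt (m + 1) → MvPolynomial (Fin (m + 1)) ℝ := fun a =>
    ∑ i, MvPolynomial.C (a i) * MvPolynomial.pderiv i p
  let q : Fin (m + 1) → MvPolynomial (Fin (m + 1)) ℝ := -∑ a ∈ K.verts, fun i =>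
    (MvPolynomial.X i - MvPolynomial.C (a i)) * (affPoly (K.bary a) * s a)
  let g : Pt (m + 1) → Pt (m + 1) := fun x => WithLp.toLp 2 (vecFun _ (gradient _ p) x)
  have hg : ∀ x, ‖g x‖ ^ 2 = sqNorm (gradient _ p) x := fun x => (sqNorm_eq_norm_sq _ x).symm
  have hs : ∀ a x, polyFun _ (s a) x = inner ℝ a (g x) := fun a x => by
    simp [s, polyFun_sum, polyFun_mul, polyFun_C, g, PiLp.inner_apply, vecFun, gradient, mul_comm]
  have hq : q ∈ gradSpace (m + 1) P j := by
    refine gradSpace_RT_le P j (neg_mem (sum_mem fun a _ => radial_mem_gradSpace_RT ?_ _))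
    -- For j = 0 the truncated degree j - 1 would leave degree 1, but then ∇p = 0.
    rcases Nat.eq_zero_or_pos j with rfl | hj
    · have h0 : s a = 0 := Finset.sum_eq_zero fun i _ => by
        have : p = MvPolynomial.C (MvPolynomial.coeff 0 p) :=
          MvPolynomial.totalDegree_eq_zero_iff_eq_C.1 (Nat.le_zero.1 (mem_Poly.1 hp))
        rw [this, MvPolynomial.pderiv_C, mul_zero]
      rw [h0, mul_zero]
      exact zero_mem _
    · have : affPoly (K.bary a) * s a ∈ Poly (m + 1) (1 + (0 + (j - 1))) :=
        mul_mem_Poly (affPoly_mem _) (sum_mem fun i _ => mul_mem_Poly (C_mem_Poly 0 _)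
          (pderiv_mem_Poly hp i))
      exact Poly_mono (by omega) this
  have hqx : ∀ x, (WithLp.toLp 2 (vecFun _ q x) : Pt (m + 1)) =
      ∑ a ∈ K.verts, K.bary a x • (inner ℝ (a - x) (g x) • (a - x)) := fun x => by
    have h1 : (WithLp.toLp 2 (vecFun _ q x) : Pt (m + 1)) =
        ∑ a ∈ K.verts, K.bary a x • (inner ℝ a (g x) • (a - x)) := by
      ext i
      simp only [vecFun, LinearMap.coe_mk, AddHom.coe_mk, q, Pi.neg_apply, Finset.sum_apply, map_neg,
        polyFun_sum, polyFun_mul, polyFun_affPoly, polyFun_C, hs, map_sub, Pi.sub_apply, polyFun_X,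
        WithLp.ofLp_sum, PiLp.smul_apply, PiLp.sub_apply, smul_eq_mul, ← Finset.sum_neg_distrib]
      exact Finset.sum_congr rfl fun b _ => by ring
    have h2 : ∑ a ∈ K.verts, K.bary a x • (inner ℝ x (g x) • (a - x)) = 0 := by
      simp only [smul_comm _ (inner ℝ x (g x)), ← Finset.smul_sum, smul_sub, Finset.sum_sub_distrib,
        K.sum_bary_smul, ← Finset.sum_smul, K.sum_bary, one_smul, sub_self]
    rw [h1, ← sub_zero (∑ a ∈ K.verts, _), ← h2, ← Finset.sum_sub_distrib]
    exact Finset.sum_congr rfl fun a _ => by rw [inner_sub_left]; module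
  have hdot : ∀ x, vecFun _ (gradient _ p) x ⬝ᵥ vecFun _ q x =
      ∑ a ∈ K.verts, K.bary a x * inner ℝ (a - x) (g x) ^ 2 := fun x => by
    have : vecFun _ (gradient _ p) x ⬝ᵥ vecFun _ q x =
        inner ℝ (WithLp.toLp 2 (vecFun _ q x) : Pt (m + 1)) (g x) := by
      simp [g, PiLp.inner_apply, dotProduct]
    rw [this, hqx, sum_inner]
    exact Finset.sum_congr rfl fun a _ => by
      rw [inner_smul_left, inner_smul_left, sq]; simp
  refine ⟨⟨q, hq⟩, fun e he x hx => ?_, fun x hx => ?_, fun x hx => ?_, fun x hx => ?_⟩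
  · obtain ⟨c, hc, hec⟩ := Cell.exists_opp he
    obtain ⟨-, H, -, hn⟩ := normal_spec K (Nat.succ_pos m) hc hec
    have hx0 := ((K.mem_facet_body hc hec).1 hx).2
    rw [fluxFun_eq_inner, hqx, sum_inner]
    refine Finset.sum_eq_zero fun b hb => ?_
    by_cases hbc : b = c
    · rw [hbc, hx0, zero_smul, inner_zero_left]
    · rw [inner_smul_left, inner_smul_left, ← sub_sub_sub_cancel_right b x c,
        inner_sub_left _ _ (K.normal e), hn, hn, K.bary_ne hc hb (Ne.symm hbc), hx0]
      ring
  · rw [sqNorm_eq_norm_sq, hqx]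
    refine norm_sum_smul_sq_le _ (K.mem_body.1 hx) (K.sum_bary x) fun b hb => ?_
    have h1 : ‖b - x‖ ≤ 2 * κ * T.h := hT.norm_sub_le (subset_convexHull ℝ _ hb) hx
    have h2 : |inner ℝ (b - x) (g x)| ≤ 2 * κ * T.h * ‖g x‖ :=
      (abs_real_inner_le_norm _ _).trans (by gcongr)
    rw [norm_smul, Real.norm_eq_abs, ← hg]
    calc (|inner ℝ (b - x) (g x)| * ‖b - x‖) ^ 2 ≤ (2 * κ * T.h * ‖g x‖ * (2 * κ * T.h)) ^ 2 := by
          gcongr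
      _ = _ := by ring
  · rw [hdot]
    exact Finset.sum_nonneg fun a ha => mul_nonneg (K.mem_body.1 hx a ha) (sq_nonneg _)
  · rw [hdot, ← hg]
    set ρ := T.h / κ / 2 with hρ
    have hρ0 : 0 < ρ := by positivity
    -- The point x + ρξ, with ξ the direction of ∇p, is a convex combination of vertices. By
    -- Jensen's inequality ρ²|∇p|² ≤ ∑ ((a - x)·∇p)².
    obtain ⟨ξ, hξ, hξg⟩ : ∃ ξ : Pt (m + 1), ‖ξ‖ ≤ 1 ∧ inner ℝ ξ (g x) = ‖g x‖ := by
      refine ⟨‖g x‖⁻¹ • g x, ?_, ?_⟩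
      · rw [norm_smul, norm_inv, norm_norm]
        exact inv_mul_le_one
      · rw [inner_smul_left, real_inner_self_eq_norm_sq]
        by_cases h : ‖g x‖ = 0
        · simp [h]
        · simp; field_simp
    have hy : x + ρ • ξ ∈ K.body := by
      refine hx ?_
      rw [mem_closedBall_iff_norm, add_sub_cancel_left, norm_smul, Real.norm_of_nonneg hρ0.le]
      nlinarith
    have h1 : ∑ a ∈ K.verts, K.bary a (x + ρ • ξ) * inner ℝ (a - x) (g x) = ρ * ‖g x‖ := by
      have : ∑ a ∈ K.verts, K.bary a (x + ρ • ξ) • (a - x) = ρ • ξ := by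
        simp only [smul_sub, Finset.sum_sub_distrib, K.sum_bary_smul, ← Finset.sum_smul, K.sum_bary,
          one_smul, add_sub_cancel_left]
      have h3 := congrArg (fun z : Pt (m + 1) => inner ℝ z (g x)) this
      simp only [sum_inner, real_inner_smul_left, hξg] at h3
      exact h3
    have h2 := norm_sum_smul_sq_le K.verts (K.mem_body.1 hy) (K.sum_bary _)
      (u := fun a => inner ℝ (a - x) (g x)) (M := ∑ a ∈ K.verts, inner ℝ (a - x) (g x) ^ 2)
      fun a ha => by
        rw [Real.norm_eq_abs, sq_abs]
        exact Finset.single_le_sum (f := fun a => inner ℝ (a - x) (g x) ^ 2)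
          (fun b _ => sq_nonneg _) ha
    simp only [smul_eq_mul] at h2
    rw [h1, Real.norm_eq_abs, sq_abs, mul_pow] at h2
    rw [mul_assoc]
    refine (mul_le_mul_of_nonneg_left h2 (by positivity)).trans ?_
    rw [Finset.mul_sum]
    exact Finset.sum_le_sum fun a ha =>
      mul_le_mul_of_nonneg_right (bary_lower hκ hT hx ha) (sq_nonneg _)

end LocalEstimates

end SimplicialMesh


/-! ### Equivalence of the weak energy with broken gradients and jumps -/

namespace SimplicialMesh

section EnergyEquivalence

variable {m : ℕ} {Ω : Domain (m + 1)} {T : SimplicialMesh Ω} {P : Pair} {j : ℕ}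

/-- `∫_K |v₀|²`. -/
def massEnergy (K : T.Cell) (v : T.weakSpace P j) : ℝ := ∫ x in K.inner, cellVal K v x ^ 2

theorem massEnergy_nonneg (K : T.Cell) (v : T.weakSpace P j) : 0 ≤ massEnergy K v :=
  integral_nonneg fun _ => sq_nonneg _

theorem weakInner_self (v : T.weakSpace P j) :
    weakInner v v = ∑ K : T.Cell, (massEnergy K v + T.h * jumpEnergy K v) := by
  simp only [weakInner_apply, massEnergy, jumpEnergy, sq]

theorem exists_cell_sqNorm_le (m k : ℕ) {κ : ℝ} (hκ : 1 ≤ κ) : ∃ C > 0,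
    ∀ {Ω : Domain (m + 1)} {T : SimplicialMesh Ω} (K : T.Cell) (x : Pt (m + 1)),
    K.body ⊆ Metric.closedBall x (κ * T.h) → ∀ q : Fin (m + 1) → MvPolynomial (Fin (m + 1)) ℝ,
      (∀ i, q i ∈ Poly (m + 1) k) → ∀ y ∈ K.body, sqNorm q y ≤
        C * ((T.h ^ (m + 1))⁻¹ * ∫ z in Metric.ball x (T.h / κ / 2), sqNorm q z) := by
  obtain ⟨C, hC, h⟩ := exists_cell_half_sq_le m k hκ
  refine ⟨C, hC, fun {Ω T} K x hK q hq y hy => ?_⟩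
  simp only [sqNorm_eq]
  rw [integral_finsetSum _ fun i _ => integrableOn_ball (continuous_polyFun_sq _) _ _,
    Finset.mul_sum, Finset.mul_sum]
  exact Finset.sum_le_sum fun i _ => h K x hK _ (hq i) y hy

/-- Tested with the bubble field for p = v₀, the weak gradient sees no jump, so ∫ ∇_w v·q = ∫ ∇v₀·q.
This dominates h²∫|∇v₀|² on a concentric half ball, and norm equivalence for polynomials extends the
bound to all of K. -/
theorem exists_brokenEnergy_le (m : ℕ) (P : Pair) (j : ℕ) {κ : ℝ} (hκ : 1 ≤ κ) : ∃ C > 0,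
    ∀ {Ω : Domain (m + 1)} {T : SimplicialMesh Ω}, T.Regular κ → ∀ (K : T.Cell)
    (v : T.weakSpace P j), brokenEnergy K v ≤ C * weakEnergy K v := by
  obtain ⟨C₁, hC₁, h₁⟩ := exists_cell_sqNorm_le m (j - 1) hκ
  obtain ⟨C₂, hC₂, h₂⟩ := exists_cell_integral_le m hκ
  have hκ0 : 0 < κ := by linarith
  set c : ℝ := (5 * κ ^ 2)⁻¹ * (κ⁻¹ / 2) ^ 2 with hc
  have hc0 : 0 < c := by positivity
  refine ⟨(2 * κ) ^ 4 * (C₂ * C₁ / c) ^ 2, by positivity, fun {Ω T} hT K v => ?_⟩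
  have hh := T.h_pos
  obtain ⟨q, hq1, hq2, hq3, hq4⟩ := exists_radial_field P hκ hT K (v.2.1 K)
  obtain ⟨x, hx1, hx2⟩ := hT K
  set g := gradient (m + 1) (v.1.1 K) with hg
  have hb : Metric.ball x (T.h / κ / 2) ⊆ K.inner :=
    (Metric.ball_subset_ball (half_le_self (by positivity))).trans (Regular.ball_subset_inner hx1)
  have hdot : ∫ y in K.inner, vecFun _ (weakGrad K v).1 y ⬝ᵥ vecFun _ q.1 y =
      ∫ y in K.inner, vecFun _ g y ⬝ᵥ vecFun _ q.1 y := by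
    rw [integral_weakGrad_dot, Finset.sum_eq_zero, sub_zero]
    intro e he
    rw [facet_integral_congr (g := fun _ => 0) fun y hy => by rw [hq1 e he y hy, mul_zero]]
    simp
  have hcont : Continuous fun y => vecFun _ g y ⬝ᵥ vecFun _ q.1 y :=
    (continuous_vecFun _).dotProduct (continuous_vecFun _)
  set I := ∫ z in Metric.ball x (T.h / κ / 2), sqNorm g z with hI
  have hI0 : 0 ≤ I := integral_nonneg fun y => sqNorm_nonneg g y
  have e1 : c * T.h ^ 2 * I ≤ ∫ y in K.inner, vecFun _ g y ⬝ᵥ vecFun _ q.1 y := by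
    rw [hI, ← integral_const_mul]
    refine (setIntegral_mono_on ((integrableOn_ball (continuous_sqNorm g) _ _).const_mul _)
      (integrableOn_ball hcont _ _) measurableSet_ball fun y hy => ?_).trans
      (setIntegral_mono_set (K.integrableOn hcont) ?_ hb.eventuallyLE)
    · refine le_trans (le_of_eq ?_) (hq4 y fun z hz => hx1 ?_)
      · rw [hc]; field_simp
      · rw [Metric.mem_closedBall] at hz ⊢
        rw [Metric.mem_ball] at hy
        linarith [dist_triangle z y x]
    · exact (ae_restrict_iff' K.isOpen_inner.measurableSet).2
        (Filter.Eventually.of_forall fun y hy => hq3 y (interior_subset hy))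
  have e2 : brokenEnergy K v ≤ C₂ * C₁ * I := by
    have := h₂ hT K (f := sqNorm g) (M := C₁ * ((T.h ^ (m + 1))⁻¹ * I)) (continuous_sqNorm g)
      (by positivity) fun y hy => h₁ K x hx2 g (fun i => pderiv_mem_Poly (v.2.1 K) i) y hy
    refine this.trans (le_of_eq ?_)
    field_simp
  have e3 : ∫ y in K.inner, sqNorm q.1 y ≤ (2 * κ * T.h) ^ 4 * brokenEnergy K v := by
    rw [brokenEnergy, ← integral_const_mul]
    exact setIntegral_mono_on (integrable_sqNorm K _) ((integrable_sqNorm K _).const_mul _)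
      K.isOpen_inner.measurableSet fun y hy => hq2 y (interior_subset hy)
  have hD : 0 ≤ brokenEnergy K v := integral_sqNorm_nonneg K g
  -- With this weight the term in ∫|q|² is at most c h² I, half of the left side 2c h² I.
  set s : ℝ := (2 * κ) ^ 4 * T.h ^ 2 * (C₂ * C₁ / c) with hs
  have hs0 : 0 < s := by positivity
  have e4 := two_integral_dot_le K (weakGrad K v).1 q.1 hs0
  rw [hdot] at e4
  have e5 : s⁻¹ * ∫ y in K.inner, sqNorm q.1 y ≤ T.h ^ 2 * (c / (C₂ * C₁)) * brokenEnergy K v := by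
    refine (mul_le_mul_of_nonneg_left e3 (by positivity)).trans (le_of_eq ?_)
    rw [hs]; field_simp
  have e6 : T.h ^ 2 * (c / (C₂ * C₁)) * brokenEnergy K v ≤ c * T.h ^ 2 * I := by
    calc _ ≤ T.h ^ 2 * (c / (C₂ * C₁)) * (C₂ * C₁ * I) := by gcongr
      _ = _ := by field_simp
  have e7 : T.h ^ 2 * (c / (C₂ * C₁)) * brokenEnergy K v ≤ s * weakEnergy K v := by
    rw [weakEnergy]; linarith
  calc brokenEnergy K v = (T.h ^ 2 * (c / (C₂ * C₁)))⁻¹ *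
        (T.h ^ 2 * (c / (C₂ * C₁)) * brokenEnergy K v) := by field_simp
    _ ≤ (T.h ^ 2 * (c / (C₂ * C₁)))⁻¹ * (s * weakEnergy K v) := by gcongr
    _ = _ := by rw [hs]; field_simp

theorem faceDegree_ge (P : Pair) (j : ℕ) : j ≤ P.faceDegree j := by
  cases P <;> simp [Pair.faceDegree]

theorem exists_facet_poly (v : T.weakSpace P j) (K : T.Cell) (e : T.Facet) :
    ∃ p ∈ Poly (m + 1) (P.faceDegree j), ∀ x ∈ e.body,
      polyFun _ p x = cellVal K v x - facetVal e v x := by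
  obtain ⟨p, hp, hpe⟩ := v.2.2.1 e
  refine ⟨v.1.1 K - p, sub_mem (Poly_mono (faceDegree_ge P j) (v.2.1 K)) hp, fun x hx => ?_⟩
  have : facetVal e v x = polyFun _ p x := by
    change v.1.2 e x = _
    rw [← hpe]
    simp [restrictTo, hx]
  rw [this, map_sub, Pi.sub_apply]
  rfl

/-- The test field lifts v₀ - v_b from e alone. The boundary term becomes the squared jump J, while
∫|q|² ≤ C h J, so Young's inequality absorbs q. -/
theorem exists_jump_le (m : ℕ) (P : Pair) (j : ℕ) {κ : ℝ} (hκ : 1 ≤ κ) : ∃ C > 0,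
    ∀ {Ω : Domain (m + 1)} {T : SimplicialMesh Ω}, T.Regular κ → ∀ (K : T.Cell)
    (v : T.weakSpace P j), ∀ e ∈ K.facets,
      ∫ x, (cellVal K v x - facetVal e v x) ^ 2 ∂e.surface ≤
        C * T.h * (weakEnergy K v + brokenEnergy K v) := by
  obtain ⟨C₁, hC₁, h₁⟩ := exists_lift m P j hκ
  obtain ⟨C₂, hC₂, h₂⟩ := exists_cell_integral_le m hκ
  refine ⟨2 * (C₂ * C₁), by positivity, fun {Ω T} hT K v e he => ?_⟩
  have hh := T.h_pos
  obtain ⟨p, hp, hpe⟩ := exists_facet_poly v K e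
  obtain ⟨q, hq1, hq2, hq3⟩ := h₁ hT K e he p hp
  set J := ∫ x, (cellVal K v x - facetVal e v x) ^ 2 ∂e.surface with hJ
  have hJ0 : 0 ≤ J := jump_nonneg K e v
  have hpJ : ∫ x, polyFun _ p x ^ 2 ∂e.surface = J :=
    facet_integral_congr fun x hx => by rw [hpe x hx]
  rw [hpJ] at hq3
  have e1 : ∫ x in K.inner, sqNorm q.1 x ≤ C₂ * C₁ * T.h * J := by
    refine (h₂ hT K (continuous_sqNorm q.1) (by positivity) hq3).trans (le_of_eq ?_)
    field_simp
    ring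
  have e2 : ∑ e' ∈ K.facets, ∫ x, (cellVal K v x - facetVal e' v x) *
      fluxFun (K.normal e') q.1 x ∂e'.surface = J := by
    rw [Finset.sum_eq_single_of_mem e he]
    · refine facet_integral_congr fun x hx => ?_
      rw [hq1 x hx, hpe x hx, sq]
    · intro e' he' hne
      rw [facet_integral_congr (g := fun _ => 0) fun x hx => by rw [hq2 e' he' hne x hx, mul_zero]]
      simp
  have e3 := integral_weakGrad_dot K v q
  rw [e2] at e3
  have hs : 0 < 2 * (C₂ * C₁ * T.h) := by positivity
  have e4 := two_integral_dot_le K (gradient _ (v.1.1 K)) q.1 hs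
  have e5 := two_integral_dot_le K (-(weakGrad K v).1) q.1 hs
  have e6 : ∫ x in K.inner, vecFun _ (-(weakGrad K v).1) x ⬝ᵥ vecFun _ q.1 x =
      -∫ x in K.inner, vecFun _ (weakGrad K v).1 x ⬝ᵥ vecFun _ q.1 x := by
    rw [← integral_neg]
    simp
  have e7 : ∫ x in K.inner, sqNorm (-(weakGrad K v).1) x = weakEnergy K v := by
    simp [sqNorm, weakEnergy]
  rw [e6, e7] at e5
  have e8 : (2 * (C₂ * C₁ * T.h))⁻¹ * ∫ x in K.inner, sqNorm q.1 x ≤ J / 2 := by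
    refine (mul_le_mul_of_nonneg_left e1 (by positivity)).trans (le_of_eq ?_)
    field_simp
  change _ ≤ _ * brokenEnergy K v + _ at e4
  nlinarith

theorem exists_card_facets_le (m : ℕ) : ∃ N : ℕ, 0 < N ∧ ∀ {Ω : Domain (m + 1)}
    {T : SimplicialMesh Ω} (K : T.Cell), K.facets.card ≤ N := by
  classical
  refine ⟨(m + 2).choose (m + 1), Nat.choose_pos (by omega), fun {Ω T} K => ?_⟩
  have h := Finset.card_powersetCard (m + 1) K.verts
  rw [K.card_eq] at h
  rw [← h]
  refine Finset.card_le_card_of_injOn (fun e => e.verts) (fun e he => ?_)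
    fun e _ e' _ h => Facet.ext' h
  exact Finset.mem_powersetCard.2 ⟨Cell.mem_facets.1 he, e.card_eq⟩

/-- The broken energy and the scaled jumps are controlled by the weak gradient. -/
theorem exists_energy_le (m : ℕ) (P : Pair) (j : ℕ) {κ : ℝ} (hκ : 1 ≤ κ) : ∃ C > 0,
    ∀ {Ω : Domain (m + 1)} {T : SimplicialMesh Ω}, T.Regular κ → ∀ (K : T.Cell)
    (v : T.weakSpace P j),
      brokenEnergy K v + T.h⁻¹ * jumpEnergy K v ≤ C * weakEnergy K v := by
  obtain ⟨C₁, hC₁, h₁⟩ := exists_brokenEnergy_le m P j hκ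
  obtain ⟨C₂, hC₂, h₂⟩ := exists_jump_le m P j hκ
  obtain ⟨N, hN, h₃⟩ := exists_card_facets_le m
  refine ⟨C₁ + N * (C₂ * (1 + C₁)), by positivity, fun {Ω T} hT K v => ?_⟩
  have hh := T.h_pos
  have e1 := h₁ hT K v
  have hG : 0 ≤ weakEnergy K v := integral_sqNorm_nonneg K _
  have e2 : jumpEnergy K v ≤ N * (C₂ * T.h * ((1 + C₁) * weakEnergy K v)) := by
    refine (Finset.sum_le_card_nsmul _ _ (C₂ * T.h * ((1 + C₁) * weakEnergy K v))
      fun e he => (h₂ hT K v e he).trans ?_).trans ?_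
    · gcongr; linarith
    · rw [nsmul_eq_mul]
      gcongr
      exact_mod_cast h₃ K
  have e3 : T.h⁻¹ * jumpEnergy K v ≤ N * (C₂ * (1 + C₁)) * weakEnergy K v := by
    refine (mul_le_mul_of_nonneg_left e2 (by positivity)).trans (le_of_eq ?_)
    field_simp
  linarith

theorem fluxFun_sq_le {d : ℕ} {n : Pt d} (hn : ‖n‖ = 1) (q : Fin d → MvPolynomial (Fin d) ℝ)
    (x : Pt d) : fluxFun n q x ^ 2 ≤ sqNorm q x := by
  have h := dot_sq_le (vecFun d q x) n.ofLp
  rwa [dot_self_eq n, hn, one_pow, mul_one] at h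

theorem norm_normal {K : T.Cell} {e : T.Facet} (he : e ∈ K.facets) : ‖K.normal e‖ = 1 := by
  classical
  obtain ⟨c, hc, hec⟩ := Cell.exists_opp he
  exact (normal_spec K (Nat.succ_pos m) hc hec).1

/-- The weak gradient is controlled by the broken energy and the scaled jumps. -/
theorem exists_weakEnergy_le (m : ℕ) (P : Pair) (j : ℕ) {κ : ℝ} (hκ : 1 ≤ κ) : ∃ C > 0,
    ∀ {Ω : Domain (m + 1)} {T : SimplicialMesh Ω}, T.Regular κ → ∀ (K : T.Cell)
    (v : T.weakSpace P j),
      weakEnergy K v ≤ 2 * brokenEnergy K v + C * T.h⁻¹ * jumpEnergy K v := by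
  obtain ⟨C₁, hC₁, h₁⟩ := exists_cell_sqNorm_le m (j + 1) hκ
  obtain ⟨C₂, hC₂, h₂⟩ := exists_facet_integral_le m hκ
  obtain ⟨N, hN, h₃⟩ := exists_card_facets_le m
  refine ⟨2 * (N * (C₁ * C₂)), by positivity, fun {Ω T} hT K v => ?_⟩
  have hh := T.h_pos
  obtain ⟨x, hx1, hx2⟩ := hT K
  set q := weakGrad K v with hq
  have hqk : ∀ i, q.1 i ∈ Poly (m + 1) (j + 1) :=
    mem_gradSpace_BDM.1 (gradSpace_le_BDM P j q.2)
  have hG : 0 ≤ weakEnergy K v := integral_sqNorm_nonneg K _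
  have hκ0 : 0 < κ := by linarith
  have e1 : ∀ y ∈ K.body, sqNorm q.1 y ≤ C₁ * ((T.h ^ (m + 1))⁻¹ * weakEnergy K v) := by
    intro y hy
    refine (h₁ K x hx2 q.1 hqk y hy).trans ?_
    have := Cell.setIntegral_ball_le ((Metric.ball_subset_ball (half_le_self (by positivity))).trans
      (Regular.ball_subset_inner hx1)) (continuous_sqNorm q.1) (fun y => sqNorm_nonneg q.1 y)
    gcongr
    exact this
  have e2 : ∀ e ∈ K.facets, ∫ y, sqNorm q.1 y ∂e.surface ≤ C₁ * C₂ * T.h⁻¹ * weakEnergy K v := by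
    intro e he
    refine (h₂ hT K e he (continuous_sqNorm q.1).continuousOn (by positivity) fun y hy =>
      e1 y (Cell.facet_subset he hy)).trans (le_of_eq ?_)
    field_simp
    ring
  -- Summed over at most N facets, the flux terms then cost at most half of the weak energy.
  set s : ℝ := 2 * (N * (C₁ * C₂)) * T.h⁻¹ with hs
  have hs0 : 0 < s := by positivity
  have e3 : ∀ e ∈ K.facets, -(2 * ∫ y, (cellVal K v y - facetVal e v y) *
      fluxFun (K.normal e) q.1 y ∂e.surface) ≤
      s * (∫ y, (cellVal K v y - facetVal e v y) ^ 2 ∂e.surface) +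
        s⁻¹ * (C₁ * C₂ * T.h⁻¹ * weakEnergy K v) := by
    intro e he
    have hc1 : ContinuousOn (fun y => cellVal K v y - facetVal e v y) e.body :=
      (continuous_cellVal K v).continuousOn.sub (continuousOn_facetVal e v)
    have hc2 := (continuous_fluxFun (K.normal e) q.1).continuousOn (s := e.body)
    have hc3 := (continuous_sqNorm q.1).continuousOn (s := e.body)
    have : -(2 * ∫ y, (cellVal K v y - facetVal e v y) * fluxFun (K.normal e) q.1 y ∂e.surface) ≤
        s * (∫ y, (cellVal K v y - facetVal e v y) ^ 2 ∂e.surface) +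
        s⁻¹ * ∫ y, sqNorm q.1 y ∂e.surface := by
      have hi1 : Integrable (fun y => s * (cellVal K v y - facetVal e v y) ^ 2) e.surface :=
        e.integrable (continuousOn_const.mul (hc1.pow 2))
      have hi2 : Integrable (fun y => s⁻¹ * sqNorm q.1 y) e.surface :=
        e.integrable (continuousOn_const.mul hc3)
      rw [← integral_const_mul, ← integral_neg, ← integral_const_mul, ← integral_const_mul,
        ← integral_add hi1 hi2]
      refine facet_integral_mono (continuousOn_const.mul (hc1.mul hc2)).neg
        ((continuousOn_const.mul (hc1.pow 2)).add (continuousOn_const.mul hc3)) fun y _ => ?_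
      have h1 := fluxFun_sq_le (norm_normal he) q.1 y
      set u := cellVal K v y - facetVal e v y
      set w := fluxFun (K.normal e) q.1 y
      have h2 : s * u ^ 2 + s⁻¹ * w ^ 2 + 2 * (u * w) = s⁻¹ * (s * u + w) ^ 2 := by
        field_simp
        ring
      have h3 : s⁻¹ * w ^ 2 ≤ s⁻¹ * sqNorm q.1 y := by gcongr
      have h4 : 0 ≤ s⁻¹ * (s * u + w) ^ 2 := by positivity
      change -(2 * (u * w)) ≤ s * u ^ 2 + s⁻¹ * sqNorm q.1 y
      linarith
    refine this.trans ?_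
    gcongr
    exact e2 e he
  have e4 := Finset.sum_le_sum e3
  rw [Finset.sum_neg_distrib, ← Finset.mul_sum, Finset.sum_add_distrib, ← Finset.mul_sum,
    Finset.sum_const, nsmul_eq_mul] at e4
  have e5 := integral_weakGrad_dot K v q
  have e6 := two_integral_dot_le K (gradient _ (v.1.1 K)) q.1 (s := 2) two_pos
  change _ ≤ _ * brokenEnergy K v + _ * weakEnergy K v at e6
  change weakEnergy K v = _ at e5
  change _ ≤ s * jumpEnergy K v + _ at e4
  have e7 : (K.facets.card : ℝ) * (s⁻¹ * (C₁ * C₂ * T.h⁻¹ * weakEnergy K v)) ≤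
      weakEnergy K v / 2 := by
    calc _ ≤ (N : ℝ) * (s⁻¹ * (C₁ * C₂ * T.h⁻¹ * weakEnergy K v)) := by
          gcongr
          exact_mod_cast h₃ K
      _ = _ := by rw [hs]; field_simp
  linarith

theorem exists_brokenEnergy_le_mass (m j : ℕ) (P : Pair) {κ : ℝ} (hκ : 1 ≤ κ) : ∃ C > 0,
    ∀ {Ω : Domain (m + 1)} {T : SimplicialMesh Ω}, T.Regular κ → ∀ (K : T.Cell)
    (v : T.weakSpace P j), brokenEnergy K v ≤ C * (T.h ^ 2)⁻¹ * massEnergy K v := by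
  obtain ⟨C₁, hC₁, h₁⟩ := exists_cell_gradient_le m j hκ
  obtain ⟨C₂, hC₂, h₂⟩ := exists_cell_integral_le m hκ
  refine ⟨C₂ * C₁, by positivity, fun {Ω T} hT K v => ?_⟩
  have hh := T.h_pos
  have := massEnergy_nonneg K v
  have e1 : ∀ y ∈ K.body, sqNorm (gradient _ (v.1.1 K)) y ≤
      (T.h ^ 2)⁻¹ * (C₁ * ((T.h ^ (m + 1))⁻¹ * massEnergy K v)) := fun y hy => by
    rw [le_inv_mul_iff₀ (by positivity)]
    exact h₁ hT K _ (v.2.1 K) y hy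
  refine (h₂ hT K (continuous_sqNorm _) (by positivity) e1).trans (le_of_eq ?_)
  field_simp

end EnergyEquivalence

end SimplicialMesh


/-! ### Divergences and normal traces of G_j -/

section GradSpaceTraces

variable {d : ℕ} {P : Pair} {j : ℕ}

theorem mem_gradSpace_RT {q : Fin d → MvPolynomial (Fin d) ℝ} (h : q ∈ gradSpace d Pair.RT j) :
    ∃ (r : Fin d → MvPolynomial (Fin d) ℝ) (p : MvPolynomial (Fin d) ℝ),
      (∀ i, r i ∈ Poly d j) ∧ p.IsHomogeneous j ∧ ∀ i, q i = r i + MvPolynomial.X i * p := by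
  obtain ⟨r, hr, s, hs, rfl⟩ := Submodule.mem_sup.1 h
  obtain ⟨p, hp, rfl⟩ := hs
  exact ⟨r, p, fun i => hr i trivial, (MvPolynomial.mem_homogeneousSubmodule j p).1 hp,
    fun i => rfl⟩

/-- This degree count lets the projection Q₀ drop out of the definition of ∇_w Πw; the normal traces
do the same for Q_b. -/
theorem divergence_mem_Poly {q : Fin d → MvPolynomial (Fin d) ℝ} (h : q ∈ gradSpace d P j) :
    divergence d q ∈ Poly d j := by
  have hdiv : divergence d q = ∑ i, MvPolynomial.pderiv i (q i) := by
    simp [divergence, LinearMap.sum_apply]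
  rw [hdiv]
  refine sum_mem fun i _ => ?_
  cases P with
  | BDM => exact pderiv_mem_Poly (mem_gradSpace_BDM.1 h i) i
  | RT =>
    obtain ⟨r, p, hr, hp, hq⟩ := mem_gradSpace_RT h
    have hpj : p ∈ Poly d j := mem_Poly.2 hp.totalDegree_le
    rw [hq, map_add, Derivation.leibniz, MvPolynomial.pderiv_X_self, smul_eq_mul, smul_eq_mul, mul_one]
    refine add_mem (Poly_mono (by omega) (pderiv_mem_Poly (hr i) i)) (add_mem ?_ hpj)
    rcases Nat.eq_zero_or_pos j with rfl | hj
    · have : p = MvPolynomial.C (MvPolynomial.coeff 0 p) :=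
        MvPolynomial.totalDegree_eq_zero_iff_eq_C.1 (Nat.le_zero.1 (mem_Poly.1 hpj))
      rw [this, MvPolynomial.pderiv_C, mul_zero]
      exact zero_mem _
    · exact Poly_mono (by omega) (mul_mem_Poly (X_mem_Poly i) (pderiv_mem_Poly hpj i))

/-- The normal trace of `G_j` on a set of a hyperplane orthogonal to `n` has degree at most `l`. -/
theorem flux_mem_polyOn {q : Fin d → MvPolynomial (Fin d) ℝ} (h : q ∈ gradSpace d P j)
    {S : Set (Pt d)} {n : Pt d} {c : ℝ} (hS : ∀ x ∈ S, inner ℝ x n = c) :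
    restrictTo S (fluxFun n q) ∈ polyOn S (P.faceDegree j) := by
  have key : ∃ p ∈ Poly d (P.faceDegree j), ∀ x ∈ S, polyFun d p x = fluxFun n q x := by
    cases P with
    | BDM =>
      refine ⟨∑ i, MvPolynomial.C (n i) * q i, sum_mem fun i _ => ?_, fun x _ => ?_⟩
      · exact Poly_mono (by simp [Pair.faceDegree]) (mul_mem_Poly (C_mem_Poly 0 _) (mem_gradSpace_BDM.1 h i))
      · rw [SimplicialMesh.fluxFun_apply, polyFun_sum]
        exact Finset.sum_congr rfl fun i _ => by rw [polyFun_mul, polyFun_C, mul_comm]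
    | RT =>
      obtain ⟨r, p, hr, hp, hq⟩ := mem_gradSpace_RT h
      -- On the hyperplane x·n = c the summand x p has normal component c p, of degree j instead of
      -- j + 1.
      refine ⟨∑ i, MvPolynomial.C (n i) * r i + MvPolynomial.C c * p,
        add_mem (sum_mem fun i _ => ?_) ?_, fun x hx => ?_⟩
      · exact Poly_mono (by simp [Pair.faceDegree]) (mul_mem_Poly (C_mem_Poly 0 _) (hr i))
      · exact Poly_mono (by simp [Pair.faceDegree])
          (mul_mem_Poly (C_mem_Poly 0 _) (mem_Poly.2 hp.totalDegree_le))
      · have h1 : ∑ i, x i * n i = c := by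
          rw [← hS x hx, PiLp.inner_apply]
          simp [mul_comm]
        rw [SimplicialMesh.fluxFun_apply, map_add, Pi.add_apply, polyFun_sum, polyFun_mul, polyFun_C, ← h1,
          Finset.sum_mul, ← Finset.sum_add_distrib]
        refine Finset.sum_congr rfl fun i _ => ?_
        rw [hq, map_add, Pi.add_apply, polyFun_mul, polyFun_mul, polyFun_C, polyFun_X]
        ring
  obtain ⟨p, hp, hpx⟩ := key
  exact ⟨p, hp, Set.indicator_congr fun x hx => hpx x hx⟩

end GradSpaceTraces

/-! ### Bilinear forms, the inverse inequality and stability of the prolongation -/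

namespace SimplicialMesh

section Forms

variable {m : ℕ} {Ω : Domain (m + 1)} {T : SimplicialMesh Ω} {P : Pair} {j : ℕ} {α β : ℝ}

theorem isInner_weakInner : IsInner (weakInner (T := T) (P := P) (j := j)) where
  symm u v := by simp only [weakInner_apply, mul_comm]
  pos v hv := by
    refine lt_of_le_of_ne ?_ fun h => hv (weakInner_definite v h.symm)
    rw [weakInner_self]
    exact Finset.sum_nonneg fun K _ => add_nonneg (massEnergy_nonneg K v)
      (mul_nonneg T.h_pos.le (jumpEnergy_nonneg K v))

theorem isInner_p1Inner : IsInner (p1Inner (T := T)) where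
  symm u v := by simp only [p1Inner_apply, mul_comm]
  pos w hw := by
    have h0 : 0 ≤ p1Inner w w := integral_nonneg fun x => mul_self_nonneg _
    refine lt_of_le_of_ne h0 fun h => hw ?_
    have h1 := eqOn_zero_of_integral_sq Ω.isOpen w.2.1.continuousOn
      (((w.2.1.mul w.2.1).continuousOn.integrableOn_compact
        Ω.isBounded.isCompact_closure).mono_set subset_closure) h.symm
    refine Subtype.ext (funext fun x => ?_)
    by_cases hx : x ∈ Ω.carrier
    · exact h1 x hx
    · exact w.2.2.1 x hx

theorem diffusion_le (𝔸 : DiffusionMatrix Ω α β) : α ≤ β := by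
  obtain ⟨x, hx⟩ := Ω.isConnected.nonempty
  have h1 := 𝔸.lower x hx (Pi.single 0 1)
  have h2 := 𝔸.upper x hx (Pi.single 0 1)
  simp at h1 h2
  linarith

theorem diffusion_symm (𝔸 : DiffusionMatrix Ω α β) (K : T.Cell) (f g : Pt (m + 1) → Fin (m + 1) → ℝ) :
    ∫ x in K.inner, (𝔸.coeff x).mulVec (f x) ⬝ᵥ g x =
      ∫ x in K.inner, (𝔸.coeff x).mulVec (g x) ⬝ᵥ f x := by
  refine setIntegral_congr_fun K.isOpen_inner.measurableSet fun x hx => ?_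
  have h := 𝔸.symm x (K.inner_subset hx)
  change _ ⬝ᵥ _ = _ ⬝ᵥ _
  rw [dotProduct_comm, Matrix.dotProduct_mulVec, ← Matrix.mulVec_transpose, h.eq]

theorem diffusion_bounds (𝔸 : DiffusionMatrix Ω α β) (K : T.Cell)
    (q : Fin (m + 1) → MvPolynomial (Fin (m + 1)) ℝ) :
    α * (∫ x in K.inner, sqNorm q x) ≤
      (∫ x in K.inner, (𝔸.coeff x).mulVec (vecFun _ q x) ⬝ᵥ vecFun _ q x) ∧
    (∫ x in K.inner, (𝔸.coeff x).mulVec (vecFun _ q x) ⬝ᵥ vecFun _ q x) ≤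
      β * ∫ x in K.inner, sqNorm q x := by
  have hi := 𝔸.integrable K (continuous_vecFun q) (continuous_vecFun q)
  rw [← integral_const_mul, ← integral_const_mul]
  constructor
  · refine setIntegral_mono_on ((integrable_sqNorm K q).const_mul _) hi
      K.isOpen_inner.measurableSet fun x hx => ?_
    rw [dotProduct_comm]
    exact 𝔸.lower x (K.inner_subset hx) _
  · refine setIntegral_mono_on hi ((integrable_sqNorm K q).const_mul _)
      K.isOpen_inner.measurableSet fun x hx => ?_
    rw [dotProduct_comm]
    exact 𝔸.upper x (K.inner_subset hx) _

theorem weakForm_symm (𝔸 : DiffusionMatrix Ω α β) (u v : T.weakSpace P j) :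
    weakForm P j 𝔸 u v = weakForm P j 𝔸 v u := by
  simp only [weakForm_apply]
  exact Finset.sum_congr rfl fun K _ => diffusion_symm 𝔸 K _ _

theorem p1Form_symm (𝔸 : DiffusionMatrix Ω α β) (u v : T.p1Space) :
    p1Form 𝔸 u v = p1Form 𝔸 v u := by
  simp only [p1Form_apply]
  exact Finset.sum_congr rfl fun K _ => diffusion_symm 𝔸 K _ _

theorem weakForm_bounds (𝔸 : DiffusionMatrix Ω α β) (v : T.weakSpace P j) :
    α * ∑ K, weakEnergy K v ≤ weakForm P j 𝔸 v v ∧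
      weakForm P j 𝔸 v v ≤ β * ∑ K, weakEnergy K v := by
  rw [weakForm_apply, Finset.mul_sum, Finset.mul_sum]
  exact ⟨Finset.sum_le_sum fun K _ => (diffusion_bounds 𝔸 K _).1,
    Finset.sum_le_sum fun K _ => (diffusion_bounds 𝔸 K _).2⟩

/-- `∫_K |∇w|²`. -/
def p1Energy (K : T.Cell) (w : T.p1Space) : ℝ :=
  ∫ x in K.inner, sqNorm (gradient (m + 1) (cellPoly K w)) x

theorem p1Form_bounds (𝔸 : DiffusionMatrix Ω α β) (w : T.p1Space) :
    α * ∑ K, p1Energy K w ≤ p1Form 𝔸 w w ∧ p1Form 𝔸 w w ≤ β * ∑ K, p1Energy K w := by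
  rw [p1Form_apply, Finset.mul_sum, Finset.mul_sum]
  exact ⟨Finset.sum_le_sum fun K _ => (diffusion_bounds 𝔸 K _).1,
    Finset.sum_le_sum fun K _ => (diffusion_bounds 𝔸 K _).2⟩

/-- The inverse inequality for the weak form. -/
theorem exists_weakForm_le (m : ℕ) (P : Pair) (j : ℕ) (β : ℝ) {κ : ℝ} (hκ : 1 ≤ κ) : ∃ C > 0,
    ∀ {α : ℝ} {Ω : Domain (m + 1)} (𝔸 : DiffusionMatrix Ω α β) {T : SimplicialMesh Ω}, 0 < α →
    T.Regular κ → ∀ v : T.weakSpace P j,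
      weakForm P j 𝔸 v v ≤ C * (T.h ^ 2)⁻¹ * weakInner v v := by
  obtain ⟨C₁, hC₁, h₁⟩ := exists_weakEnergy_le m P j hκ
  obtain ⟨C₂, hC₂, h₂⟩ := exists_brokenEnergy_le_mass m j P hκ
  -- The constant is fixed before any diffusion matrix is given, and only the existence of one
  -- forces β > 0; hence |β| and the added 1.
  refine ⟨|β| * (2 * C₂ + C₁) + 1, by positivity, fun {α Ω} 𝔸 {T} hα hT v => ?_⟩
  have hβ : 0 < β := hα.trans_le (diffusion_le 𝔸)
  have hh := T.h_pos
  rw [abs_of_pos hβ]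
  refine (weakForm_bounds 𝔸 v).2.trans ?_
  have hI : 0 ≤ weakInner v v := isInner_weakInner.nonneg v
  have e1 : ∑ K, weakEnergy K v ≤ (2 * C₂ + C₁) * (T.h ^ 2)⁻¹ * weakInner v v := by
    rw [weakInner_self, Finset.mul_sum]
    refine Finset.sum_le_sum fun K _ => (h₁ hT K v).trans ?_
    have e2 := h₂ hT K v
    have hM := massEnergy_nonneg K v
    have hJ := jumpEnergy_nonneg K v
    have e3 : C₁ * T.h⁻¹ * jumpEnergy K v = C₁ * (T.h ^ 2)⁻¹ * (T.h * jumpEnergy K v) := by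
      field_simp
    have e4 : 0 ≤ C₁ * (T.h ^ 2)⁻¹ * massEnergy K v := by positivity
    have e5 : 0 ≤ 2 * C₂ * (T.h ^ 2)⁻¹ * (T.h * jumpEnergy K v) := by positivity
    rw [e3]
    linarith
  have e6 : 0 ≤ (T.h ^ 2)⁻¹ * weakInner v v := by positivity
  calc β * ∑ K, weakEnergy K v ≤ β * ((2 * C₂ + C₁) * (T.h ^ 2)⁻¹ * weakInner v v) := by gcongr
    _ ≤ _ := by linarith

theorem inner_normal_eq {K : T.Cell} {e : T.Facet} (he : e ∈ K.facets) :
    ∃ c : ℝ, ∀ x ∈ e.body, inner ℝ x (K.normal e) = c := by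
  classical
  obtain ⟨a, ha, hea⟩ := Cell.exists_opp he
  obtain ⟨-, H, -, hn⟩ := normal_spec K (Nat.succ_pos m) ha hea
  refine ⟨H + inner ℝ a (K.normal e), fun x hx => ?_⟩
  have h := hn x
  rw [((K.mem_facet_body ha hea).1 hx).2, inner_sub_left] at h
  linarith

/-- Commutation: ∇_w Πw is the L² projection of ∇w onto G_j. Since ∇·G_j lies in P_j and G_j·n lies
in P_l, the projections Q₀ and Q_b can be removed, and what is left is integration by parts for w.
-/
theorem integral_weakGrad_prolong (K : T.Cell) (w : T.p1Space) (q : gradSpace (m + 1) P j) :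
    ∫ x in K.inner, vecFun _ (weakGrad K (prolong P j w)).1 x ⬝ᵥ vecFun _ q.1 x =
      ∫ x in K.inner, vecFun _ (gradient _ (cellPoly K w)) x ⬝ᵥ vecFun _ q.1 x := by
  rw [weakGrad_spec, integral_by_parts]
  congr 1
  · have h := projCell_spec K w ⟨divergence _ q.1, divergence_mem_Poly q.2⟩
    refine congrArg Neg.neg (Eq.trans h ?_)
    refine setIntegral_congr_fun K.isOpen_inner.measurableSet fun x hx => ?_
    rw [(cellPoly_spec K w).2 x (interior_subset hx)]
  · refine Finset.sum_congr rfl fun e he => ?_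
    obtain ⟨c, hc⟩ := inner_normal_eq he
    have h := projFacet_spec e w ⟨_, flux_mem_polyOn q.2 hc⟩
    refine (facet_integral_congr fun x hx => ?_).trans (h.trans (facet_integral_congr fun x hx => ?_))
    · simp [restrictTo, hx, fluxFun]
      exact Or.inl rfl
    · rw [(cellPoly_spec K w).2 x (Cell.facet_subset he hx)]
      simp [restrictTo, hx, fluxFun]

theorem weakEnergy_prolong_le (K : T.Cell) (w : T.p1Space) :
    weakEnergy K (prolong P j w) ≤ p1Energy K w := by
  have h1 := integral_weakGrad_prolong K w (weakGrad K (prolong P j w))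
  have h2 := two_integral_dot_le K (gradient _ (cellPoly K w)) (weakGrad K (prolong P j w)).1
    one_pos
  change weakEnergy K _ = _ at h1
  rw [← h1] at h2
  change _ ≤ 1 * p1Energy K w + _ * weakEnergy K _ at h2
  linarith

theorem weakForm_prolong_le (𝔸 : DiffusionMatrix Ω α β) (hα : 0 < α) (w : T.p1Space) :
    weakForm P j 𝔸 (prolong P j w) (prolong P j w) ≤ β / α * p1Form 𝔸 w w := by
  have hβ : 0 < β := hα.trans_le (diffusion_le 𝔸)
  have h1 : ∑ K, weakEnergy K (prolong P j w) ≤ ∑ K, p1Energy K w :=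
    Finset.sum_le_sum fun K _ => weakEnergy_prolong_le K w
  calc weakForm P j 𝔸 (prolong P j w) (prolong P j w)
      ≤ β * ∑ K, weakEnergy K (prolong P j w) := (weakForm_bounds 𝔸 _).2
    _ ≤ β * ∑ K, p1Energy K w := by gcongr
    _ = β / α * (α * ∑ K, p1Energy K w) := by field_simp
    _ ≤ _ := by gcongr; exact (p1Form_bounds 𝔸 w).1

end Forms

end SimplicialMesh


/-! ### How the elements fit together inside Ω -/

namespace SimplicialMesh

section Topology

variable {d : ℕ} {Ω : Domain d} {T : SimplicialMesh Ω}

/-- Conformity: the common point lies in the hull of the common vertices, where the coordinates of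
all other vertices of K vanish. -/
theorem Cell.mem_of_bary_pos {K : T.Cell} {t : Finset (Pt d)} (ht : t ∈ T.complex.faces) {x : Pt d}
    (hx : x ∈ K.body) (hxt : x ∈ convexHull ℝ (t : Set (Pt d))) {b : Pt d} (hb : b ∈ K.verts)
    (hpos : 0 < K.bary b x) : b ∈ t := by
  classical
  have h := T.complex.inter_subset_convexHull K.mem ht ⟨hx, hxt⟩
  rw [← Finset.coe_inter] at h
  by_contra hbt
  have h0 := ((K.mem_convexHull Finset.inter_subset_left).1 h).2 b hb
    fun h => hbt (Finset.mem_inter.1 h).2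
  linarith

theorem Cell.eq_of_mem_inner {K K' : T.Cell} {x : Pt d} (hx : x ∈ K.inner) (hx' : x ∈ K'.body) :
    K = K' :=
  Cell.ext' (Finset.eq_of_subset_of_card_le (fun _ hb => Cell.mem_of_bary_pos K'.mem
    (interior_subset hx) hx' hb (K.mem_inner.1 hx _ hb)) (by rw [K.card_eq, K'.card_eq]))

/-- Only common vertices carry weight at x, so the weights from K also represent x in K', and
barycentric weights are unique. -/
theorem Cell.bary_congr {K K' : T.Cell} {x : Pt d} (hx : x ∈ K.body) (hx' : x ∈ K'.body) {b : Pt d}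
    (hb : b ∈ K.verts) (hb' : b ∈ K'.verts) : K.bary b x = K'.bary b x := by
  classical
  have hz : ∀ c ∈ K.verts, c ∉ K'.verts → K.bary c x = 0 := fun c hc hc' => by
    by_contra hne
    exact hc' (Cell.mem_of_bary_pos K'.mem hx hx' hc
      (lt_of_le_of_ne (K.mem_body.1 hx c hc) (Ne.symm hne)))
  have key : ∀ {M : Type} [AddCommMonoid M] [Module ℝ M] (g : Pt d → M),
      ∑ c ∈ K'.verts, (if c ∈ K.verts then K.bary c x else 0) • g c =
        ∑ c ∈ K.verts, K.bary c x • g c := by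
    intro M _ _ g
    have h1 : ∑ c ∈ K.verts, K.bary c x • g c = ∑ c ∈ K'.verts ∩ K.verts, K.bary c x • g c := by
      refine (Finset.sum_subset Finset.inter_subset_right fun c hc hc' => ?_).symm
      rw [hz c hc fun h => hc' (Finset.mem_inter.2 ⟨h, hc⟩), zero_smul]
    rw [h1, ← Finset.filter_mem_eq_inter, Finset.sum_filter]
    exact Finset.sum_congr rfl fun c _ => by split_ifs <;> simp
  have h1 : ∑ c ∈ K'.verts, (if c ∈ K.verts then K.bary c x else 0) = 1 := by
    have := key (fun _ => (1 : ℝ))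
    simpa [K.sum_bary] using this
  have h2 := K'.bary_unique h1 hb'
  rw [key (fun c => c), K.sum_bary_smul] at h2
  rw [h2, if_pos hb]

theorem Cell.affine_eq (K : T.Cell) (f : Pt d →ᵃ[ℝ] ℝ) (x : Pt d) :
    f x = ∑ b ∈ K.verts, K.bary b x * f b := by
  have h := affineMap_sum f K.verts (K.sum_bary x) id
  simp only [id, K.sum_bary_smul, smul_eq_mul] at h
  exact h

theorem isClosed_body (K : T.Cell) : IsClosed K.body := K.isCompact_body.isClosed

/-- Near `x` there are only the elements that contain `x`. -/
theorem eventually_mem_body (x : Pt d) :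
    ∀ᶠ y in nhds x, ∀ K : T.Cell, y ∈ K.body → x ∈ K.body := by
  rw [Filter.eventually_all]
  intro K
  by_cases hx : x ∈ K.body
  · exact Filter.Eventually.of_forall fun _ _ => hx
  · filter_upwards [(isClosed_body K).isOpen_compl.mem_nhds hx] with y hy h
    exact absurd h hy

theorem Cell.bary_line (K : T.Cell) (b x y : Pt d) (s : ℝ) :
    K.bary b (x + s • (y - x)) = K.bary b x + s * (K.bary b y - K.bary b x) := by
  have := AffineMap.apply_lineMap (K.bary b) x y s
  rw [AffineMap.lineMap_apply, AffineMap.lineMap_apply] at this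
  simp only [vsub_eq_sub, vadd_eq_add, smul_eq_mul] at this
  rw [add_comm x, this]
  ring

/-- Two elements that share a facet cover a neighbourhood of its relative interior. -/
theorem union_mem_nhds {K₁ K₂ : T.Cell} (hne : K₁ ≠ K₂) {e : T.Facet} (h₁ : e ∈ K₁.facets)
    (h₂ : e ∈ K₂.facets) {x : Pt d} (hx : x ∈ e.body) (hpos : ∀ b ∈ e.verts, 0 < K₁.bary b x) :
    K₁.body ∪ K₂.body ∈ nhds x := by
  classical
  obtain ⟨a₁, ha₁, he₁⟩ := Cell.exists_opp h₁
  obtain ⟨a₂, ha₂, he₂⟩ := Cell.exists_opp h₂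
  have hsub₁ := Cell.mem_facets.1 h₁
  have hsub₂ := Cell.mem_facets.1 h₂
  have hx₁ := Cell.facet_subset h₁ hx
  have hx₂ := Cell.facet_subset h₂ hx
  have hxa : K₁.bary a₁ x = 0 := ((K₁.mem_facet_body ha₁ he₁).1 hx).2
  have he0 : ∀ b ∈ e.verts, K₁.bary a₁ b = 0 := fun b hb =>
    K₁.bary_ne ha₁ (hsub₁ hb) (by rintro rfl; rw [he₁] at hb; exact absurd rfl (Finset.ne_of_mem_erase hb))
  have ha₂e : a₂ ∉ e.verts := by rw [he₂]; exact Finset.notMem_erase _ _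
  set f := K₁.bary a₁ with hf
  have hprop : ∀ y, f y = K₂.bary a₂ y * f a₂ := fun y => by
    rw [K₂.affine_eq f y, ← Finset.add_sum_erase _ _ ha₂, ← he₂,
      Finset.sum_eq_zero fun b hb => by rw [he0 b hb, mul_zero], add_zero]
  -- The elements lie on opposite sides of e. If f were zero at a₂ it would vanish identically; if
  -- positive, points of K₂ just off x would be interior to K₁, and the elements would coincide.
  have hfa : f a₂ < 0 := by
    by_contra! hge
    have hp : 0 < f a₂ := by
      refine lt_of_le_of_ne hge fun h => ?_
      have := hprop a₁
      rw [← h, mul_zero, hf, K₁.bary_self ha₁] at this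
      exact one_ne_zero this
    have hcont : ∀ b, Continuous fun s : ℝ => K₁.bary b (x + s • (a₂ - x)) := fun b =>
      (K₁.continuous_bary b).comp (by fun_prop)
    have hev : ∀ᶠ s in nhdsWithin (0 : ℝ) (Set.Ioi 0), (∀ b ∈ e.verts,
        0 < K₁.bary b (x + s • (a₂ - x))) ∧ s < 1 ∧ 0 < s := by
      refine Filter.Eventually.and (Filter.Eventually.filter_mono nhdsWithin_le_nhds ?_)
        (Filter.Eventually.and (Filter.Eventually.filter_mono nhdsWithin_le_nhds
          (eventually_lt_nhds one_pos)) self_mem_nhdsWithin)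
      rw [Filter.eventually_all_finset]
      intro b hb
      exact (hcont b).continuousAt.eventually (lt_mem_nhds (by simpa using hpos b hb))
    obtain ⟨s, hs, hs1, hs0⟩ := hev.exists
    refine hne (Cell.eq_of_mem_inner (x := x + s • (a₂ - x)) (K₁.mem_inner.2 fun b hb => ?_) ?_)
    · by_cases hba : b = a₁
      · rw [hba, K₁.bary_line, ← hf, hxa]
        simpa using mul_pos hs0 hp
      · exact hs b (by rw [he₁]; exact Finset.mem_erase.2 ⟨hba, hb⟩)
    · exact (convex_convexHull ℝ _).add_smul_sub_mem hx₂ (subset_convexHull ℝ _ ha₂) ⟨hs0.le, hs1.le⟩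
  have hev : ∀ᶠ y in nhds x, ∀ b ∈ e.verts, 0 < K₁.bary b y ∧ 0 < K₂.bary b y := by
    rw [Filter.eventually_all_finset]
    intro b hb
    have hb2 : 0 < K₂.bary b x := by
      rw [← Cell.bary_congr hx₁ hx₂ (hsub₁ hb) (hsub₂ hb)]
      exact hpos b hb
    exact ((K₁.continuous_bary b).continuousAt.eventually (lt_mem_nhds (hpos b hb))).and
      ((K₂.continuous_bary b).continuousAt.eventually (lt_mem_nhds hb2))
  filter_upwards [hev] with y hy
  -- Near x the coordinates of the vertices of e stay positive, so the sign of f alone decides in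
  -- which element y lies.
  by_cases hfy : 0 ≤ f y
  · refine Or.inl (K₁.mem_body.2 fun b hb => ?_)
    by_cases hba : b = a₁
    · rw [hba]; exact hfy
    · exact (hy b (by rw [he₁]; exact Finset.mem_erase.2 ⟨hba, hb⟩)).1.le
  · refine Or.inr (K₂.mem_body.2 fun b hb => ?_)
    by_cases hba : b = a₂
    · rw [hba]
      have := hprop y
      nlinarith
    · exact (hy b (by rw [he₂]; exact Finset.mem_erase.2 ⟨hba, hb⟩)).2.le

/-- A facet of only one element lies in the boundary. -/
theorem Facet.body_subset_frontier {K : T.Cell} {e : T.Facet} (he : e ∈ K.facets)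
    (huniq : ∀ K' : T.Cell, e ∈ K'.facets → K' = K) : e.body ⊆ frontier Ω.carrier := by
  classical
  obtain ⟨a, ha, hea⟩ := Cell.exists_opp he
  have hsub := Cell.mem_facets.1 he
  -- For x in the relative interior of e and in Ω, step slightly away from a, out of K. The new
  -- point lies in an element that contains x, hence all vertices of e, hence is K itself; but its
  -- coordinate at a is negative.
  have key : ∀ x ∈ e.body, (∀ b ∈ e.verts, 0 < K.bary b x) → x ∉ Ω.carrier := by
    intro x hx hpos hxΩ
    have hxK := Cell.facet_subset he hx
    have hc : Filter.Tendsto (fun s : ℝ => x + s • (a - x)) (nhds 0) (nhds x) := by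
      have : Continuous fun s : ℝ => x + s • (a - x) := by fun_prop
      simpa using this.tendsto 0
    have hev : ∀ᶠ s in nhdsWithin (0 : ℝ) (Set.Iio 0), s < 0 ∧ x + s • (a - x) ∈ Ω.carrier ∧
        ∀ K' : T.Cell, x + s • (a - x) ∈ K'.body → x ∈ K'.body :=
      Filter.Eventually.and self_mem_nhdsWithin (Filter.Eventually.filter_mono nhdsWithin_le_nhds
        ((hc.eventually (Ω.isOpen.mem_nhds hxΩ)).and (hc.eventually (eventually_mem_body x))))
    obtain ⟨s, hs, hs1, hs2⟩ := hev.exists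
    obtain ⟨K', hK'⟩ := T.exists_cell_of_mem (subset_closure hs1)
    have hK : K' = K := huniq K' (Cell.mem_facets.2 fun b hb =>
      Cell.mem_of_bary_pos K'.mem hxK (hs2 K' hK') (hsub hb) (hpos b hb))
    rw [hK] at hK'
    have h := K.mem_body.1 hK' a ha
    rw [K.bary_line, K.bary_self ha, ((K.mem_facet_body ha hea).1 hx).2] at h
    linarith
  intro x hx
  rw [Ω.isOpen.frontier_eq]
  refine ⟨K.body_subset_closure (Cell.facet_subset he hx), fun hxΩ => ?_⟩
  -- Any point of e in the open set Ω can be moved a little toward the barycenter of e, into the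
  -- relative interior and still inside Ω.
  obtain ⟨c, hc, hcpos⟩ : ∃ c ∈ e.body, ∀ b ∈ e.verts, 0 < K.bary b c := by
    have hd : 0 < d := by
      rw [← e.card_eq]; exact Finset.card_pos.2 (T.complex.nonempty_of_mem_faces e.mem)
    have hd' : (0 : ℝ) < d := by exact_mod_cast hd
    refine ⟨_, e.barycenter_mem hd, fun b hb => ?_⟩
    have : barycenter e.verts = ∑ c ∈ K.verts, (if c ∈ e.verts then (d : ℝ)⁻¹ else 0) • c := by
      rw [barycenter, e.card_eq, Finset.smul_sum]
      simp only [ite_smul, zero_smul]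
      rw [← Finset.sum_filter, Finset.filter_mem_eq_inter, Finset.inter_eq_right.2 hsub]
    rw [this, K.bary_unique _ (hsub hb), if_pos hb]
    · positivity
    · rw [← Finset.sum_filter, Finset.filter_mem_eq_inter, Finset.inter_eq_right.2 hsub,
        Finset.sum_const, e.card_eq, nsmul_eq_mul, mul_inv_cancel₀ hd'.ne']
  have hcs : Filter.Tendsto (fun s : ℝ => x + s • (c - x)) (nhds 0) (nhds x) := by
    have : Continuous fun s : ℝ => x + s • (c - x) := by fun_prop
    simpa using this.tendsto 0
  have hev : ∀ᶠ s in nhdsWithin (0 : ℝ) (Set.Ioi 0), 0 < s ∧ s < 1 ∧ x + s • (c - x) ∈ Ω.carrier :=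
    Filter.Eventually.and self_mem_nhdsWithin (Filter.Eventually.filter_mono nhdsWithin_le_nhds
      ((eventually_lt_nhds one_pos).and (hcs.eventually (Ω.isOpen.mem_nhds hxΩ))))
  obtain ⟨s, hs0, hs1, hs⟩ := hev.exists
  refine key _ ((convex_convexHull ℝ _).add_smul_sub_mem hx hc ⟨hs0.le, hs1.le⟩) (fun b hb => ?_) hs
  rw [K.bary_line]
  have h1 := K.mem_body.1 (Cell.facet_subset he hx) b (hsub hb)
  have h2 := hcpos b hb
  nlinarith

/-- A point in the open star of a vertex in `Ω` lies in `Ω`. -/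
theorem mem_of_bary_pos_of_mem {K : T.Cell} {b x : Pt d} (hb : b ∈ K.verts) (hbΩ : b ∈ Ω.carrier)
    (hx : x ∈ K.body) (hpos : 0 < K.bary b x) : x ∈ Ω.carrier := by
  have hcs : Filter.Tendsto (fun s : ℝ => b + s • (x - b)) (nhds 0) (nhds b) := by
    have : Continuous fun s : ℝ => b + s • (x - b) := by fun_prop
    simpa using this.tendsto 0
  have hev : ∀ᶠ s in nhdsWithin (0 : ℝ) (Set.Ioi 0), 0 < s ∧ s < 1 ∧ b + s • (x - b) ∈ Ω.carrier :=
    Filter.Eventually.and self_mem_nhdsWithin (Filter.Eventually.filter_mono nhdsWithin_le_nhds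
      ((eventually_lt_nhds one_pos).and (hcs.eventually (Ω.isOpen.mem_nhds hbΩ))))
  obtain ⟨s, hs0, hs1, hs⟩ := hev.exists
  -- The homothety with center b and ratio s takes x to a point p of Ω. For y near x its image lies
  -- in some element K' through p; the homothety scales by s the coordinates other than that of b,
  -- so y lies in K' too. Thus a neighborhood of x lies in the closure of Ω, whose interior is Ω.
  set p := b + s • (x - b) with hp
  have hpK : p ∈ K.body :=
    (convex_convexHull ℝ _).add_smul_sub_mem (subset_convexHull ℝ _ hb) hx ⟨hs0.le, hs1.le⟩
  have hbp : ∀ (K' : T.Cell) (c y : Pt d), K'.bary c (b + s • (y - b)) =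
      (1 - s) * K'.bary c b + s * K'.bary c y := fun K' c y => by rw [K'.bary_line]; ring
  have hz : Filter.Tendsto (fun y : Pt d => b + s • (y - b)) (nhds x) (nhds p) := by
    have : Continuous fun y : Pt d => b + s • (y - b) := by fun_prop
    exact this.tendsto x
  have h3 : ∀ᶠ y in nhds x, ∀ K' : T.Cell, 0 < K'.bary b x → 0 < K'.bary b y := by
    rw [Filter.eventually_all]
    intro K'
    by_cases h : 0 < K'.bary b x
    · exact ((K'.continuous_bary b).continuousAt.eventually (lt_mem_nhds h)).mono fun _ h _ => h
    · exact Filter.Eventually.of_forall fun _ h' => absurd h' h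
  rw [← Ω.interior_closure, mem_interior_iff_mem_nhds]
  filter_upwards [h3, hz.eventually (Ω.isOpen.mem_nhds hs), hz.eventually (eventually_mem_body p)]
    with y hy1 hy2 hy3
  obtain ⟨K', hK'⟩ := T.exists_cell_of_mem (subset_closure hy2)
  have hpK' := hy3 K' hK'
  have hcar : ∀ c ∈ K.verts, 0 < K.bary c x → c ∈ K'.verts := fun c hc hcx => by
    refine Cell.mem_of_bary_pos K'.mem hpK hpK' hc ?_
    rw [hp, hbp]
    have := K.mem_body.1 (subset_convexHull ℝ _ hb) c hc
    have h1s : 0 < 1 - s := by linarith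
    positivity
  have hb' : b ∈ K'.verts := hcar b hb hpos
  have hbx : 0 < K'.bary b x := by
    have h := Cell.bary_congr hpK hpK' hb hb'
    rw [hp, hbp, hbp, K.bary_self hb, K'.bary_self hb'] at h
    have : K.bary b x = K'.bary b x := by
      have := mul_left_cancel₀ hs0.ne' (add_left_cancel h)
      exact this
    rw [← this]
    exact hpos
  refine K'.body_subset_closure (K'.mem_body.2 fun c hc => ?_)
  by_cases hcb : c = b
  · rw [hcb]; exact (hy1 K' hbx).le
  · have h := K'.mem_body.1 hK' c hc
    rw [hbp, K'.bary_ne hc hb' hcb, mul_zero, zero_add] at h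
    exact nonneg_of_mul_nonneg_right h hs0

end Topology

end SimplicialMesh


/-! ### Connectivity of vertex stars through facets -/

namespace SimplicialMesh

section Stars

variable {m : ℕ} {Ω : Domain (m + 1)} {T : SimplicialMesh Ω}

/-- At most m + 1 points span a proper affine subspace of an (m + 1)-dimensional space, which is a
null set. -/
theorem ae_notMem_affineSpan {t : Finset (Pt (m + 1))} (hne : t.Nonempty) (ht : t.card ≤ m + 1) :
    ∀ᵐ q : Pt (m + 1), q ∉ affineSpan ℝ (t : Set (Pt (m + 1))) := by
  refine measure_eq_zero_iff_ae_notMem.1 (Measure.addHaar_affineSubspace _ _ fun h => ?_)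
  have : Nonempty t := hne.to_subtype
  have h1 := finrank_vectorSpan_range_add_one_le ℝ (Subtype.val : t → Pt (m + 1))
  rw [Fintype.card_coe, Subtype.range_coe_subtype] at h1
  have h2 : vectorSpan ℝ {x | x ∈ t} = ⊤ := by
    rw [← direction_affineSpan]
    have h' : affineSpan ℝ {x | x ∈ t} = ⊤ := h
    rw [h', AffineSubspace.direction_top]
  rw [h2, finrank_top, finrank_euclideanSpace_fin] at h1
  omega

theorem Cell.mem_closure_inner {K : T.Cell} {x : Pt (m + 1)} (hx : x ∈ K.body) :
    x ∈ closure K.inner := by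
  change x ∈ closure (interior (convexHull ℝ _))
  rw [(convex_convexHull ℝ _).closure_interior_eq_closure_of_nonempty_interior
    K.inner_nonempty]
  exact subset_closure hx

/-- A nonempty set of elements around a vertex `a` such that every facet of its elements
through `a` is shared within the set consists of all elements around `a`, and `a` is an interior
vertex. -/
theorem star_eq_of_closed {a : Pt (m + 1)} {S : Set T.Cell} (hne : S.Nonempty)
    (ha : ∀ K ∈ S, a ∈ K.verts) (hS : ∀ K ∈ S, ∀ e ∈ K.facets, a ∈ e.verts →
      ∃ K' ∈ S, K ≠ K' ∧ e ∈ K'.facets) :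
    a ∈ Ω.carrier ∧ ∀ K : T.Cell, a ∈ K.verts → K ∈ S := by
  classical
  obtain ⟨K₀, hK₀⟩ := hne
  set U : Set (Pt (m + 1)) := ⋃ K ∈ S, K.body with hU
  have hUc : IsClosed U := (Set.toFinite S).isClosed_biUnion fun K _ => isClosed_body K
  have haK : ∀ K : T.Cell, a ∈ K.verts → a ∈ K.body := fun K h => subset_convexHull ℝ _ h
  -- Near a every facet met contains a, so the sharing hypothesis applies to every facet crossed
  -- there.
  obtain ⟨ε, hε, hB⟩ : ∃ ε > 0, ∀ y ∈ Metric.ball a ε, ∀ e : T.Facet, y ∈ e.body → a ∈ e.verts := by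
    refine Metric.eventually_nhds_iff_ball.1 ?_
    rw [Filter.eventually_all]
    intro e
    by_cases h : a ∈ e.body
    · refine Filter.Eventually.of_forall fun _ _ => ?_
      refine Cell.mem_of_bary_pos e.mem (haK K₀ (ha K₀ hK₀)) h (ha K₀ hK₀) ?_
      rw [K₀.bary_self (ha K₀ hK₀)]
      exact one_pos
    · filter_upwards [e.isCompact_body.isClosed.isOpen_compl.mem_nhds h] with y hy h'
      exact absurd h' hy
  have hnear : ∀ K : T.Cell, a ∈ K.verts → ∃ p ∈ K.inner, p ∈ Metric.ball a ε := fun K h => by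
    obtain ⟨p, hp1, hp2⟩ := mem_closure_iff.1 (Cell.mem_closure_inner (haK K h)) _
      Metric.isOpen_ball (Metric.mem_ball_self hε)
    exact ⟨p, hp2, hp1⟩
  obtain ⟨p, hp, hpB⟩ := hnear K₀ (ha K₀ hK₀)
  let F : T.Cell → Pt (m + 1) → Pt (m + 1) → Finset (Pt (m + 1)) := fun K c c' =>
    (K.verts.erase c).erase c'
  -- Generic q: the segment from p to q must miss every face of codimension 2. Such a face has m
  -- vertices; together with p they span dimension at most m, so almost every q qualifies.
  let Good : Set (Pt (m + 1)) := {q | ∀ K : T.Cell, ∀ c ∈ K.verts, ∀ c' ∈ K.verts, c' ≠ c →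
    q ∉ affineSpan ℝ ((insert p (F K c c') : Finset (Pt (m + 1))) : Set (Pt (m + 1)))}
  have hGood : ∀ᵐ q : Pt (m + 1), q ∈ Good := by
    refine ae_all_iff.2 fun K => ?_
    refine (ae_ball_iff K.verts.countable_toSet).2 fun c hc => ?_
    refine (ae_ball_iff K.verts.countable_toSet).2 fun c' hc' => ?_
    by_cases hcc : c' = c
    · exact Filter.Eventually.of_forall fun _ h => absurd hcc h
    refine (ae_notMem_affineSpan (Finset.insert_nonempty _ _) ?_).mono fun _ h _ => h
    refine (Finset.card_insert_le _ _).trans ?_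
    rw [Finset.card_erase_of_mem (Finset.mem_erase.2 ⟨hcc, hc'⟩), Finset.card_erase_of_mem hc,
      K.card_eq]
    omega
  have key : ∀ q ∈ Metric.ball a ε, q ∈ Good → q ∈ U := by
    intro q hqB hq
    let f : unitInterval → Pt (m + 1) := fun t => p + (t : ℝ) • (q - p)
    have hf : Continuous f := by fun_prop
    -- A connectedness argument along the segment from p to q: membership in U is a closed
    -- condition, and it is open because a facet can only be crossed in its relative interior, where
    -- the neighboring element of S takes over.
    have hopen : IsOpen (f ⁻¹' U) := by
      rw [isOpen_iff_mem_nhds]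
      intro t ht
      refine hf.continuousAt.preimage_mem_nhds ?_
      obtain ⟨K, hK, hx⟩ := Set.mem_iUnion₂.1 ht
      have hKU : ∀ K ∈ S, K.body ⊆ U := fun K hK => Set.subset_biUnion_of_mem (u := Cell.body) hK
      by_cases hin : f t ∈ K.inner
      · exact Filter.mem_of_superset (K.isOpen_inner.mem_nhds hin) (interior_subset.trans (hKU K hK))
      have ht0 : (t : ℝ) ≠ 0 := fun h0 => by
        have hfp : f t = p := by simp [f, h0]
        rw [hfp] at hin hx
        exact hin (Cell.eq_of_mem_inner hp hx ▸ hp)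
      rw [K.mem_inner] at hin
      push Not at hin
      obtain ⟨c, hc, hc0⟩ := hin
      replace hc0 : K.bary c (f t) = 0 := le_antisymm hc0 (K.mem_body.1 hx c hc)
      obtain ⟨e, he, hec⟩ := K.exists_facet (Nat.succ_pos m) hc
      have hxe : f t ∈ e.body := (K.mem_facet_body hc hec).2 ⟨hx, hc0⟩
      have hftB : f t ∈ Metric.ball a ε :=
        (convex_ball a ε).add_smul_sub_mem hpB hqB t.2
      obtain ⟨K', hK', hne, he'⟩ := hS K hK e he (hB _ hftB e hxe)
      refine Filter.mem_of_superset (union_mem_nhds hne he he' hxe fun b hb => ?_)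
        (Set.union_subset (hKU K hK) (hKU K' hK'))
      have hbK := Cell.mem_facets.1 he hb
      refine lt_of_le_of_ne (K.mem_body.1 hx b hbK) fun hb0 => ?_
      have hbc : b ≠ c := by rw [hec] at hb; exact Finset.ne_of_mem_erase hb
      -- If a second coordinate vanished, the crossing point would lie on a face of codimension 2,
      -- and q would lie on the line through p and that point.
      refine hq K c hc b hbK hbc ?_
      have hsub : F K c b ⊆ K.verts := (Finset.erase_subset _ _).trans (Finset.erase_subset _ _)
      have hconv : f t ∈ convexHull ℝ (F K c b : Set (Pt (m + 1))) := by
        refine (K.mem_convexHull hsub).2 ⟨hx, fun z hz hz' => ?_⟩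
        by_cases hzb : z = b
        · rw [hzb, hb0]
        · by_cases hzc : z = c
          · rw [hzc, hc0]
          · exact absurd (Finset.mem_erase.2 ⟨hzb, Finset.mem_erase.2 ⟨hzc, hz⟩⟩) hz'
      have h1 : f t ∈ affineSpan ℝ ((insert p (F K c b) : Finset (Pt (m + 1))) : Set (Pt (m + 1))) :=
        affineSpan_mono ℝ (by simp) (convexHull_subset_affineSpan _ hconv)
      have h2 : p ∈ affineSpan ℝ ((insert p (F K c b) : Finset (Pt (m + 1))) : Set (Pt (m + 1))) :=
        subset_affineSpan ℝ _ (by simp)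
      have h3 := AffineMap.lineMap_mem (t : ℝ)⁻¹ h2 h1
      have h4 : AffineMap.lineMap p (f t) (t : ℝ)⁻¹ = q := by
        rw [AffineMap.lineMap_apply]
        simp [f, smul_smul, ht0]
      rwa [h4] at h3
    have hclopen : IsClopen (f ⁻¹' U) := ⟨hUc.preimage hf, hopen⟩
    have huniv := hclopen.eq_univ ⟨0, by
      simp only [Set.mem_preimage, f, Set.Icc.coe_zero, zero_smul, add_zero]
      exact Set.mem_biUnion hK₀ (interior_subset hp)⟩
    have h1 : (1 : unitInterval) ∈ f ⁻¹' U := by rw [huniv]; trivial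
    simpa [f] using h1
  have hBU : Metric.ball a ε ⊆ U := by
    have hdense : Dense Good := Measure.dense_of_ae hGood
    refine (hdense.open_subset_closure_inter Metric.isOpen_ball).trans
      (hUc.closure_subset_iff.2 fun q hq => key q hq.1 hq.2)
  constructor
  · rw [← Ω.interior_closure, mem_interior_iff_mem_nhds]
    refine Filter.mem_of_superset (Metric.ball_mem_nhds a hε) (hBU.trans ?_)
    exact Set.iUnion₂_subset fun K _ => K.body_subset_closure
  · intro K hK
    obtain ⟨y, hy, hyB⟩ := hnear K hK
    obtain ⟨K', hK', hyK'⟩ := Set.mem_iUnion₂.1 (hBU hyB)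
    rw [Cell.eq_of_mem_inner hy hyK']
    exact hK'

/-- The elements around the vertex `a`, joined when they share a facet through `a`. -/
def starGraph (T : SimplicialMesh Ω) (a : Pt (m + 1)) : SimpleGraph {K : T.Cell // a ∈ K.verts} where
  Adj K K' := K ≠ K' ∧ ∃ e : T.Facet, a ∈ e.verts ∧ e ∈ K.1.facets ∧ e ∈ K'.1.facets
  symm := ⟨fun _ _ ⟨h, e, h0, h1, h2⟩ => ⟨h.symm, e, h0, h2, h1⟩⟩
  loopless := ⟨fun _ h => h.1 rfl⟩

/-- From an element around `a` one reaches a boundary facet through `a`, or else `a` is an interior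
vertex and one reaches every element around `a`. -/
theorem starGraph_dichotomy {a : Pt (m + 1)} (K : {K : T.Cell // a ∈ K.verts}) :
    (∃ K', (starGraph T a).Reachable K K' ∧ ∃ e ∈ K'.1.facets, a ∈ e.verts ∧
      e.body ⊆ frontier Ω.carrier) ∨
    (a ∈ Ω.carrier ∧ ∀ K', (starGraph T a).Reachable K K') := by
  by_cases hb : ∃ K', (starGraph T a).Reachable K K' ∧ ∃ e ∈ K'.1.facets, a ∈ e.verts ∧
      e.body ⊆ frontier Ω.carrier
  · exact Or.inl hb
  push Not at hb
  right
  -- If no boundary facet is reachable, each facet through a of a reachable element has a second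
  -- element, which is reachable as well. So the reachable set is closed under sharing.
  have := star_eq_of_closed (T := T) (a := a)
    (S := {K' | ∃ h : a ∈ K'.verts, (starGraph T a).Reachable K ⟨K', h⟩})
    ⟨K.1, K.2, SimpleGraph.Reachable.refl _⟩ (fun K' h => h.1) fun K' h e he hae => by
      have hbd := hb ⟨K', h.1⟩ h.2 e he hae
      by_contra! hno
      refine hbd (Facet.body_subset_frontier he fun K'' h'' => ?_)
      by_contra hne
      have haK'' : a ∈ K''.verts := Cell.mem_facets.1 h'' hae
      refine hno K'' ⟨haK'', h.2.trans (SimpleGraph.Adj.reachable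
        (⟨fun h => hne (congrArg Subtype.val h).symm, e, hae, he, h''⟩ :
          (starGraph T a).Adj ⟨K', h.1⟩ ⟨K'', haK''⟩))⟩ (fun h => hne h.symm) h''
  exact ⟨this.1, fun K' => (this.2 K'.1 K'.2).2⟩

end Stars

end SimplicialMesh


/-! ### Continuous piecewise affine functions -/

namespace SimplicialMesh

section Nodal

variable {m : ℕ} {Ω : Domain (m + 1)} {T : SimplicialMesh Ω}

theorem sum_bary_congr {K K' : T.Cell} {x : Pt (m + 1)} (hx : x ∈ K.body) (hx' : x ∈ K'.body)
    (val : Pt (m + 1) → ℝ) :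
    ∑ a ∈ K.verts, K.bary a x * val a = ∑ a ∈ K'.verts, K'.bary a x * val a := by
  classical
  have h : ∀ {K K' : T.Cell}, x ∈ K.body → x ∈ K'.body → ∑ a ∈ K.verts, K.bary a x * val a =
      ∑ a ∈ K.verts ∩ K'.verts, K.bary a x * val a := fun {K K'} hx hx' => by
    refine (Finset.sum_subset Finset.inter_subset_left fun a ha ha' => ?_).symm
    have : K.bary a x = 0 := by
      by_contra hne
      exact ha' (Finset.mem_inter.2 ⟨ha, Cell.mem_of_bary_pos K'.mem hx hx' ha
        (lt_of_le_of_ne (K.mem_body.1 hx a ha) (Ne.symm hne))⟩)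
    rw [this, zero_mul]
  rw [h hx hx', h hx' hx, Finset.inter_comm]
  refine Finset.sum_congr rfl fun a ha => ?_
  rw [Finset.mem_inter] at ha
  rw [Cell.bary_congr hx hx' ha.2 ha.1]

/-- Continuous piecewise affine functions with prescribed nodal values. -/
theorem exists_nodal (T : SimplicialMesh Ω) (val : Pt (m + 1) → ℝ)
    (hval : ∀ a ∉ Ω.carrier, val a = 0) :
    ∃ w : T.p1Space, ∀ K : T.Cell, ∀ x ∈ K.body, w.1 x = ∑ a ∈ K.verts, K.bary a x * val a := by
  classical
  let w : Pt (m + 1) → ℝ := fun x =>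
    if h : ∃ K : T.Cell, x ∈ K.body then ∑ a ∈ h.choose.verts, h.choose.bary a x * val a else 0
  have hw : ∀ K : T.Cell, ∀ x ∈ K.body, w x = ∑ a ∈ K.verts, K.bary a x * val a := fun K x hx => by
    have h : ∃ K : T.Cell, x ∈ K.body := ⟨K, hx⟩
    simp only [w, dif_pos h]
    exact sum_bary_congr h.choose_spec hx val
  have hw0 : ∀ x ∉ Ω.carrier, w x = 0 := fun x hx => by
    by_cases h : ∃ K : T.Cell, x ∈ K.body
    · obtain ⟨K, hK⟩ := h
      rw [hw K x hK]
      refine Finset.sum_eq_zero fun a ha => ?_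
      by_cases haΩ : a ∈ Ω.carrier
      · have : K.bary a x = 0 := by
          by_contra hne
          exact hx (mem_of_bary_pos_of_mem ha haΩ hK
            (lt_of_le_of_ne (K.mem_body.1 hK a ha) (Ne.symm hne)))
        rw [this, zero_mul]
      · rw [hval a haΩ, mul_zero]
    · simp only [w, dif_neg h]
  -- Gluing over the finite closed cover by the elements and the complement of Ω.
  have hcont : Continuous w := by
    refine (locallyFinite_of_finite fun o : Option T.Cell =>
      o.elim Ω.carrierᶜ Cell.body).continuous ?_ ?_ ?_
    · refine Set.eq_univ_of_forall fun x => Set.mem_iUnion.2 ?_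
      by_cases hx : x ∈ Ω.carrier
      · obtain ⟨K, hK⟩ := T.exists_cell_of_mem (subset_closure hx)
        exact ⟨some K, hK⟩
      · exact ⟨none, hx⟩
    · rintro (_ | K)
      · exact Ω.isOpen.isClosed_compl
      · exact isClosed_body K
    · rintro (_ | K)
      · exact (continuousOn_const (c := (0 : ℝ))).congr fun x hx => hw0 x hx
      · refine ContinuousOn.congr (Continuous.continuousOn ?_) fun x hx => hw K x hx
        exact continuous_finsetSum _ fun a _ => (K.continuous_bary a).mul continuous_const
  refine ⟨⟨w, hcont, hw0, fun K => ⟨∑ a ∈ K.verts, affPoly (K.bary a) * MvPolynomial.C (val a),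
    sum_mem fun a _ => mul_mem_Poly (affPoly_mem _) (C_mem_Poly 0 _), fun x hx => ?_⟩⟩, hw⟩
  rw [hw K x hx, polyFun_sum]
  exact Finset.sum_congr rfl fun a _ => by rw [polyFun_mul, polyFun_affPoly, polyFun_C]

/-- Zero energy makes w constant on each element, so w has finitely many values on the connected
space and is constant; it vanishes outside the bounded set Ω. No Poincaré inequality is needed. -/
theorem eq_zero_of_p1Energy {w : T.p1Space} (h : ∀ K : T.Cell, p1Energy K w = 0) : w = 0 := by
  have hgrad : ∀ K : T.Cell, ∀ x, sqNorm (gradient _ (cellPoly K w)) x = 0 := fun K x => by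
    have h1 : ∀ i, gradient (m + 1) (cellPoly K w) i = 0 := fun i => by
      refine poly_eq_zero K.isOpen_inner K.inner_nonempty _
        (eqOn_zero_of_integral_sq K.isOpen_inner (continuous_polyFun _).continuousOn
          (K.integrableOn ((continuous_polyFun _).mul (continuous_polyFun _))) ?_)
      refine le_antisymm ?_ (integral_nonneg fun x => mul_self_nonneg _)
      rw [← h K, p1Energy]
      refine setIntegral_mono_on (K.integrableOn ((continuous_polyFun _).mul (continuous_polyFun _)))
        (integrable_sqNorm K _) K.isOpen_inner.measurableSet fun x _ => ?_
      rw [sqNorm_eq, ← sq]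
      exact Finset.single_le_sum (f := fun i => polyFun _ (gradient (m + 1) (cellPoly K w) i) x ^ 2)
        (fun i _ => sq_nonneg _) (Finset.mem_univ i)
    rw [sqNorm_eq]
    exact Finset.sum_eq_zero fun i _ => by rw [h1 i]; simp
  have hconst : ∀ K : T.Cell, ∀ x ∈ K.body, ∀ y ∈ K.body, w.1 y = w.1 x := fun K x hx y hy => by
    have := polyFun_sub_sq_le (p := cellPoly K w) (x := x) (y := y) (M := 0)
      fun z _ => (hgrad K z).le
    rw [zero_mul] at this
    rw [(cellPoly_spec K w).2 x hx, (cellPoly_spec K w).2 y hy]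
    exact sub_eq_zero.1 (pow_eq_zero_iff two_ne_zero |>.1 (le_antisymm this (sq_nonneg _)))
  have hfin : (Set.range w.1).Finite := by
    refine ((Set.finite_range fun K : T.Cell => w.1 K.inner_nonempty.some).insert 0).subset ?_
    rintro _ ⟨x, rfl⟩
    by_cases hx : x ∈ Ω.carrier
    · obtain ⟨K, hK⟩ := T.exists_cell_of_mem (subset_closure hx)
      exact Or.inr ⟨K, hconst K x hK _ (interior_subset K.inner_nonempty.some_mem)⟩
    · exact Or.inl (w.2.2.1 x hx)
  obtain ⟨y, hy⟩ : ∃ y, y ∉ Ω.carrier := by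
    by_contra! hall
    have : Bornology.IsBounded (Set.univ : Set (Pt (m + 1))) :=
      Ω.isBounded.subset fun x _ => hall x
    exact NormedSpace.unbounded_univ ℝ (Pt (m + 1)) this
  have hsub := hfin.countable.isTotallyDisconnected _ subset_rfl (isPreconnected_range w.2.1)
  refine Subtype.ext (funext fun x => ?_)
  have := hsub ⟨x, rfl⟩ ⟨y, rfl⟩
  rw [this, w.2.2.1 y hy]
  rfl

/-- The inscribed balls of radius h/κ are disjoint and lie in the ball of radius 2κh about a;
comparing volumes bounds their number. -/
theorem exists_card_star_le (m : ℕ) {κ : ℝ} (hκ : 1 ≤ κ) : ∃ N : ℕ, 0 < N ∧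
    ∀ {Ω : Domain (m + 1)} {T : SimplicialMesh Ω}, T.Regular κ → ∀ (a : Pt (m + 1))
    (S : Finset T.Cell), (∀ K ∈ S, a ∈ K.verts) → S.card ≤ N := by
  have hκ0 : 0 < κ := by linarith
  refine ⟨⌈(2 * κ ^ 2) ^ (m + 1)⌉₊, Nat.ceil_pos.2 (by positivity), fun {Ω T} hT a S hS => ?_⟩
  have hh := T.h_pos
  have hT' := hT
  choose c hc _ using hT
  have hdisj : Set.PairwiseDisjoint (S : Set T.Cell) fun K => Metric.ball (c K) (T.h / κ) := by
    intro K _ K' _ hne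
    refine Set.disjoint_left.2 fun x hx hx' => hne ?_
    exact Cell.eq_of_mem_inner (Regular.ball_subset_inner (hc K) hx)
      (hc K' (Metric.ball_subset_closedBall hx'))
  have hsub : (⋃ K ∈ S, Metric.ball (c K) (T.h / κ)) ⊆ Metric.closedBall a (2 * κ * T.h) := by
    refine Set.iUnion₂_subset fun K hK x hx => ?_
    rw [mem_closedBall_iff_norm]
    exact Regular.norm_sub_le hT' (hc K (Metric.ball_subset_closedBall hx))
      (subset_convexHull ℝ _ (hS K hK))
  have h1 := measure_mono (μ := volume) hsub
  rw [measure_biUnion_finset hdisj fun K _ => measurableSet_ball] at h1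
  simp only [Measure.addHaar_ball _ _ (show 0 ≤ T.h / κ by positivity),
    Measure.addHaar_closedBall _ _ (show 0 ≤ 2 * κ * T.h by positivity), finrank_euclideanSpace_fin,
    Finset.sum_const, nsmul_eq_mul] at h1
  have hb0 : volume (Metric.ball (0 : Pt (m + 1)) 1) ≠ 0 := (Metric.measure_ball_pos _ _ one_pos).ne'
  have hbt : volume (Metric.ball (0 : Pt (m + 1)) 1) ≠ ⊤ := measure_ball_lt_top.ne
  rw [← mul_assoc, ENNReal.mul_le_mul_iff_left hb0 hbt, ← ENNReal.ofReal_natCast,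
    ← ENNReal.ofReal_mul (by positivity), ENNReal.ofReal_le_ofReal_iff (by positivity)] at h1
  have h2 : (2 * κ * T.h) ^ (m + 1) = (2 * κ ^ 2) ^ (m + 1) * (T.h / κ) ^ (m + 1) := by
    rw [← mul_pow]; congr 1; field_simp
  rw [h2] at h1
  have h3 := le_of_mul_le_mul_right h1 (by positivity)
  exact_mod_cast h3.trans (Nat.le_ceil _)

end Nodal

end SimplicialMesh


/-! ### Nodal averaging error -/

namespace SimplicialMesh

section NodalError

variable {m : ℕ} {Ω : Domain (m + 1)} {T : SimplicialMesh Ω} {P : Pair} {j : ℕ}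

theorem exists_jump_sq_le (m : ℕ) (P : Pair) (j : ℕ) {κ : ℝ} (hκ : 1 ≤ κ) : ∃ C > 0,
    ∀ {Ω : Domain (m + 1)} {T : SimplicialMesh Ω}, T.Regular κ → ∀ (K : T.Cell)
    (v : T.weakSpace P j), ∀ e ∈ K.facets, ∀ x ∈ e.body,
      (cellVal K v x - facetVal e v x) ^ 2 ≤ C * ((T.h ^ m)⁻¹ * jumpEnergy K v) := by
  obtain ⟨C, hC, h⟩ := exists_facet_sq_le m (P.faceDegree j) hκ
  refine ⟨C, hC, fun {Ω T} hT K v e he x hx => ?_⟩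
  have hh := T.h_pos
  obtain ⟨p, hp, hpe⟩ := exists_facet_poly v K e
  have h1 := h hT K e he p hp x hx
  rw [hpe x hx, facet_integral_congr (g := fun x => (cellVal K v x - facetVal e v x) ^ 2)
    fun x hx => by rw [hpe x hx]] at h1
  refine h1.trans ?_
  gcongr
  exact Finset.single_le_sum (f := fun e => ∫ x, (cellVal K v x - facetVal e v x) ^ 2 ∂e.surface)
    (fun e _ => jump_nonneg K e v) he

open Classical in
/-- The value of `v₀` at an interior vertex `a`, taken from some element around `a`; zero at other
points. -/
def nodeVal (v : T.weakSpace P j) (a : Pt (m + 1)) : ℝ :=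
  if h : a ∈ Ω.carrier ∧ ∃ K : T.Cell, a ∈ K.verts then cellVal h.2.choose v a else 0

open Classical in
/-- The jump energy of the elements around a point. -/
def starJump (v : T.weakSpace P j) (a : Pt (m + 1)) : ℝ :=
  ∑ K : T.Cell, if a ∈ K.verts then jumpEnergy K v else 0

theorem starJump_nonneg (v : T.weakSpace P j) (a : Pt (m + 1)) : 0 ≤ starJump v a :=
  Finset.sum_nonneg fun K _ => by split_ifs; exacts [jumpEnergy_nonneg K v, le_rfl]

theorem jumpEnergy_le_starJump (v : T.weakSpace P j) {a : Pt (m + 1)} {K : T.Cell}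
    (ha : a ∈ K.verts) : jumpEnergy K v ≤ starJump v a := by
  classical
  have := Finset.single_le_sum (f := fun K : T.Cell => if a ∈ K.verts then jumpEnergy K v else 0)
    (fun K _ => by split_ifs; exacts [jumpEnergy_nonneg K v, le_rfl]) (Finset.mem_univ K)
  simp only [if_pos ha] at this
  unfold starJump
  convert this

theorem walk_abs_sub_le {V : Type*} {G : SimpleGraph V} {f : V → ℝ} {M : ℝ}
    (h : ∀ u v, G.Adj u v → |f u - f v| ≤ M) {u v : V} (p : G.Walk u v) :
    |f u - f v| ≤ p.length * M := by
  induction p with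
  | nil => simp
  | @cons u v w huv p ih =>
    rw [SimpleGraph.Walk.length_cons, Nat.cast_add, Nat.cast_one]
    have := abs_sub_le (f u) (f v) (f w)
    have := h _ _ huv
    linarith

/-- Passing through a shared facet changes v₀(a) by at most two jumps, v₀ to v_b and v_b to v₀. A
path in the star has fewer steps than there are elements around a, so it costs at most 2N jumps. At
a boundary vertex one more jump reaches v_b = 0, whence 2N + 1; no connectivity of boundary stars is
required. -/
theorem exists_nodeVal_sub_le (m : ℕ) (P : Pair) (j : ℕ) {κ : ℝ} (hκ : 1 ≤ κ) : ∃ C > 0,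
    ∀ {Ω : Domain (m + 1)} {T : SimplicialMesh Ω}, T.Regular κ → ∀ (v : T.weakSpace P j)
    (K : T.Cell), ∀ a ∈ K.verts,
      (cellVal K v a - nodeVal v a) ^ 2 ≤ C * ((T.h ^ m)⁻¹ * starJump v a) := by
  classical
  obtain ⟨C, hC, h⟩ := exists_jump_sq_le m P j hκ
  obtain ⟨N, hN, hstar⟩ := exists_card_star_le m hκ
  refine ⟨(2 * N + 1) ^ 2 * C, by positivity, fun {Ω T} hT v K a ha => ?_⟩
  have hh := T.h_pos
  have hJ := starJump_nonneg v a
  set M : ℝ := √(C * ((T.h ^ m)⁻¹ * starJump v a)) with hM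
  have hM0 : 0 ≤ M := Real.sqrt_nonneg _
  have hM2 : M ^ 2 = C * ((T.h ^ m)⁻¹ * starJump v a) := Real.sq_sqrt (by positivity)
  have hjump : ∀ (K' : T.Cell) (e : T.Facet), e ∈ K'.facets → a ∈ e.verts →
      |cellVal K' v a - facetVal e v a| ≤ M := fun K' e he hae => by
    refine Real.abs_le_sqrt ((h hT K' v e he a (subset_convexHull ℝ _ hae)).trans ?_)
    have := jumpEnergy_le_starJump v (Cell.mem_facets.1 he hae)
    gcongr
  let f : {K : T.Cell // a ∈ K.verts} → ℝ := fun K' => cellVal K'.1 v a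
  have hadj : ∀ u w, (starGraph T a).Adj u w → |f u - f w| ≤ 2 * M := by
    rintro u w ⟨-, e, hae, he1, he2⟩
    have h1 := hjump u.1 e he1 hae
    have h2 := hjump w.1 e he2 hae
    have h3 := abs_sub_le (f u) (facetVal e v a) (f w)
    rw [abs_sub_comm (facetVal e v a) (f w)] at h3
    linarith
  have hreach : ∀ u w, (starGraph T a).Reachable u w → |f u - f w| ≤ 2 * N * M := by
    intro u w ⟨p⟩
    have h1 := walk_abs_sub_le hadj p.toPath.1
    have h2 := p.toPath.2.length_lt
    have h3 : Fintype.card {K : T.Cell // a ∈ K.verts} ≤ N := by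
      rw [Fintype.card_subtype]
      exact hstar hT a _ fun K hK => (Finset.mem_filter.1 hK).2
    have h4 : (p.toPath.1.length : ℝ) ≤ N := by exact_mod_cast h2.le.trans h3
    calc _ ≤ _ := h1
      _ ≤ N * (2 * M) := by gcongr
      _ = _ := by ring
  have hmain : |cellVal K v a - nodeVal v a| ≤ (2 * N + 1) * M := by
    rcases starGraph_dichotomy (T := T) ⟨K, ha⟩ with ⟨K', hK', e, he, hae, hbd⟩ | ⟨haΩ, hall⟩
    · have haΩ : a ∉ Ω.carrier := by
        have := hbd (subset_convexHull ℝ _ hae)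
        rw [Ω.isOpen.frontier_eq] at this
        exact this.2
      have hn : nodeVal v a = 0 := dif_neg fun h => haΩ h.1
      have hf : facetVal e v a = 0 := congrFun (v.2.2.2 e hbd) a
      have h1 := hreach _ _ hK'
      have h2 := hjump K'.1 e he hae
      rw [hf, sub_zero] at h2
      rw [hn, sub_zero]
      have h3 := abs_sub_abs_le_abs_sub (cellVal K v a) (cellVal K'.1 v a)
      change |cellVal K v a - cellVal K'.1 v a| ≤ _ at h1
      linarith
    · have hex : a ∈ Ω.carrier ∧ ∃ K : T.Cell, a ∈ K.verts := ⟨haΩ, K, ha⟩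
      have hn : nodeVal v a = cellVal hex.2.choose v a := dif_pos hex
      have h1 := hreach _ _ (hall ⟨hex.2.choose, hex.2.choose_spec⟩)
      rw [hn]
      change |cellVal K v a - cellVal hex.2.choose v a| ≤ _ at h1
      linarith
  calc (cellVal K v a - nodeVal v a) ^ 2 = |cellVal K v a - nodeVal v a| ^ 2 := (sq_abs _).symm
    _ ≤ ((2 * N + 1) * M) ^ 2 := by gcongr
    _ = _ := by rw [mul_pow, hM2]; ring

/-- The polynomial `v₀ - w` on an element. -/
def errorPoly (K : T.Cell) (v : T.weakSpace P j) (w : T.p1Space) : MvPolynomial (Fin (m + 1)) ℝ :=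
  v.1.1 K - cellPoly K w

theorem errorPoly_mem (K : T.Cell) (v : T.weakSpace P j) (w : T.p1Space) :
    errorPoly K v w ∈ Poly (m + 1) (j + 1) :=
  sub_mem (Poly_mono (by omega) (v.2.1 K)) (Poly_mono (by omega) (cellPoly_spec K w).1)

theorem polyFun_errorPoly {K : T.Cell} (v : T.weakSpace P j) (w : T.p1Space) {x : Pt (m + 1)}
    (hx : x ∈ K.body) : polyFun _ (errorPoly K v w) x = cellVal K v x - w.1 x := by
  rw [errorPoly, map_sub, Pi.sub_apply, (cellPoly_spec K w).2 x hx]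
  rfl

theorem integral_polyFun_sq_nonneg (K : T.Cell) (p : MvPolynomial (Fin (m + 1)) ℝ) :
    0 ≤ ∫ x in K.inner, polyFun _ p x ^ 2 := integral_nonneg fun _ => sq_nonneg _

/-- On K, v₀(x) - w(x) is the convex combination of v₀(x) - v₀(a) and v₀(a) - w(a) over the
vertices. The former is bounded by the mean value inequality, the latter by the chain of jumps. -/
theorem exists_error_le (m : ℕ) (P : Pair) (j : ℕ) {κ : ℝ} (hκ : 1 ≤ κ) : ∃ C > 0,
    ∀ {Ω : Domain (m + 1)} {T : SimplicialMesh Ω}, T.Regular κ → ∀ (v : T.weakSpace P j)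
    (w : T.p1Space), (∀ K : T.Cell, ∀ x ∈ K.body,
      w.1 x = ∑ a ∈ K.verts, K.bary a x * nodeVal v a) → ∀ K : T.Cell,
      ∫ x in K.inner, polyFun _ (errorPoly K v w) x ^ 2 ≤
        C * T.h ^ 2 * (brokenEnergy K v + T.h⁻¹ * ∑ a ∈ K.verts, starJump v a) := by
  obtain ⟨C₁, hC₁, h₁⟩ := exists_nodeVal_sub_le m P j hκ
  obtain ⟨C₂, hC₂, h₂⟩ := exists_cell_sqNorm_le m (j - 1) hκ
  obtain ⟨C₃, hC₃, h₃⟩ := exists_cell_integral_le m hκ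
  have hκ0 : 0 < κ := by linarith
  refine ⟨C₃ * (2 * (C₂ * (2 * κ) ^ 2) + 2 * C₁), by positivity, fun {Ω T} hT v w hw K => ?_⟩
  have hh := T.h_pos
  have hD : 0 ≤ brokenEnergy K v := integral_sqNorm_nonneg K _
  set J := ∑ a ∈ K.verts, starJump v a with hJ
  have hJ0 : 0 ≤ J := Finset.sum_nonneg fun a _ => starJump_nonneg v a
  obtain ⟨c, hc1, hc2⟩ := hT K
  have hgrad : ∀ y ∈ K.body, sqNorm (gradient _ (v.1.1 K)) y ≤
      C₂ * ((T.h ^ (m + 1))⁻¹ * brokenEnergy K v) := fun y hy => by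
    refine (h₂ K c hc2 _ (fun i => pderiv_mem_Poly (v.2.1 K) i) y hy).trans ?_
    have := Cell.setIntegral_ball_le ((Metric.ball_subset_ball (half_le_self (by positivity))).trans
      (Regular.ball_subset_inner hc1)) (continuous_sqNorm (gradient _ (v.1.1 K)))
      (fun y => sqNorm_nonneg _ y)
    gcongr
    exact this
  set M : ℝ := 2 * (C₂ * ((T.h ^ (m + 1))⁻¹ * brokenEnergy K v) * (2 * κ * T.h) ^ 2) +
    2 * (C₁ * ((T.h ^ m)⁻¹ * J)) with hM
  have hpt : ∀ x ∈ K.body, polyFun _ (errorPoly K v w) x ^ 2 ≤ M := fun x hx => by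
    have e1 : polyFun _ (errorPoly K v w) x =
        ∑ a ∈ K.verts, K.bary a x • (cellVal K v x - nodeVal v a) := by
      rw [polyFun_errorPoly v w hx, hw K x hx]
      simp only [smul_eq_mul, mul_sub, Finset.sum_sub_distrib, ← Finset.sum_mul, K.sum_bary, one_mul]
    have e2 := norm_sum_smul_sq_le K.verts (K.mem_body.1 hx) (K.sum_bary x)
      (u := fun a => cellVal K v x - nodeVal v a) (M := M) fun a ha => by
        have haK : a ∈ K.body := subset_convexHull ℝ _ ha
        have f1 : (cellVal K v x - cellVal K v a) ^ 2 ≤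
            C₂ * ((T.h ^ (m + 1))⁻¹ * brokenEnergy K v) * (2 * κ * T.h) ^ 2 := by
          refine (polyFun_sub_sq_le (p := v.1.1 K) fun z hz => hgrad z
            ((convex_convexHull ℝ _).segment_subset haK hx hz)).trans ?_
          have := hT.norm_sub_le hx haK
          gcongr
        have f2 : (cellVal K v a - nodeVal v a) ^ 2 ≤ C₁ * ((T.h ^ m)⁻¹ * J) := by
          refine (h₁ hT v K a ha).trans ?_
          have := Finset.single_le_sum (f := fun a => starJump v a)
            (fun a _ => starJump_nonneg v a) ha
          gcongr
        rw [Real.norm_eq_abs, sq_abs, hM]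
        have f3 := sq_nonneg (cellVal K v x - cellVal K v a - (cellVal K v a - nodeVal v a))
        nlinarith
    rwa [← e1, Real.norm_eq_abs, sq_abs] at e2
  refine (h₃ hT K (continuous_polyFun_sq _) (by positivity) hpt).trans ?_
  have e3 : C₃ * T.h ^ (m + 1) * M = C₃ * (2 * (C₂ * (2 * κ) ^ 2)) * T.h ^ 2 * brokenEnergy K v +
      C₃ * (2 * C₁) * T.h ^ 2 * (T.h⁻¹ * J) := by
    rw [hM]
    field_simp
    ring
  rw [e3]
  have e4 : 0 ≤ C₃ * (2 * (C₂ * (2 * κ) ^ 2)) * T.h ^ 2 * (T.h⁻¹ * J) := by positivity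
  have e5 : 0 ≤ C₃ * (2 * C₁) * T.h ^ 2 * brokenEnergy K v := by positivity
  linarith

/-- Exchange the sums: the jump energy of an element is counted for each of its m + 2 vertices and
each of at most N elements around that vertex. -/
theorem exists_sum_starJump_le (m : ℕ) {κ : ℝ} (hκ : 1 ≤ κ) : ∃ C > 0,
    ∀ {P : Pair} {j : ℕ} {Ω : Domain (m + 1)} {T : SimplicialMesh Ω}, T.Regular κ →
    ∀ v : T.weakSpace P j,
      ∑ K : T.Cell, ∑ a ∈ K.verts, starJump v a ≤ C * ∑ K : T.Cell, jumpEnergy K v := by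
  classical
  obtain ⟨N, hN, hstar⟩ := exists_card_star_le m hκ
  refine ⟨(m + 2) * N, by positivity, fun {P j Ω T} hT v => ?_⟩
  have e1 : ∀ K K' : T.Cell, ∑ a ∈ K.verts, (if a ∈ K'.verts then jumpEnergy K' v else 0) =
      ∑ a ∈ K'.verts, (if a ∈ K.verts then jumpEnergy K' v else 0) := fun K K' => by
    rw [← Finset.sum_filter, ← Finset.sum_filter, Finset.filter_mem_eq_inter,
      Finset.filter_mem_eq_inter, Finset.inter_comm]
  have e2 : ∑ K : T.Cell, ∑ a ∈ K.verts, starJump v a =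
      ∑ K' : T.Cell, ∑ a ∈ K'.verts, ∑ K : T.Cell, (if a ∈ K.verts then jumpEnergy K' v else 0) := by
    calc _ = ∑ K : T.Cell, ∑ K' : T.Cell, ∑ a ∈ K.verts,
          (if a ∈ K'.verts then jumpEnergy K' v else 0) :=
          Finset.sum_congr rfl fun K _ => by
            rw [Finset.sum_comm]
            exact Finset.sum_congr rfl fun a _ => by
              unfold starJump
              exact Finset.sum_congr rfl fun K _ => by congr
      _ = _ := by
          rw [Finset.sum_comm]
          refine Finset.sum_congr rfl fun K' _ => ?_
          rw [Finset.sum_comm]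
          exact Finset.sum_congr rfl fun K _ => e1 K K'
  rw [e2, Finset.mul_sum]
  refine Finset.sum_le_sum fun K' _ => ?_
  have hJ := jumpEnergy_nonneg K' v
  refine (Finset.sum_le_card_nsmul _ _ (N * jumpEnergy K' v) fun a _ => ?_).trans ?_
  · rw [← Finset.sum_filter, Finset.sum_const, nsmul_eq_mul]
    gcongr
    exact_mod_cast hstar hT a _ fun K hK => (Finset.mem_filter.1 hK).2
  · rw [K'.card_eq, nsmul_eq_mul]
    push_cast
    refine le_of_eq ?_
    ring

/-- Every weak function is approximated by a continuous piecewise affine one. -/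
theorem exists_approximation (m : ℕ) (P : Pair) (j : ℕ) {κ : ℝ} (hκ : 1 ≤ κ) : ∃ C > 0,
    ∀ {Ω : Domain (m + 1)} {T : SimplicialMesh Ω}, T.Regular κ → ∀ v : T.weakSpace P j,
    ∃ w : T.p1Space, ∑ K : T.Cell, ∫ x in K.inner, polyFun _ (errorPoly K v w) x ^ 2 ≤
      C * T.h ^ 2 * ∑ K : T.Cell, weakEnergy K v := by
  obtain ⟨C₁, hC₁, h₁⟩ := exists_error_le m P j hκ
  obtain ⟨C₂, hC₂, h₂⟩ := exists_sum_starJump_le m hκ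
  obtain ⟨C₃, hC₃, h₃⟩ := exists_energy_le m P j hκ
  refine ⟨C₁ * ((1 + C₂) * C₃), by positivity, fun {Ω T} hT v => ?_⟩
  have hh := T.h_pos
  obtain ⟨w, hw⟩ := exists_nodal T (nodeVal v) fun a ha => dif_neg fun h => ha h.1
  refine ⟨w, (Finset.sum_le_sum fun K _ => h₁ hT v w hw K).trans ?_⟩
  rw [← Finset.mul_sum, Finset.sum_add_distrib, ← Finset.mul_sum]
  have e1 := h₂ hT v
  have e2 := Finset.sum_le_sum fun K (_ : K ∈ Finset.univ) => h₃ hT K v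
  rw [Finset.sum_add_distrib, ← Finset.mul_sum, ← Finset.mul_sum] at e2
  have hD : 0 ≤ ∑ K : T.Cell, brokenEnergy K v :=
    Finset.sum_nonneg fun K _ => integral_sqNorm_nonneg K _
  have hJ : 0 ≤ T.h⁻¹ * ∑ K : T.Cell, jumpEnergy K v :=
    mul_nonneg (by positivity) (Finset.sum_nonneg fun K _ => jumpEnergy_nonneg K v)
  have e3 : T.h⁻¹ * ∑ K : T.Cell, ∑ a ∈ K.verts, starJump v a ≤
      C₂ * (T.h⁻¹ * ∑ K : T.Cell, jumpEnergy K v) := by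
    calc _ ≤ T.h⁻¹ * (C₂ * ∑ K : T.Cell, jumpEnergy K v) := by gcongr
      _ = _ := by ring
  have e4 : ∑ K : T.Cell, brokenEnergy K v + T.h⁻¹ * ∑ K : T.Cell, ∑ a ∈ K.verts, starJump v a ≤
      (1 + C₂) * (C₃ * ∑ K : T.Cell, weakEnergy K v) := by
    have : 0 ≤ C₂ * ∑ K : T.Cell, brokenEnergy K v := by positivity
    nlinarith
  calc _ ≤ C₁ * T.h ^ 2 * ((1 + C₂) * (C₃ * ∑ K : T.Cell, weakEnergy K v)) := by gcongr
    _ = _ := by ring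

end NodalError

end SimplicialMesh


/-! ### The stable splitting -/

namespace SimplicialMesh

section Splitting

variable {m : ℕ} {Ω : Domain (m + 1)} {T : SimplicialMesh Ω} {P : Pair} {j : ℕ}

theorem sqNorm_sub_le {d : ℕ} (p q : Fin d → MvPolynomial (Fin d) ℝ) (x : Pt d) :
    sqNorm (p - q) x ≤ 2 * sqNorm p x + 2 * sqNorm q x := by
  simp only [sqNorm_eq, Finset.mul_sum, ← Finset.sum_add_distrib]
  refine Finset.sum_le_sum fun i _ => ?_
  rw [Pi.sub_apply, map_sub, Pi.sub_apply]
  nlinarith [sq_nonneg (polyFun d (p i) x + polyFun d (q i) x)]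

/-- Write ∇w = ∇v₀ - ∇(v₀ - w) and apply the inverse estimate to the polynomial v₀ - w; the L² error
bound thus also yields energy stability. -/
theorem exists_p1Energy_le (m : ℕ) (P : Pair) (j : ℕ) {κ : ℝ} (hκ : 1 ≤ κ) : ∃ C > 0,
    ∀ {Ω : Domain (m + 1)} {T : SimplicialMesh Ω}, T.Regular κ → ∀ (K : T.Cell)
    (v : T.weakSpace P j) (w : T.p1Space), p1Energy K w ≤ 2 * brokenEnergy K v +
      C * (T.h ^ 2)⁻¹ * ∫ x in K.inner, polyFun _ (errorPoly K v w) x ^ 2 := by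
  obtain ⟨C₁, hC₁, h₁⟩ := exists_cell_gradient_le m (j + 1) hκ
  obtain ⟨C₂, hC₂, h₂⟩ := exists_cell_integral_le m hκ
  refine ⟨2 * (C₂ * C₁), by positivity, fun {Ω T} hT K v w => ?_⟩
  have hh := T.h_pos
  set I := ∫ x in K.inner, polyFun _ (errorPoly K v w) x ^ 2 with hI
  have hI0 : 0 ≤ I := integral_polyFun_sq_nonneg K _
  have e1 : ∀ y ∈ K.body, sqNorm (gradient _ (errorPoly K v w)) y ≤
      (T.h ^ 2)⁻¹ * (C₁ * ((T.h ^ (m + 1))⁻¹ * I)) := fun y hy => by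
    rw [le_inv_mul_iff₀ (by positivity)]
    exact h₁ hT K _ (errorPoly_mem K v w) y hy
  have e2 := h₂ hT K (continuous_sqNorm _) (by positivity) e1
  have e3 : gradient _ (cellPoly K w) = gradient _ (v.1.1 K) - gradient _ (errorPoly K v w) := by
    rw [← map_sub, errorPoly, sub_sub_cancel]
  have e4 : p1Energy K w ≤ 2 * brokenEnergy K v +
      2 * ∫ x in K.inner, sqNorm (gradient _ (errorPoly K v w)) x := by
    rw [p1Energy, brokenEnergy, e3, ← integral_const_mul, ← integral_const_mul,
      ← integral_add ((integrable_sqNorm K _).const_mul 2) ((integrable_sqNorm K _).const_mul 2)]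
    exact integral_mono (integrable_sqNorm K _) (((integrable_sqNorm K _).const_mul 2).add
      ((integrable_sqNorm K _).const_mul 2)) fun x => sqNorm_sub_le _ _ x
  refine e4.trans (add_le_add le_rfl ?_)
  refine (mul_le_mul_of_nonneg_left e2 two_pos.le).trans (le_of_eq ?_)
  field_simp

/-- The hypothesis ∫f² = ∫fg holds when f is an L² projection of g; the conclusion is that
projections are contractions. -/
theorem integral_mul_self_le {X : Type*} [MeasurableSpace X] {μ : Measure X} {f g : X → ℝ}
    (hf : Integrable (fun x => f x ^ 2) μ) (hg : Integrable (fun x => g x ^ 2) μ)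
    (hfg : Integrable (fun x => f x * g x) μ) (h : ∫ x, f x ^ 2 ∂μ = ∫ x, f x * g x ∂μ) :
    ∫ x, f x ^ 2 ∂μ ≤ ∫ x, g x ^ 2 ∂μ := by
  have h1 : 2 * ∫ x, f x * g x ∂μ ≤ ∫ x, f x ^ 2 ∂μ + ∫ x, g x ^ 2 ∂μ := by
    rw [← integral_const_mul, ← integral_add hf hg]
    refine integral_mono (hfg.const_mul 2) (hf.add hg) fun x => ?_
    change 2 * (f x * g x) ≤ f x ^ 2 + g x ^ 2
    nlinarith [sq_nonneg (f x - g x)]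
  linarith

/-- As v₀ lies in P_j, v₀ - Q₀w = Q₀(v₀ - w), and Q₀ is a contraction. -/
theorem massEnergy_sub_prolong_le (K : T.Cell) (v : T.weakSpace P j) (w : T.p1Space) :
    massEnergy K (v - prolong P j w) ≤ ∫ x in K.inner, polyFun _ (errorPoly K v w) x ^ 2 := by
  set p : Poly (m + 1) j := ⟨(v - prolong P j w).1.1 K, (v - prolong P j w).2.1 K⟩ with hp
  have hpx : ∀ x, polyFun _ p.1 x = cellVal K v x - polyFun _ (projCell j K w).1 x := fun x => by
    change cellVal K (v - prolong P j w) x = _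
    rw [map_sub]
    rfl
  have hc := continuous_polyFun p.1
  have hce := continuous_polyFun (errorPoly K v w)
  refine integral_mul_self_le (f := polyFun _ p.1) (K.integrableOn (hc.pow 2))
    (K.integrableOn (hce.pow 2)) (K.integrableOn (hc.mul hce)) ?_
  have h1 := projCell_spec K w p
  have hi1 : IntegrableOn (fun x => cellVal K v x * polyFun _ p.1 x) K.inner :=
    K.integrableOn ((continuous_cellVal K v).mul hc)
  have hi2 : IntegrableOn (fun x => polyFun _ (projCell j K w).1 x * polyFun _ p.1 x) K.inner :=
    K.integrableOn ((continuous_polyFun _).mul hc)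
  have hi3 : IntegrableOn (fun x => w.1 x * polyFun _ p.1 x) K.inner :=
    K.integrableOn (w.2.1.mul hc)
  have h2 : ∫ x in K.inner, polyFun _ p.1 x ^ 2 = (∫ x in K.inner, cellVal K v x * polyFun _ p.1 x) -
      ∫ x in K.inner, polyFun _ (projCell j K w).1 x * polyFun _ p.1 x := by
    rw [← integral_sub hi1 hi2]
    refine integral_congr_ae (Filter.Eventually.of_forall fun x => ?_)
    change polyFun _ p.1 x ^ 2 = cellVal K v x * polyFun _ p.1 x -
      polyFun _ (projCell j K w).1 x * polyFun _ p.1 x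
    rw [sq, ← sub_mul, ← hpx]
  rw [h2, h1, ← integral_sub hi1 hi3]
  refine setIntegral_congr_fun K.isOpen_inner.measurableSet fun x hx => ?_
  change cellVal K v x * polyFun _ p.1 x - w.1 x * polyFun _ p.1 x = polyFun _ p.1 x * _
  rw [polyFun_errorPoly v w (interior_subset hx)]
  ring

theorem integral_facetVal_sub_prolong_le (e : T.Facet) (v : T.weakSpace P j) (w : T.p1Space) :
    ∫ x, facetVal e (v - prolong P j w) x ^ 2 ∂e.surface ≤
      ∫ x, (facetVal e v x - w.1 x) ^ 2 ∂e.surface := by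
  set p : polyOn e.body (P.faceDegree j) := ⟨(v - prolong P j w).1.2 e, (v - prolong P j w).2.2.1 e⟩
    with hp
  have hpx : ∀ x, p.1 x = facetVal e v x - (projFacet (P.faceDegree j) e w).1 x := fun x => by
    change facetVal e (v - prolong P j w) x = _
    rw [map_sub]
    rfl
  have hc : ContinuousOn p.1 e.body := continuousOn_of_mem_polyOn p.2
  have hv := continuousOn_facetVal e v
  have hw : ContinuousOn w.1 e.body := w.2.1.continuousOn
  have hq : ContinuousOn (projFacet (P.faceDegree j) e w).1 e.body :=
    continuousOn_of_mem_polyOn (projFacet (P.faceDegree j) e w).2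
  refine integral_mul_self_le (f := p.1) (e.integrable (hc.pow 2))
    (e.integrable ((hv.sub hw).pow 2)) (e.integrable (hc.mul (hv.sub hw))) ?_
  have h1 := projFacet_spec e w p
  have hi1 : Integrable (fun x => facetVal e v x * p.1 x) e.surface := e.integrable (hv.mul hc)
  have hi2 : Integrable (fun x => (projFacet (P.faceDegree j) e w).1 x * p.1 x) e.surface :=
    e.integrable (hq.mul hc)
  have hi3 : Integrable (fun x => w.1 x * p.1 x) e.surface := e.integrable (hw.mul hc)
  have h2 : ∫ x, p.1 x ^ 2 ∂e.surface = (∫ x, facetVal e v x * p.1 x ∂e.surface) -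
      ∫ x, (projFacet (P.faceDegree j) e w).1 x * p.1 x ∂e.surface := by
    rw [← integral_sub hi1 hi2]
    refine integral_congr_ae (Filter.Eventually.of_forall fun x => ?_)
    change p.1 x ^ 2 = facetVal e v x * p.1 x - (projFacet (P.faceDegree j) e w).1 x * p.1 x
    rw [sq, ← sub_mul, ← hpx]
  rw [h2, h1, ← integral_sub hi1 hi3]
  refine integral_congr_ae (Filter.Eventually.of_forall fun x => ?_)
  change facetVal e v x * p.1 x - w.1 x * p.1 x = p.1 x * (facetVal e v x - w.1 x)
  ring

theorem integral_sub_sq_le {e : T.Facet} {f g : Pt (m + 1) → ℝ} (hf : ContinuousOn f e.body)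
    (hg : ContinuousOn g e.body) : ∫ x, (f x - g x) ^ 2 ∂e.surface ≤
      2 * (∫ x, f x ^ 2 ∂e.surface) + 2 * ∫ x, g x ^ 2 ∂e.surface := by
  have hf2 : Integrable (fun x => f x ^ 2) e.surface := e.integrable (hf.pow 2)
  have hg2 : Integrable (fun x => g x ^ 2) e.surface := e.integrable (hg.pow 2)
  rw [← integral_const_mul, ← integral_const_mul, ← integral_add (hf2.const_mul 2) (hg2.const_mul 2)]
  refine integral_mono (e.integrable ((hf.sub hg).pow 2)) ((hf2.const_mul 2).add (hg2.const_mul 2))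
    fun x => ?_
  change (f x - g x) ^ 2 ≤ 2 * f x ^ 2 + 2 * g x ^ 2
  nlinarith [sq_nonneg (f x + g x)]

/-- The trace inequality for polynomials. -/
theorem exists_trace_le (m k : ℕ) {κ : ℝ} (hκ : 1 ≤ κ) : ∃ C > 0,
    ∀ {Ω : Domain (m + 1)} {T : SimplicialMesh Ω}, T.Regular κ → ∀ (K : T.Cell), ∀ e ∈ K.facets,
    ∀ p ∈ Poly (m + 1) k, T.h * ∫ x, polyFun _ p x ^ 2 ∂e.surface ≤
      C * ∫ x in K.inner, polyFun _ p x ^ 2 := by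
  obtain ⟨C₁, hC₁, h₁⟩ := exists_cell_sq_le m k hκ
  obtain ⟨C₂, hC₂, h₂⟩ := exists_facet_integral_le m hκ
  refine ⟨C₂ * C₁, by positivity, fun {Ω T} hT K e he p hp => ?_⟩
  have hh := T.h_pos
  have hI := integral_polyFun_sq_nonneg K p
  have e1 := h₂ hT K e he (continuous_polyFun_sq p).continuousOn
    (M := C₁ * ((T.h ^ (m + 1))⁻¹ * ∫ z in K.inner, polyFun _ p z ^ 2)) (by positivity)
    fun x hx => h₁ hT K p hp x (Cell.facet_subset he hx)
  refine (mul_le_mul_of_nonneg_left e1 hh.le).trans (le_of_eq ?_)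
  field_simp
  ring

/-- For u = v - Πw, the face part is u_b = Q_b(v_b - w) with v_b - w = (v₀ - w) - (v₀ - v_b). Since
h‖u₀ - u_b‖² ≤ 2h‖u₀‖² + 2h‖u_b‖², the trace inequality contributes 2C₁ from u₀ and 4C₁ from v₀ - w,
and the jump gets the factor 4. -/
theorem exists_weakInner_sub_le (m : ℕ) (P : Pair) (j : ℕ) {κ : ℝ} (hκ : 1 ≤ κ) : ∃ C > 0,
    ∀ {Ω : Domain (m + 1)} {T : SimplicialMesh Ω}, T.Regular κ → ∀ (v : T.weakSpace P j)
    (w : T.p1Space), weakInner (v - prolong P j w) (v - prolong P j w) ≤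
      C * (∑ K : T.Cell, ∫ x in K.inner, polyFun _ (errorPoly K v w) x ^ 2) +
        4 * T.h * ∑ K : T.Cell, jumpEnergy K v := by
  obtain ⟨C₁, hC₁, h₁⟩ := exists_trace_le m (j + 1) hκ
  obtain ⟨N, hN, hcard⟩ := exists_card_facets_le m
  refine ⟨1 + N * (6 * C₁), by positivity, fun {Ω T} hT v w => ?_⟩
  have hh := T.h_pos
  rw [weakInner_self, Finset.mul_sum, Finset.mul_sum, ← Finset.sum_add_distrib]
  refine Finset.sum_le_sum fun K _ => ?_
  set u := v - prolong P j w with hu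
  set I := ∫ x in K.inner, polyFun _ (errorPoly K v w) x ^ 2 with hI
  have hI0 : 0 ≤ I := integral_polyFun_sq_nonneg K _
  have e1 : massEnergy K u ≤ I := massEnergy_sub_prolong_le K v w
  have e2 : ∀ e ∈ K.facets, T.h * ∫ x, (cellVal K u x - facetVal e u x) ^ 2 ∂e.surface ≤
      6 * C₁ * I + 4 * (T.h * ∫ x, (cellVal K v x - facetVal e v x) ^ 2 ∂e.surface) := by
    intro e he
    have hv := continuousOn_facetVal e v
    have hcv := (continuous_cellVal K v).continuousOn (s := e.body)
    have hw : ContinuousOn w.1 e.body := w.2.1.continuousOn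
    have f1 := integral_sub_sq_le ((continuous_cellVal K u).continuousOn (s := e.body))
      (continuousOn_facetVal e u)
    have f2 := h₁ hT K e he (u.1.1 K) (Poly_mono (by omega) (u.2.1 K))
    have f3 := integral_facetVal_sub_prolong_le e v w
    have f4 := integral_sub_sq_le (hcv.sub hw) (hcv.sub hv)
    have f5 := h₁ hT K e he _ (errorPoly_mem K v w)
    rw [facet_integral_congr (g := fun x => (cellVal K v x - w.1 x) ^ 2) fun x hx => by
      rw [polyFun_errorPoly v w (Cell.facet_subset he hx)]] at f5
    have f6 : ∫ x, (cellVal K v x - w.1 x - (cellVal K v x - facetVal e v x)) ^ 2 ∂e.surface =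
        ∫ x, (facetVal e v x - w.1 x) ^ 2 ∂e.surface :=
      integral_congr_ae (Filter.Eventually.of_forall fun x => by ring)
    change _ ≤ C₁ * massEnergy K u at f2
    change T.h * (∫ x, cellVal K u x ^ 2 ∂e.surface) ≤ _ at f2
    change ∫ x, (cellVal K v x - w.1 x - (cellVal K v x - facetVal e v x)) ^ 2 ∂e.surface ≤
      2 * (∫ x, (cellVal K v x - w.1 x) ^ 2 ∂e.surface) +
      2 * ∫ x, (cellVal K v x - facetVal e v x) ^ 2 ∂e.surface at f4
    rw [f6] at f4
    have g1 := mul_le_mul_of_nonneg_left f1 hh.le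
    have g3 := mul_le_mul_of_nonneg_left f3 hh.le
    have g4 := mul_le_mul_of_nonneg_left f4 hh.le
    have g5 := mul_le_mul_of_nonneg_left e1 hC₁.le
    linarith
  have e3 := Finset.sum_le_sum e2
  rw [← Finset.mul_sum, Finset.sum_add_distrib, Finset.sum_const, nsmul_eq_mul, ← Finset.mul_sum,
    ← Finset.mul_sum] at e3
  change T.h * jumpEnergy K u ≤ _ + 4 * (T.h * jumpEnergy K v) at e3
  have e4 : (K.facets.card : ℝ) * (6 * C₁ * I) ≤ N * (6 * C₁ * I) := by
    gcongr
    exact_mod_cast hcard K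
  linarith

/-- The stable splitting of `V_h` along the auxiliary space. -/
theorem exists_splitting (m : ℕ) (P : Pair) (j : ℕ) {κ : ℝ} (hκ : 1 ≤ κ) : ∃ C > 0,
    ∀ {Ω : Domain (m + 1)} {T : SimplicialMesh Ω}, T.Regular κ → ∀ v : T.weakSpace P j,
    ∃ w : T.p1Space, ∑ K : T.Cell, p1Energy K w ≤ C * ∑ K : T.Cell, weakEnergy K v ∧
      weakInner (v - prolong P j w) (v - prolong P j w) ≤
        C * T.h ^ 2 * ∑ K : T.Cell, weakEnergy K v := by
  obtain ⟨C₁, hC₁, h₁⟩ := exists_approximation m P j hκ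
  obtain ⟨C₂, hC₂, h₂⟩ := exists_p1Energy_le m P j hκ
  obtain ⟨C₃, hC₃, h₃⟩ := exists_weakInner_sub_le m P j hκ
  obtain ⟨C₄, hC₄, h₄⟩ := exists_energy_le m P j hκ
  refine ⟨2 * C₄ + C₂ * C₁ + (C₃ * C₁ + 4 * C₄), by positivity, fun {Ω T} hT v => ?_⟩
  have hh := T.h_pos
  obtain ⟨w, hw⟩ := h₁ hT v
  set G := ∑ K : T.Cell, weakEnergy K v with hG
  have hG0 : 0 ≤ G := Finset.sum_nonneg fun K _ => integral_sqNorm_nonneg K _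
  have e1 := Finset.sum_le_sum fun K (_ : K ∈ Finset.univ) => h₄ hT K v
  rw [Finset.sum_add_distrib, ← Finset.mul_sum, ← Finset.mul_sum] at e1
  have hD : 0 ≤ ∑ K : T.Cell, brokenEnergy K v :=
    Finset.sum_nonneg fun K _ => integral_sqNorm_nonneg K _
  have hJ : 0 ≤ T.h⁻¹ * ∑ K : T.Cell, jumpEnergy K v :=
    mul_nonneg (by positivity) (Finset.sum_nonneg fun K _ => jumpEnergy_nonneg K v)
  refine ⟨w, ?_, ?_⟩
  · have e2 := Finset.sum_le_sum fun K (_ : K ∈ Finset.univ) => h₂ hT K v w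
    rw [Finset.sum_add_distrib, ← Finset.mul_sum, ← Finset.mul_sum] at e2
    have e3 := mul_le_mul_of_nonneg_left hw (show 0 ≤ C₂ * (T.h ^ 2)⁻¹ by positivity)
    have e4 : C₂ * (T.h ^ 2)⁻¹ * (C₁ * T.h ^ 2 * G) = C₂ * C₁ * G := by field_simp
    have e5 : 0 ≤ (C₃ * C₁ + 4 * C₄) * G := by positivity
    rw [← hG] at e1
    linarith
  · have e2 := h₃ hT v w
    have e3 := mul_le_mul_of_nonneg_left hw hC₃.le
    have e4 : 4 * T.h * ∑ K : T.Cell, jumpEnergy K v =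
        4 * T.h ^ 2 * (T.h⁻¹ * ∑ K : T.Cell, jumpEnergy K v) := by field_simp
    have e5 : 4 * T.h ^ 2 * (T.h⁻¹ * ∑ K : T.Cell, jumpEnergy K v) ≤ 4 * T.h ^ 2 * (C₄ * G) :=
      mul_le_mul_of_nonneg_left (by linarith) (by positivity)
    have e6 : 0 ≤ (2 * C₄ + C₂ * C₁) * T.h ^ 2 * G := by positivity
    linarith

end Splitting

end SimplicialMesh


/-! ### Verification of the auxiliary space hypotheses -/

namespace SimplicialMesh

variable {m : ℕ} {Ω : Domain (m + 1)} {T : SimplicialMesh Ω} {P : Pair} {j : ℕ} {α β : ℝ}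

/-- The pair {1, 0} is nonzero. Nontriviality is what makes ρ_A positive. -/
theorem nontrivial_weakSpace : Nontrivial (T.weakSpace P j) := by
  classical
  obtain ⟨x, hx⟩ := Ω.isConnected.nonempty
  obtain ⟨K, -⟩ := T.exists_cell_of_mem (subset_closure hx)
  refine ⟨⟨⟨(fun _ => 1, 0), fun _ => C_mem_Poly j 1, fun _ => zero_mem _, fun _ _ => rfl⟩, 0,
    fun h => ?_⟩⟩
  have := congrFun (congrArg (fun v : T.weakSpace P j => v.1.1) h) K
  exact one_ne_zero this

theorem isInner_p1Form (𝔸 : DiffusionMatrix Ω α β) (hα : 0 < α) : IsInner (p1Form (T := T) 𝔸) where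
  symm := p1Form_symm 𝔸
  pos w hw := by
    have h0 : ∀ K ∈ Finset.univ, 0 ≤ p1Energy K w := fun K _ => integral_sqNorm_nonneg K _
    refine lt_of_lt_of_le (mul_pos hα (lt_of_le_of_ne (Finset.sum_nonneg h0) fun h => hw ?_))
      (p1Form_bounds 𝔸 w).1
    exact eq_zero_of_p1Energy fun K =>
      (Finset.sum_eq_zero_iff_of_nonneg h0).1 h.symm K (Finset.mem_univ K)

/-- Definiteness comes from the splitting: if ∇_w v = 0, the associated w has zero energy, so w = 0,
and v = v - Πw has zero norm. -/
theorem isInner_weakForm (𝔸 : DiffusionMatrix Ω α β) (hα : 0 < α) {κ : ℝ} (hκ : 1 ≤ κ)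
    (hT : T.Regular κ) : IsInner (weakForm (T := T) P j 𝔸) where
  symm := weakForm_symm 𝔸
  pos v hv := by
    have h0 : ∀ K ∈ Finset.univ, 0 ≤ weakEnergy K v := fun K _ => integral_sqNorm_nonneg K _
    refine lt_of_lt_of_le (mul_pos hα (lt_of_le_of_ne (Finset.sum_nonneg h0) fun h => hv ?_))
      (weakForm_bounds 𝔸 v).1
    obtain ⟨C, -, hC⟩ := exists_splitting m P j hκ
    obtain ⟨w, hw1, hw2⟩ := hC hT v
    rw [← h, mul_zero] at hw1 hw2
    have h1 : ∀ K ∈ Finset.univ, 0 ≤ p1Energy K w := fun K _ => integral_sqNorm_nonneg K _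
    have hw : w = 0 := eq_zero_of_p1Energy fun K => (Finset.sum_eq_zero_iff_of_nonneg h1).1
      (le_antisymm hw1 (Finset.sum_nonneg h1)) K (Finset.mem_univ K)
    have h2 := weakInner_definite _ (le_antisymm hw2 (isInner_weakInner.nonneg _))
    rw [hw, map_zero, sub_zero] at h2
    exact h2

/-- The weak Galerkin method with its auxiliary space of continuous piecewise affine functions. -/
theorem exists_auxiliarySpace (m : ℕ) (P : Pair) (j : ℕ) (β κ : ℝ) {α : ℝ} (hα : 0 < α) (hκ : 1 ≤ κ) :
    ∃ C₁ C₂ C₃ : ℝ, ∀ {Ω : Domain (m + 1)} (𝔸 : DiffusionMatrix Ω α β) {T : SimplicialMesh Ω},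
      T.Regular κ → ∀ {R : Module.End ℝ (T.weakSpace P j)} {S : Module.End ℝ T.p1Space}
      {r₀ r₁ b₀ b₁ : ℝ}, 0 < r₀ → 0 < b₀ →
      IsSymmetric weakInner R → IsSymmetric p1Inner S →
      (∀ v, r₀ * ((maxEigenvalue (weakOp P j 𝔸 : Module.End ℝ (T.weakSpace P j)))⁻¹ *
            weakInner v v) ≤ weakInner (R v) v ∧
        weakInner (R v) v ≤
          r₁ * ((maxEigenvalue (weakOp P j 𝔸 : Module.End ℝ (T.weakSpace P j)))⁻¹ *
            weakInner v v)) →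
      (∀ w, b₀ * p1Inner (p1Op 𝔸 w) w ≤ p1Inner (S (p1Op 𝔸 w)) (p1Op 𝔸 w) ∧
        p1Inner (S (p1Op 𝔸 w)) (p1Op 𝔸 w) ≤ b₁ * p1Inner (p1Op 𝔸 w) w) →
      AuxiliarySpace weakInner (weakForm P j 𝔸) p1Inner (p1Form 𝔸) (weakOp P j 𝔸) R (p1Op 𝔸) S
        (prolong P j) (restriction P j) r₀ (max r₁ 0) b₀ (max b₁ 0)
        (maxEigenvalue (weakOp P j 𝔸 : Module.End ℝ (T.weakSpace P j))) C₁ C₂ C₃ := by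
  obtain ⟨C, hC, hsplit⟩ := exists_splitting m P j hκ
  obtain ⟨C', hC', hinv⟩ := exists_weakForm_le m P j β hκ
  -- C₁ bounds β/α from the contraction ∇w ↦ ∇_w Πw. C₂ comes from the energy of w in the splitting.
  -- In C₃ the factor h⁻² of ρ_A meets the factor h² of ‖v - Πw‖².
  refine ⟨|β| / α + 1, (|β| + 1) * C / α, C' * C / α, fun {Ω} 𝔸 {T} hT {R S r₀ r₁ b₀ b₁} hr₀ hb₀
    hR hS hRb hSb => ?_⟩
  have hβ : 0 < β := hα.trans_le (diffusion_le 𝔸)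
  have hh := T.h_pos
  rw [abs_of_pos hβ]
  have ha : IsInner (weakForm (T := T) P j 𝔸) := isInner_weakForm 𝔸 hα hκ hT
  have ha' : IsInner (p1Form (T := T) 𝔸) := isInner_p1Form 𝔸 hα
  have hA : IsSPD weakInner (weakOp P j 𝔸 : Module.End ℝ (T.weakSpace P j)) := by
    refine ⟨fun u v => ?_, fun v hv => ?_⟩
    · rw [weakOp_spec, isInner_weakInner.symm, weakOp_spec, weakForm_symm]
    · rw [weakOp_spec]
      exact ha.pos v hv
  have := nontrivial_weakSpace (T := T) (P := P) (j := j)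
  obtain ⟨hρ, hρle⟩ := maxEigenvalue_pos_and_le isInner_weakInner hA
    (M := C' * (T.h ^ 2)⁻¹) fun v => by
      rw [weakOp_spec]
      exact hinv 𝔸 hα hT v
  have hG : ∀ v : T.weakSpace P j, 0 ≤ ∑ K, weakEnergy K v := fun v =>
    Finset.sum_nonneg fun K _ => integral_sqNorm_nonneg K _
  exact {
    inner_b := isInner_weakInner
    inner_a := ha
    inner_c := isInner_p1Inner
    inner_a' := ha'
    A_spec := weakOp_spec 𝔸
    A'_spec := p1Op_spec 𝔸
    Qt_spec := restriction_spec
    R_symm := hR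
    S_symm := hS
    r₀_pos := hr₀
    b₀_pos := hb₀
    r₁_nonneg := le_max_right _ _
    b₁_nonneg := le_max_right _ _
    ρ_pos := hρ
    C₁_pos := by positivity
    C₂_pos := by positivity
    C₃_pos := by positivity
    R_lower := fun v => (hRb v).1
    R_upper := fun v => (hRb v).2.trans (mul_le_mul_of_nonneg_right (le_max_left _ _)
      (mul_nonneg (inv_nonneg.2 hρ.le) (isInner_weakInner.nonneg v)))
    S_lower := fun w => (hSb w).1
    S_upper := fun w => (hSb w).2.trans (mul_le_mul_of_nonneg_right (le_max_left _ _) (by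
      rw [p1Op_spec]
      exact ha'.nonneg w))
    A_le := fun v => by
      have h := apply_apply_le_maxEigenvalue isInner_weakInner hA.1 (fun v => by
        rw [weakOp_spec]
        exact ha.nonneg v) v
      rwa [weakOp_spec 𝔸 v v] at h
    Q_stable := fun w => (weakForm_prolong_le 𝔸 hα w).trans
      (mul_le_mul_of_nonneg_right (by linarith) (ha'.nonneg w))
    split := fun v => by
      obtain ⟨w, hw1, hw2⟩ := hsplit hT v
      have h1 := (weakForm_bounds 𝔸 v).1
      refine ⟨w, ?_, ?_⟩
      · calc p1Form 𝔸 w w ≤ β * ∑ K, p1Energy K w := (p1Form_bounds 𝔸 w).2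
          _ ≤ (β + 1) * (C * ∑ K, weakEnergy K v) :=
            mul_le_mul (by linarith) hw1 (Finset.sum_nonneg fun K _ => integral_sqNorm_nonneg K _)
              (by linarith)
          _ = (β + 1) * C / α * (α * ∑ K, weakEnergy K v) := by field_simp
          _ ≤ _ := mul_le_mul_of_nonneg_left h1 (by positivity)
      · calc _ ≤ C' * (T.h ^ 2)⁻¹ * (C * T.h ^ 2 * ∑ K, weakEnergy K v) :=
            mul_le_mul hρle hw2 (isInner_weakInner.nonneg _) (by positivity)
          _ = C' * C / α * (α * ∑ K, weakEnergy K v) := by field_simp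
          _ ≤ _ := mul_le_mul_of_nonneg_left h1 (by positivity) }

end SimplicialMesh

end
end WG

/-! ### The preconditioning theorem -/

theorem mainTheorem1 (d : ℕ) (hd : d = 2 ∨ d = 3) (Ω : Domain d) (P : Pair) (j : ℕ)
    (α β σ τ r₀ r₁ b₀ b₁ : ℝ) (hα : 0 < α) (hr₀ : 0 < r₀) (hb₀ : 0 < b₀) :
    ∃ (Cadd : ℝ) (Cmul : ℝ → ℝ), ∀ (𝔸 : DiffusionMatrix Ω α β) (T : SimplicialMesh Ω),
      T.ShapeRegular σ → T.QuasiUniform τ →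
      ∀ (R : Module.End ℝ (T.weakSpace P j)) (S : Module.End ℝ T.p1Space),
        IsSymmetric weakInner R → IsSymmetric p1Inner S →
        (∀ v, r₀ * ((maxEigenvalue (weakOp P j 𝔸 : Module.End ℝ (T.weakSpace P j)))⁻¹ *
              weakInner v v) ≤ weakInner (R v) v ∧
          weakInner (R v) v ≤
            r₁ * ((maxEigenvalue (weakOp P j 𝔸 : Module.End ℝ (T.weakSpace P j)))⁻¹ *
              weakInner v v)) →
        (∀ w, b₀ * p1Inner (p1Op 𝔸 w) w ≤ p1Inner (S (p1Op 𝔸 w)) (p1Op 𝔸 w) ∧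
          p1Inner (S (p1Op 𝔸 w)) (p1Op 𝔸 w) ≤ b₁ * p1Inner (p1Op 𝔸 w) w) →
        (IsSPD weakInner (additive R S) ∧
          condNumber (additive R S * weakOp P j 𝔸) ≤ Cadd) ∧
        ∀ ω : ℝ, ω < 2 →
          (∀ v, weakInner (R (weakOp P j 𝔸 v)) (weakOp P j 𝔸 v) ≤
            ω * weakInner (weakOp P j 𝔸 v) v) →
          (∃! B, IsMultiplicative 𝔸 R S B) ∧
          ∀ B, IsMultiplicative 𝔸 R S B →
            IsSPD weakInner B ∧ condNumber (B * weakOp P j 𝔸) ≤ Cmul ω := by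
  obtain ⟨m, rfl⟩ : ∃ m, d = m + 1 := by
    rcases hd with rfl | rfl
    exacts [⟨1, rfl⟩, ⟨2, rfl⟩]
  obtain ⟨C₁, C₂, C₃, h⟩ := SimplicialMesh.exists_auxiliarySpace m P j β
    (max 1 (max (σ * τ) τ)) hα (le_max_left _ _)
  -- Neither r₁, b₁ ≥ 0 nor ω ≥ 1 is assumed. Replacing them by max r₁ 0, max b₁ 0 and max ω 1 only
  -- weakens the hypotheses, and max ω 1 is still less than 2.
  refine ⟨(max r₁ 0 + max b₁ 0 * C₁) / (2 * (C₃ / r₀ + C₂ / b₀))⁻¹,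
    fun ω => (1 + max b₁ 0 * C₁) / (1 + 2 * (C₃ / r₀ + C₂ / b₀) / (2 - max ω 1))⁻¹,
    fun 𝔸 T hσ hτ R S hR hS hRb hSb => ?_⟩
  have H := h 𝔸 (SimplicialMesh.regular_of_shapeRegular hσ hτ) hr₀ hb₀ hR hS hRb hSb
  refine ⟨⟨H.additive_isSPD, H.additive_condNumber_le⟩, fun ω hω hRω => ?_⟩
  exact H.multiplicative (le_max_right ω 1) (max_lt hω one_lt_two) fun v =>
    (hRω v).trans (mul_le_mul_of_nonneg_right (le_max_left _ _) (by
      rw [H.A_spec]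
      exact H.inner_a.nonneg v))
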